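/- All alphabets below are finite, except that the reconstruction alphabets $\hat{\mathcal X}_c,\hat{\mathcal X}_r$ may be arbitrary. Logarithms are to base 2. A chain $A-B-C$ means that $A$ and $C$ are conditionally independent given $B$. Setup. Let $p_{V_cV_r|U}$ be a memoryless broadcast channel with input alphabet $\mathcal U$ and two receivers $c$ and $r$, and let $\kappa>0$ be rational. A source is an i.i.d. sequence of copies of $(X,Y_c,Y_r)$; $X^n$ is seen by the encoder and $Y_k^n$ is side information at receiver $k\in\{c,r\}$; distortion measures are functions $d_k:\mathcal X\times\hat{\mathcal X}_k\to[0,\infty)$. A pair $(D_c,D_r)$ is achievable at rate $\kappa$ if for every $\epsilon>0$ there is $n_0$ such that for all integers $m>0$, $n>n_0$ with $m/n=\kappa$ there are an encoder $\phi:\mathcal X^n\to\mathcal U^m$ and decoders $\psi_k:\mathcal V_k^m\times\mathcal Y_k^n\to\hat{\mathcal X}_k^n$, $k=c,r$, with $\mathrm E\big[\frac1n\sum_{j=1}^n d_k(X_j,\hat X_{kj})\big]\le D_k+\epsilon$ for $k=c,r$, where $\hat X_k^n=\psi_k(V_k^m,Y_k^n)$ and $(V_c^m,V_r^m)$ is the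 channel output for the input $\phi(X^n)$. Source rates. For a source with distortion measures, $\mathcal R^s_{\rm LDS}(D_c,D_r)$ is the set of all triples $(R_{cc},R_{cr},R_{rr})$ for which there are $Z_c,Z_r$ with $(Y_c,Y_r)-X-Z_r-Z_c$ and functions $g_k:\mathcal Z_k\times\mathcal Y_k\to\hat{\mathcal X}_k$ such that $I(X;Z_c|Y_c)\le R_{cc}$, $I(X;Z_c|Y_r)\le R_{cr}$, $I(X;Z_r|Z_c,Y_r)\le R_{rr}$ and $\mathrm E[d_k(X,g_k(Z_k,Y_k))]\le D_k$ for $k=c,r$. The achievable channel-rate region $\mathcal C_{\rm WZBC}(\kappa)$ is the set of all triples $R$ such that, for every source, all distortion measures and all $(D_c,D_r)$ with $R\in\mathcal R^s_{\rm LDS}(D_c,D_r)$, the pair $(D_c,D_r)$ is achievable at rate $\kappa$. Theorem. Let $\mathcal R^c_{\rm LDS}(\kappa)$ be the union of all $(R_{cc},R_{cr},R_{rr})\in\mathbb R^3$ for which there exist random variables $U_c,U_r,T$, an input $U\in\mathcal U$ and the corresponding channel outputs $V_c,V_r$ with $T-(U_r,U_c)-(V_r,V_c)$ and $(U_r,U_c)-U-(V_r,V_c)$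 such that \begin{align*} R_{cc}&\le\kappa[I(T;V_c)-I(T;U_r)],\\ R_{cr}&\le\kappa[I(T;V_r)-I(T;U_r)],\\ R_{rr}&\le\kappa I(U_r;T,V_r). \end{align*} Then $\mathcal R^c_{\rm LDS}(\kappa)\subseteq\mathcal C_{\rm WZBC}(\kappa)$. In particular, for every source, all distortion measures and all $(D_c,D_r)$ with $\mathcal R^s_{\rm LDS}(D_c,D_r)\cap\mathcal R^c_{\rm LDS}(\kappa)\ne\emptyset$, the pair $(D_c,D_r)$ is achievable at rate $\kappa$. -/

import Mathlib

open scoped NNReal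

universe u v w₁ w₂ w₃

namespace WZBC

noncomputable section

/-! Discrete random variables are functions on a finite sample space `Ω` carrying a probability
mass function `p ∈ stdSimplex ℝ Ω`. -/

section Information

variable {Ω : Type*} [Fintype Ω] {A B C D : Type*}

open Classical in
/-- The probability mass function of the random variable `f`, i.e. `law p f a = Pr[f = a]`. -/
def law (p : Ω → ℝ) (f : Ω → A) (a : A) : ℝ := ∑ ω with f ω = a, p ω

/-- Mutual information `I(f;g)` in bits. -/
def mutualInfo [Fintype A] [Fintype B] (p : Ω → ℝ) (f : Ω → A) (g : Ω → B) : ℝ :=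
  ∑ a, ∑ b, law p (fun ω => (f ω, g ω)) (a, b) *
    Real.logb 2 (law p (fun ω => (f ω, g ω)) (a, b) / (law p f a * law p g b))

/-- Conditional mutual information `I(f;g|h)` in bits. -/
def condMutualInfo [Fintype A] [Fintype B] [Fintype C]
    (p : Ω → ℝ) (f : Ω → A) (g : Ω → B) (h : Ω → C) : ℝ :=
  ∑ a, ∑ b, ∑ c, law p (fun ω => (f ω, g ω, h ω)) (a, b, c) *
    Real.logb 2 ((law p (fun ω => (f ω, g ω, h ω)) (a, b, c) * law p h c) /
      (law p (fun ω => (f ω, h ω)) (a, c) * law p (fun ω => (g ω, h ω)) (b, c)))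

/-- The Markov chain `f - g - h`: `f` and `h` are conditionally independent given `g`. -/
def IsMarkov (p : Ω → ℝ) (f : Ω → A) (g : Ω → B) (h : Ω → C) : Prop :=
  ∀ a b c, law p (fun ω => (f ω, g ω, h ω)) (a, b, c) * law p g b =
    law p (fun ω => (f ω, g ω)) (a, b) * law p (fun ω => (g ω, h ω)) (b, c)

/-- The Markov chain `f - g - h - k` of length four. -/
def IsMarkov₄ (p : Ω → ℝ) (f : Ω → A) (g : Ω → B) (h : Ω → C) (k : Ω → D) : Prop :=
  IsMarkov p f g h ∧ IsMarkov p (fun ω => (f ω, g ω)) h k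

end Information

/-- `W u` is the conditional probability mass function of the output pair `(V_c, V_r)` of the
broadcast channel given the input `u`. -/
def IsChannel {U Vc Vr : Type*} [Fintype Vc] [Fintype Vr] (W : U → Vc × Vr → ℝ) : Prop :=
  ∀ u, W u ∈ stdSimplex ℝ (Vc × Vr)

/-- A code with `m` channel uses for `n` source symbols: an encoder, and a decoder at each of the
receivers `c` and `r`, which sees its channel output and its side information. -/
structure Code (m n : ℕ) (X Yc Yr U Vc Vr Xc Xr : Type*) where
  enc : (Fin n → X) → (Fin m → U)
  decC : (Fin m → Vc) → (Fin n → Yc) → (Fin n → Xc)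
  decR : (Fin m → Vr) → (Fin n → Yr) → (Fin n → Xr)

section Coding

variable {X Yc Yr U Vc Vr Xc Xr : Type*}

/-- Per-letter distortion between two words of length `n`. -/
def blockDist {X Xh : Type*} {n : ℕ} (d : X → Xh → ℝ≥0) (x : Fin n → X) (xh : Fin n → Xh) : ℝ :=
  (1 / (n : ℝ)) * ∑ j, (d (x j) (xh j) : ℝ)

/-- Probability that the memoryless source `(X, Y_c, Y_r)` of law `P` emits the word `s` and the
memoryless channel `W`, fed with the encoded source word, outputs `v`. -/
def blockProb {m n : ℕ} (P : X × Yc × Yr → ℝ) (W : U → Vc × Vr → ℝ)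
    (enc : (Fin n → X) → (Fin m → U)) (s : Fin n → X × Yc × Yr) (v : Fin m → Vc × Vr) : ℝ :=
  (∏ j, P (s j)) * ∏ i, W (enc (fun j => (s j).1) i) (v i)

variable [Fintype X] [Fintype Yc] [Fintype Yr] [Fintype Vc] [Fintype Vr]

/-- Expected distortion of a code at receiver `c`. -/
def expDistC {m n : ℕ} (P : X × Yc × Yr → ℝ) (W : U → Vc × Vr → ℝ) (dC : X → Xc → ℝ≥0)
    (code : Code m n X Yc Yr U Vc Vr Xc Xr) : ℝ :=
  ∑ s : Fin n → X × Yc × Yr, ∑ v : Fin m → Vc × Vr, blockProb P W code.enc s v *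
    blockDist dC (fun j => (s j).1) (code.decC (fun i => (v i).1) (fun j => (s j).2.1))

/-- Expected distortion of a code at receiver `r`. -/
def expDistR {m n : ℕ} (P : X × Yc × Yr → ℝ) (W : U → Vc × Vr → ℝ) (dR : X → Xr → ℝ≥0)
    (code : Code m n X Yc Yr U Vc Vr Xc Xr) : ℝ :=
  ∑ s : Fin n → X × Yc × Yr, ∑ v : Fin m → Vc × Vr, blockProb P W code.enc s v *
    blockDist dR (fun j => (s j).1) (code.decR (fun i => (v i).2) (fun j => (s j).2.2))

/-- The distortion pair `(Dc, Dr)` is achievable for the source `P` over the channel `W` with `κ`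
channel uses per source symbol. -/
def Achievable (P : X × Yc × Yr → ℝ) (W : U → Vc × Vr → ℝ) (dC : X → Xc → ℝ≥0)
    (dR : X → Xr → ℝ≥0) (κ : ℚ) (Dc Dr : ℝ) : Prop :=
  ∀ ε : ℝ, 0 < ε → ∃ n₀ : ℕ, ∀ m n : ℕ, 0 < m → n₀ < n → (m : ℚ) / (n : ℚ) = κ →
    ∃ code : Code m n X Yc Yr U Vc Vr Xc Xr,
      expDistC P W dC code ≤ Dc + ε ∧ expDistR P W dR code ≤ Dr + ε

/-- The source rate region of the layered description scheme: all `(R_cc, R_cr, R_rr)` that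
dominate `(I(X;Z_c|Y_c), I(X;Z_c|Y_r), I(X;Z_r|Z_c,Y_r))` for some auxiliary `Z_c, Z_r` with
`(Y_c,Y_r) - X - Z_r - Z_c` and some reconstruction functions meeting the distortions. -/
def sourceRegionLDS (P : X × Yc × Yr → ℝ) (dC : X → Xc → ℝ≥0) (dR : X → Xr → ℝ≥0)
    (Dc Dr : ℝ) : Set (ℝ × ℝ × ℝ) :=
  {R | ∃ (Ω Zc Zr : Type) (_ : Fintype Ω) (_ : Fintype Zc) (_ : Fintype Zr) (p : Ω → ℝ)
      (x : Ω → X) (yc : Ω → Yc) (yr : Ω → Yr) (zc : Ω → Zc) (zr : Ω → Zr)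
      (gc : Zc × Yc → Xc) (gr : Zr × Yr → Xr),
    p ∈ stdSimplex ℝ Ω ∧
    law p (fun ω => (x ω, yc ω, yr ω)) = P ∧
    IsMarkov₄ p (fun ω => (yc ω, yr ω)) x zr zc ∧
    condMutualInfo p x zc yc ≤ R.1 ∧
    condMutualInfo p x zc yr ≤ R.2.1 ∧
    condMutualInfo p x zr (fun ω => (zc ω, yr ω)) ≤ R.2.2 ∧
    ∑ ω, p ω * (dC (x ω) (gc (zc ω, yc ω)) : ℝ) ≤ Dc ∧
    ∑ ω, p ω * (dR (x ω) (gr (zr ω, yr ω)) : ℝ) ≤ Dr}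

/-- The channel rate region of the layered description scheme at `κ` channel uses per source
symbol. -/
def channelRegionLDS [Fintype U] (W : U → Vc × Vr → ℝ) (κ : ℚ) : Set (ℝ × ℝ × ℝ) :=
  {R | ∃ (Ω Uc Ur T : Type) (_ : Fintype Ω) (_ : Fintype Uc) (_ : Fintype Ur) (_ : Fintype T)
      (p : Ω → ℝ) (uc : Ω → Uc) (ur : Ω → Ur) (t : Ω → T)
      (u : Ω → U) (vc : Ω → Vc) (vr : Ω → Vr),
    p ∈ stdSimplex ℝ Ω ∧
    (∀ a b, law p (fun ω => (u ω, vc ω, vr ω)) (a, b) = law p u a * W a b) ∧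
    IsMarkov p t (fun ω => (ur ω, uc ω)) (fun ω => (vr ω, vc ω)) ∧
    IsMarkov p (fun ω => (ur ω, uc ω)) u (fun ω => (vr ω, vc ω)) ∧
    R.1 ≤ (κ : ℝ) * (mutualInfo p t vc - mutualInfo p t ur) ∧
    R.2.1 ≤ (κ : ℝ) * (mutualInfo p t vr - mutualInfo p t ur) ∧
    R.2.2 ≤ (κ : ℝ) * mutualInfo p ur (fun ω => (t ω, vr ω))}

end Coding

/-- The achievable channel rate region for Wyner-Ziv coding over the broadcast channel `W` with
`κ` channel uses per source symbol: the triples `(R_cc, R_cr, R_rr)` which suffice for every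
discrete memoryless source with side information and all distortion measures, in the sense that
each distortion pair whose source rate region contains the triple is achievable over the channel. -/
def capacityWZBC {U : Type w₁} {Vc : Type w₂} {Vr : Type w₃} [Fintype Vc] [Fintype Vr]
    (W : U → Vc × Vr → ℝ) (κ : ℚ) : Set (ℝ × ℝ × ℝ) :=
  {R | ∀ (X Yc Yr : Type u) (Xc Xr : Type v) [Fintype X] [Fintype Yc] [Fintype Yr]
      (P : X × Yc × Yr → ℝ) (dC : X → Xc → ℝ≥0) (dR : X → Xr → ℝ≥0) (Dc Dr : ℝ),
    P ∈ stdSimplex ℝ (X × Yc × Yr) →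
    R ∈ sourceRegionLDS P dC dR Dc Dr →
    Achievable P W dC dR κ Dc Dr}

end

end WZBC

/-! The proof uses one random code in which source and channel codewords are indexed together; no
bits are passed between separate codes. For auxiliaries (Zc, Zr) and (T, Ur, Uc) there are about
2^(n I(X;Zc)) clusters. A cluster has a centre word zc, about 2^(n I(X;Zr|Zc)) satellites, each a
word zr drawn given zc paired with an independent word ur, and about 2^(m I(T;Ur)) words t. The
encoder selects a triple (centre, satellite, t) such that (zc, zr) fits x and t fits ur. Thus ur
carries the refinement zr and acts as known interference for t, in the manner of Gelfand and
Pinsker. The channel input is drawn given (t, ur), with Uc averaged out. Receiver c decodes (zc, t)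
and receiver r the whole triple, each with one metric for side information and channel output.

Receiver c rejects wrong clusters if n I(X;Zc) + m I(T;Ur) < n I(Yc;Zc) + m I(T;Vc). Since Yc - X -
Zc, the difference I(X;Zc) - I(Yc;Zc) is I(X;Zc|Yc), and this is the R_cc condition. For receiver r
a wrong satellite alone gives the R_rr condition and a wrong cluster gives the sum of the R_cr and
R_rr conditions. The remaining error events follow because the quantities involved are nonnegative.

Encoder and decoders draw an index with probability proportional to a likelihood. Success then
involves the reciprocal of a product of two random normalizers, which `three_sub_sub_le_one_div_mul`
bounds below by an affine expression, so that only the conditional means given the sent word matter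
(`sum_codebook_mul_sum`, `le_sum_likelihood_coding`). Chebyshev's inequality controls the atypical
words, and `exists_code` combines this with derandomization.

The region is closed, so the inequalities may hold with equality. Slack comes from time sharing: a
small part of the source uses a letter without description, and a small part of the channel uses the
letter of `exists_mixing_letter`. If that letter carries no information for a receiver, the output
there does not depend on the input. Then the relevant source rates are at most 0, and
`exists_estimate_of_condMutualInfo_eq_zero` gives an estimate from the side information alone.
`achievable_of_letters` and `achievable_of_mem` assemble these pieces. -/

namespace WZBC
noncomputable section

/-! ### Expectations over families of independent variables -/

section ProductSums

variable {ι : Type*} [Fintype ι] [DecidableEq ι]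

open Classical in
theorem sum_pi_prod_mul_apply {α : ι → Type*} [∀ i, Fintype (α i)] (w : ∀ i, α i → ℝ)
    (hw : ∀ i, ∑ x, w i x = 1) (i : ι) (F : α i → ℝ) :
    ∑ c : ∀ i, α i, (∏ k, w k (c k)) * F (c i) = ∑ x, w i x * F x := by
  have key : ∀ x : α i, ∑ c : ∀ i, α i, (∏ k, w k (c k)) * (if c i = x then 1 else 0) = w i x := by
    intro x
    -- Expanding the product of sums over a box whose side `i` is the singleton `{x}` and whose
    -- other sides are full isolates the words with `c i = x`.
    have h := Finset.prod_univ_sum (fun k => Function.update (fun k => (Finset.univ : Finset (α k))) i {x} k) w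
    rw [Finset.prod_eq_single i] at h
    · simp only [Function.update_self, Finset.sum_singleton] at h
      rw [h]
      simp only [mul_ite, mul_one, mul_zero]
      rw [← Finset.sum_filter]
      refine Finset.sum_congr ?_ fun _ _ => rfl
      ext c
      simp only [Finset.mem_filter, Finset.mem_univ, true_and, Fintype.mem_piFinset]
      constructor
      · rintro rfl k
        by_cases hk : k = i
        · subst hk; simp
        · simp [Function.update_of_ne hk]
      · intro hc
        simpa using hc i
    · intro b _ hb
      simp [Function.update_of_ne hb, hw]
    · simp
  calc _ = ∑ c : ∀ i, α i, ∑ x, ((∏ k, w k (c k)) * (if c i = x then 1 else 0)) * F x := by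
        refine Finset.sum_congr rfl fun c _ => ?_
        simp
    _ = _ := by
        rw [Finset.sum_comm]
        refine Finset.sum_congr rfl fun x _ => ?_
        rw [← Finset.sum_mul, key]

open Classical in
theorem sum_pi_prod_mul_apply_apply {α : ι → Type*} [∀ i, Fintype (α i)] (w : ∀ i, α i → ℝ)
    (hw : ∀ i, ∑ x, w i x = 1) {i j : ι} (hij : i ≠ j) (F : α i → α j → ℝ) :
    ∑ c : ∀ i, α i, (∏ k, w k (c k)) * F (c i) (c j) = ∑ x, ∑ y, w i x * w j y * F x y := by
  have key : ∀ (x : α i) (y : α j), ∑ c : ∀ i, α i, (∏ k, w k (c k)) *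
      ((if c i = x then 1 else 0) * (if c j = y then 1 else 0)) = w i x * w j y := by
    intro x y
    have h := Finset.prod_univ_sum (fun k => Function.update (Function.update
      (fun k => (Finset.univ : Finset (α k))) i {x}) j {y} k) w
    rw [Finset.prod_eq_mul i j hij] at h
    · simp only [Function.update_self, Finset.sum_singleton, Function.update_of_ne hij] at h
      rw [h]
      simp only [← ite_and, mul_ite, mul_one, mul_zero]
      rw [← Finset.sum_filter]
      refine Finset.sum_congr ?_ fun _ _ => rfl
      ext c
      simp only [Finset.mem_filter, Finset.mem_univ, true_and, Fintype.mem_piFinset]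
      constructor
      · rintro ⟨rfl, rfl⟩ k
        by_cases hk : k = j
        · subst hk; simp
        · rw [Function.update_of_ne hk]
          by_cases hk' : k = i
          · subst hk'; simp
          · simp [Function.update_of_ne hk']
      · intro hc
        have h1 := hc i
        have h2 := hc j
        rw [Function.update_of_ne hij] at h1
        simp at h1 h2
        exact ⟨h2, h1⟩
    · rintro b _ ⟨hb, hb'⟩
      simp [Function.update_of_ne hb, Function.update_of_ne hb', hw]
    · simp
    · simp
  calc _ = ∑ c : ∀ i, α i, ∑ x, ∑ y, ((∏ k, w k (c k)) *
        ((if c i = x then 1 else 0) * (if c j = y then 1 else 0))) * F x y := by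
        refine Finset.sum_congr rfl fun c _ => ?_
        simp
    _ = _ := by
        rw [Finset.sum_comm]
        refine Finset.sum_congr rfl fun x _ => ?_
        rw [Finset.sum_comm]
        refine Finset.sum_congr rfl fun y _ => ?_
        rw [← Finset.sum_mul, key]

theorem sum_pi_prod {α : ι → Type*} [∀ i, Fintype (α i)] (w : ∀ i, α i → ℝ) :
    ∑ c : ∀ i, α i, ∏ k, w k (c k) = ∏ k, ∑ x, w k x := by
  rw [Finset.prod_univ_sum, Fintype.piFinset_univ]

theorem sum_pi_prod_eq_one {α : ι → Type*} [∀ i, Fintype (α i)] (w : ∀ i, α i → ℝ)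
    (hw : ∀ i, ∑ x, w i x = 1) : ∑ c : ∀ i, α i, ∏ k, w k (c k) = 1 := by
  rw [sum_pi_prod]; simp [hw]

/-- Second-moment identity for i.i.d. families: the diagonal term is separated from the
off-diagonal ones. -/
theorem sum_pi_prod_mul_sum {α : Type*} [Fintype α] (w : α → ℝ) (hw : ∑ x, w x = 1) (i : ι)
    (H : α → α → ℝ) :
    ∑ c : ι → α, (∏ k, w (c k)) * ∑ i', H (c i) (c i') =
      ∑ x, w x * (H x x + ((Fintype.card ι : ℝ) - 1) * ∑ y, w y * H x y) := by
  have h1 : ∀ i' ∈ Finset.univ.erase i, ∑ c : ι → α, (∏ k, w (c k)) * H (c i) (c i') =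
      ∑ x, ∑ y, w x * w y * H x y := fun i' hi' =>
    sum_pi_prod_mul_apply_apply (fun _ => w) (fun _ => hw) (Finset.ne_of_mem_erase hi').symm H
  simp only [Finset.mul_sum]
  rw [Finset.sum_comm, ← Finset.add_sum_erase _ _ (Finset.mem_univ i), Finset.sum_congr rfl h1,
    sum_pi_prod_mul_apply (fun _ => w) (fun _ => hw) i (fun x => H x x), Finset.sum_const,
    Finset.card_erase_of_mem (Finset.mem_univ i), Finset.card_univ, nsmul_eq_mul,
    Nat.cast_sub (Fintype.card_pos_iff.mpr ⟨i⟩), Finset.mul_sum, ← Finset.sum_add_distrib]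
  refine Finset.sum_congr rfl fun x _ => ?_
  rw [mul_add, Finset.mul_sum, Finset.mul_sum, Nat.cast_one]
  congr 1
  refine Finset.sum_congr rfl fun y _ => by ring

/-- Variance of a sum of independent centred variables. -/
theorem sum_pi_prod_mul_sq {α : ι → Type*} [∀ i, Fintype (α i)] (w : ∀ i, α i → ℝ)
    (hw : ∀ i, ∑ x, w i x = 1) (f : ∀ i, α i → ℝ) (hf : ∀ i, ∑ x, w i x * f i x = 0) :
    ∑ c : ∀ i, α i, (∏ k, w k (c k)) * (∑ i, f i (c i)) ^ 2 = ∑ i, ∑ x, w i x * f i x ^ 2 := by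
  have h0 : ∀ i j, ∑ c : ∀ i, α i, (∏ k, w k (c k)) * (f i (c i) * f j (c j)) =
      if i = j then ∑ x, w i x * f i x ^ 2 else 0 := by
    intro i j
    split_ifs with h
    · subst h
      rw [sum_pi_prod_mul_apply w hw i (fun x => f i x * f i x)]
      simp [sq]
    · rw [sum_pi_prod_mul_apply_apply w hw h (fun x y => f i x * f j y)]
      calc _ = ∑ x, (w i x * f i x) * ∑ y, w j y * f j y := by
            refine Finset.sum_congr rfl fun x _ => ?_
            rw [Finset.mul_sum]
            exact Finset.sum_congr rfl fun y _ => by ring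
        _ = 0 := by simp [hf]
  have h1 : ∀ c : ∀ i, α i, (∏ k, w k (c k)) * (∑ i, f i (c i)) ^ 2 =
      ∑ i, ∑ j, (∏ k, w k (c k)) * (f i (c i) * f j (c j)) := by
    intro c
    rw [sq, Finset.sum_mul_sum, Finset.mul_sum]
    exact Finset.sum_congr rfl fun i _ => Finset.mul_sum _ _ _
  rw [Finset.sum_congr rfl fun c _ => h1 c, Finset.sum_comm]
  refine Finset.sum_congr rfl fun i _ => ?_
  rw [Finset.sum_comm, Finset.sum_congr rfl fun j _ => h0 i j]
  simp

open Classical in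
/-- Chebyshev's inequality for a sum of independent variables with bounded second moments. -/
theorem prob_abs_sum_sub_mean_gt_le {α : ι → Type*} [∀ i, Fintype (α i)] (w : ∀ i, α i → ℝ)
    (hw0 : ∀ i x, 0 ≤ w i x) (hw : ∀ i, ∑ x, w i x = 1) (f : ∀ i, α i → ℝ) {C h : ℝ} (hh : 0 < h)
    (hC : ∀ i, ∑ x, w i x * f i x ^ 2 ≤ C) :
    (∑ c : ∀ i, α i, (∏ k, w k (c k)) *
      if h < |∑ i, f i (c i) - ∑ i, ∑ x, w i x * f i x| then 1 else 0) ≤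
      Fintype.card ι * C / h ^ 2 := by
  set g : ∀ i, α i → ℝ := fun i x => f i x - ∑ x, w i x * f i x with hg
  have hg0 : ∀ i, ∑ x, w i x * g i x = 0 := by
    intro i
    simp only [hg, mul_sub, Finset.sum_sub_distrib, ← Finset.sum_mul, hw, one_mul, sub_self]
  have hgC : ∀ i, ∑ x, w i x * g i x ^ 2 ≤ C := by
    intro i
    refine le_trans ?_ (hC i)
    set μ := ∑ x, w i x * f i x with hμ
    have : ∑ x, w i x * g i x ^ 2 = ∑ x, w i x * f i x ^ 2 - μ ^ 2 := by
      calc _ = ∑ x, (w i x * f i x ^ 2 - 2 * μ * (w i x * f i x) + μ ^ 2 * w i x) :=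
            Finset.sum_congr rfl fun x _ => by simp only [hg, ← hμ]; ring
        _ = _ := by
            rw [Finset.sum_add_distrib, Finset.sum_sub_distrib, ← Finset.mul_sum, ← Finset.mul_sum,
              hw, ← hμ]
            ring
    rw [this]
    nlinarith [sq_nonneg μ]
  have hsq := sum_pi_prod_mul_sq w hw g hg0
  rw [le_div_iff₀ (by positivity), Finset.sum_mul]
  calc _ ≤ ∑ c : ∀ i, α i, (∏ k, w k (c k)) * (∑ i, g i (c i)) ^ 2 := by
        refine Finset.sum_le_sum fun c _ => ?_
        have hp : 0 ≤ ∏ k, w k (c k) := Finset.prod_nonneg fun k _ => hw0 k _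
        rw [mul_assoc]
        refine mul_le_mul_of_nonneg_left ?_ hp
        have e : ∑ i, g i (c i) = ∑ i, f i (c i) - ∑ i, ∑ x, w i x * f i x := by
          simp [hg]
        rw [e]
        split_ifs with hlt
        · rw [one_mul, ← sq_abs (_ - _)]
          exact pow_le_pow_left₀ hh.le hlt.le 2
        · rw [zero_mul]; positivity
    _ ≤ _ := by
        rw [hsq]
        calc _ ≤ ∑ _i : ι, C := Finset.sum_le_sum fun i _ => hgC i
          _ = _ := by simp

end ProductSums

/-! ### First and second moments of the superposition codebook -/

section Codebook

variable {I K J A B T : Type*} [Fintype I] [Fintype K] [Fintype J] [Fintype A] [Fintype B]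
  [Fintype T] [DecidableEq I] [DecidableEq K] [DecidableEq J]

/-- Probability of a cluster of a superposition codebook: a centre `a ∼ pa`, satellites
`b k ∼ β a` and channel codewords `t j ∼ q`. -/
def clusterProb (pa : A → ℝ) (β : A → B → ℝ) (q : T → ℝ) (c : A × (K → B) × (J → T)) : ℝ :=
  pa c.1 * ((∏ k, β c.1 (c.2.1 k)) * ∏ j, q (c.2.2 j))

/-- The codeword with index `(i, k, j)`. -/
def codeword (c : I → A × (K → B) × (J → T)) (l : I × K × J) : A × B × T :=
  ((c l.1).1, (c l.1).2.1 l.2.1, (c l.1).2.2 l.2.2)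

/-- Probability of a single codeword. -/
def codewordProb (pa : A → ℝ) (β : A → B → ℝ) (q : T → ℝ) (w : A × B × T) : ℝ :=
  pa w.1 * (β w.1 w.2.1 * q w.2.2)

/-- Conditional expectation of the sum of `f` over all codewords, given that one of them is `w`. -/
def codebookMean (I K J : Type*) [Fintype I] [Fintype K] [Fintype J] (pa : A → ℝ)
    (β : A → B → ℝ) (q : T → ℝ) (f : A × B × T → ℝ) (w : A × B × T) : ℝ :=
  f w + ((Fintype.card J : ℝ) - 1) * ∑ t, q t * f (w.1, w.2.1, t)
    + ((Fintype.card K : ℝ) - 1) * ∑ b, β w.1 b * f (w.1, b, w.2.2)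
    + ((Fintype.card K : ℝ) - 1) * ((Fintype.card J : ℝ) - 1) *
      ∑ b, β w.1 b * ∑ t, q t * f (w.1, b, t)
    + ((Fintype.card I : ℝ) - 1) * (Fintype.card K * Fintype.card J *
      ∑ a, pa a * ∑ b, β a b * ∑ t, q t * f (a, b, t))

variable {pa : A → ℝ} {β : A → B → ℝ} {q : T → ℝ}

theorem sum_clusterProb_mul (hβ : ∀ a, ∑ b, β a b = 1) (hq : ∑ t, q t = 1) (k : K) (j : J)
    (f : A × B × T → ℝ) :
    ∑ c : A × (K → B) × (J → T), clusterProb pa β q c * f (c.1, c.2.1 k, c.2.2 j) =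
      ∑ a, pa a * ∑ b, β a b * ∑ t, q t * f (a, b, t) := by
  rw [Fintype.sum_prod_type]
  refine Finset.sum_congr rfl fun a _ => ?_
  rw [← sum_pi_prod_mul_apply (fun _ => β a) (fun _ => hβ a) k (fun b => ∑ t, q t * f (a, b, t)),
    Fintype.sum_prod_type, Finset.mul_sum]
  refine Finset.sum_congr rfl fun b _ => ?_
  rw [← sum_pi_prod_mul_apply (fun _ => q) (fun _ => hq) j (fun t => f (a, b k, t)),
    Finset.mul_sum, Finset.mul_sum]
  refine Finset.sum_congr rfl fun t _ => ?_
  simp only [clusterProb]; ring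

/-- The words of one cluster share their centre, so a second word `(k', j')` falls into one of four
cases, according to whether `k' = k` and whether `j' = j`. The second-moment identity is used for
the channel codewords with the satellites fixed, and then for the satellites. -/
theorem sum_clusterProb_mul_sum (hβ : ∀ a, ∑ b, β a b = 1) (hq : ∑ t, q t = 1) (k : K) (j : J)
    (h f : A × B × T → ℝ) :
    ∑ c : A × (K → B) × (J → T), clusterProb pa β q c *
      (h (c.1, c.2.1 k, c.2.2 j) * ∑ k', ∑ j', f (c.1, c.2.1 k', c.2.2 j')) =
    ∑ a, pa a * ∑ b, β a b * ∑ t, q t * (h (a, b, t) * (f (a, b, t)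
      + ((Fintype.card J : ℝ) - 1) * ∑ t', q t' * f (a, b, t')
      + ((Fintype.card K : ℝ) - 1) * ∑ b', β a b' * f (a, b', t)
      + ((Fintype.card K : ℝ) - 1) * ((Fintype.card J : ℝ) - 1) *
        ∑ b', β a b' * ∑ t', q t' * f (a, b', t'))) := by
  rw [Fintype.sum_prod_type]
  refine Finset.sum_congr rfl fun a _ => ?_
  have h1 : ∀ b : K → B, ∑ t : J → T, (∏ j, q (t j)) * ∑ j', (h (a, b k, t j) *
      ∑ k', f (a, b k', t j')) = ∑ k', ∑ t, q t * (h (a, b k, t) * (f (a, b k', t) +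
        ((Fintype.card J : ℝ) - 1) * ∑ t', q t' * f (a, b k', t'))) := by
    intro b
    rw [sum_pi_prod_mul_sum q hq j (fun t t' => h (a, b k, t) * ∑ k', f (a, b k', t')),
      Finset.sum_comm]
    refine Finset.sum_congr rfl fun t _ => ?_
    rw [← Finset.mul_sum, ← Finset.mul_sum, Finset.sum_add_distrib, ← Finset.mul_sum,
      Finset.sum_comm]
    simp only [Finset.mul_sum, mul_add]
    congr 1
    refine Finset.sum_congr rfl fun t' _ => Finset.sum_congr rfl fun k' _ => by ring
  have h2 := sum_pi_prod_mul_sum (β a) (hβ a) k (fun b b' => ∑ t, q t * (h (a, b, t) *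
    (f (a, b', t) + ((Fintype.card J : ℝ) - 1) * ∑ t', q t' * f (a, b', t'))))
  calc _ = pa a * ∑ b : K → B, (∏ k, β a (b k)) * ∑ t : J → T, (∏ j, q (t j)) *
        ∑ j', (h (a, b k, t j) * ∑ k', f (a, b k', t j')) := by
        rw [Fintype.sum_prod_type, Finset.mul_sum]
        refine Finset.sum_congr rfl fun b _ => ?_
        rw [Finset.mul_sum, Finset.mul_sum]
        refine Finset.sum_congr rfl fun t _ => ?_
        rw [← Finset.mul_sum, Finset.sum_comm (s := (Finset.univ : Finset J))]
        simp only [clusterProb]; ring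
    _ = _ := by
        rw [Finset.sum_congr rfl fun b _ => by rw [h1 b], h2]
        congr 1
        refine Finset.sum_congr rfl fun b _ => ?_
        congr 1
        have h3 : ∑ b', β a b' * ∑ t, q t * (h (a, b, t) * (f (a, b', t) +
            ((Fintype.card J : ℝ) - 1) * ∑ t', q t' * f (a, b', t'))) =
            ∑ t, q t * (h (a, b, t) * (∑ b', β a b' * f (a, b', t) +
              ((Fintype.card J : ℝ) - 1) * ∑ b', β a b' * ∑ t', q t' * f (a, b', t'))) := by
          simp only [Finset.mul_sum (s := (Finset.univ : Finset B)), mul_add, Finset.mul_sum (s := (Finset.univ : Finset T)), Finset.sum_add_distrib]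
          congr 1
          · rw [Finset.sum_comm]
            exact Finset.sum_congr rfl fun t _ => Finset.sum_congr rfl fun b' _ => by ring
          · rw [Finset.sum_comm]
            exact Finset.sum_congr rfl fun t _ => Finset.sum_congr rfl fun b' _ =>
              Finset.sum_congr rfl fun t' _ => by ring
        rw [h3, Finset.mul_sum Finset.univ _ ((Fintype.card K : ℝ) - 1), ← Finset.sum_add_distrib]
        exact Finset.sum_congr rfl fun t _ => by ring

theorem sum_clusterProb (hpa : ∑ a, pa a = 1) (hβ : ∀ a, ∑ b, β a b = 1) (hq : ∑ t, q t = 1) :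
    ∑ c : A × (K → B) × (J → T), clusterProb pa β q c = 1 := by
  rw [Fintype.sum_prod_type, ← hpa]
  refine Finset.sum_congr rfl fun a _ => ?_
  simp only [clusterProb, ← Finset.mul_sum]
  rw [Fintype.sum_prod_type]
  simp only [← Finset.mul_sum, ← Finset.sum_mul]
  rw [sum_pi_prod_eq_one (fun _ => β a) (fun _ => hβ a), sum_pi_prod_eq_one (fun _ => q) fun _ => hq]
  ring

theorem sum_codebook_mul (hpa : ∑ a, pa a = 1) (hβ : ∀ a, ∑ b, β a b = 1) (hq : ∑ t, q t = 1)
    (l : I × K × J) (h : A × B × T → ℝ) :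
    ∑ c : I → A × (K → B) × (J → T), (∏ i, clusterProb pa β q (c i)) * h (codeword c l) =
      ∑ w, codewordProb pa β q w * h w := by
  have := sum_pi_prod_mul_apply (fun _ : I => clusterProb (K := K) (J := J) pa β q)
    (fun _ => sum_clusterProb hpa hβ hq) l.1 (fun c => h (c.1, c.2.1 l.2.1, c.2.2 l.2.2))
  rw [sum_clusterProb_mul hβ hq] at this
  simp only [codeword, this, codewordProb, Fintype.sum_prod_type, Finset.mul_sum]
  refine Finset.sum_congr rfl fun a _ => Finset.sum_congr rfl fun b _ =>
    Finset.sum_congr rfl fun t _ => by ring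

/-- The second-moment identity is used a third time, now for the clusters. The cluster of `l`
contributes the four terms found above, and every other cluster is independent of it and contributes
its unconditional mean. This is the origin of the five terms of `codebookMean`. -/
theorem sum_codebook_mul_sum (hpa : ∑ a, pa a = 1) (hβ : ∀ a, ∑ b, β a b = 1) (hq : ∑ t, q t = 1)
    (l : I × K × J) (h f : A × B × T → ℝ) :
    ∑ c : I → A × (K → B) × (J → T), (∏ i, clusterProb pa β q (c i)) *
      (h (codeword c l) * ∑ l', f (codeword c l')) =
      ∑ w, codewordProb pa β q w * (h w * codebookMean I K J pa β q f w) := by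
  have h1 := sum_pi_prod_mul_sum (clusterProb (K := K) (J := J) pa β q)
    (sum_clusterProb hpa hβ hq) l.1
    (fun c c' : A × (K → B) × (J → T) => h (c.1, c.2.1 l.2.1, c.2.2 l.2.2) *
      ∑ k', ∑ j', f (c'.1, c'.2.1 k', c'.2.2 j'))
  have h2 : ∑ c : A × (K → B) × (J → T), clusterProb pa β q c *
      ∑ k', ∑ j', f (c.1, c.2.1 k', c.2.2 j') = Fintype.card K * Fintype.card J *
        ∑ a, pa a * ∑ b, β a b * ∑ t, q t * f (a, b, t) := by
    simp only [Finset.mul_sum (s := (Finset.univ : Finset K)),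
      Finset.mul_sum (s := (Finset.univ : Finset J))]
    rw [Finset.sum_comm]
    rw [Finset.sum_congr rfl fun k _ => Finset.sum_comm]
    rw [Finset.sum_congr rfl fun k _ => Finset.sum_congr rfl fun j _ =>
      sum_clusterProb_mul (pa := pa) hβ hq k j f]
    simp [mul_assoc]
  have h3 : ∀ c : A × (K → B) × (J → T), ∑ c' : A × (K → B) × (J → T), clusterProb pa β q c' *
      (h (c.1, c.2.1 l.2.1, c.2.2 l.2.2) * ∑ k', ∑ j', f (c'.1, c'.2.1 k', c'.2.2 j')) =
      h (c.1, c.2.1 l.2.1, c.2.2 l.2.2) * (Fintype.card K * Fintype.card J *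
        ∑ a, pa a * ∑ b, β a b * ∑ t, q t * f (a, b, t)) := by
    intro c
    rw [← h2, Finset.mul_sum]
    exact Finset.sum_congr rfl fun c' _ => by ring
  simp only [h3, mul_add, Finset.sum_add_distrib] at h1
  rw [sum_clusterProb_mul_sum hβ hq] at h1
  have h4 := sum_clusterProb_mul (K := K) (J := J) (pa := pa) hβ hq l.2.1 l.2.2 (fun w => h w *
    (((Fintype.card I : ℝ) - 1) * (Fintype.card K * Fintype.card J *
        ∑ a, pa a * ∑ b, β a b * ∑ t, q t * f (a, b, t))))
  calc _ = ∑ c : I → A × (K → B) × (J → T), (∏ i, clusterProb pa β q (c i)) * ∑ i',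
        h ((c l.1).1, (c l.1).2.1 l.2.1, (c l.1).2.2 l.2.2) *
          ∑ k', ∑ j', f ((c i').1, (c i').2.1 k', (c i').2.2 j') := by
        refine Finset.sum_congr rfl fun c _ => ?_
        rw [← Finset.mul_sum, Fintype.sum_prod_type]
        simp only [Fintype.sum_prod_type, codeword]
    _ = _ := by
        rw [h1]
        have h5 : ∀ c : A × (K → B) × (J → T), clusterProb pa β q c *
            (((Fintype.card I : ℝ) - 1) * (h (c.1, c.2.1 l.2.1, c.2.2 l.2.2) *
            (Fintype.card K * Fintype.card J *
              ∑ a, pa a * ∑ b, β a b * ∑ t, q t * f (a, b, t)))) = clusterProb pa β q c *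
            (h (c.1, c.2.1 l.2.1, c.2.2 l.2.2) * (((Fintype.card I : ℝ) - 1) *
              (Fintype.card K * Fintype.card J *
                ∑ a, pa a * ∑ b, β a b * ∑ t, q t * f (a, b, t)))) := fun c => by ring
        rw [Finset.sum_congr rfl fun c _ => h5 c, h4, ← Finset.sum_add_distrib,
          Fintype.sum_prod_type]
        refine Finset.sum_congr rfl fun a _ => ?_
        rw [← mul_add, ← Finset.sum_add_distrib, Fintype.sum_prod_type, Finset.mul_sum]
        refine Finset.sum_congr rfl fun b _ => ?_
        rw [← mul_add, ← Finset.sum_add_distrib, Finset.mul_sum, Finset.mul_sum]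
        refine Finset.sum_congr rfl fun t _ => ?_
        simp only [codewordProb, codebookMean]
        ring

end Codebook

/-! ### Likelihood encoding and decoding, and removal of randomness -/

section OneShot

/-- The left side is the tangent plane of the convex function 1/(xy) at (1, 1). Being affine, it
reduces the expectation of the reciprocal of a product of two dependent normalizers to the mean of
each one separately. -/
theorem three_sub_sub_le_one_div_mul {x y : ℝ} (hx : 0 < x) (hy : 0 < y) :
    3 - x - y ≤ 1 / (x * y) := by
  have h1 : x ≤ Real.exp (x - 1) := by linarith [Real.add_one_le_exp (x - 1)]
  have h2 : y ≤ Real.exp (y - 1) := by linarith [Real.add_one_le_exp (y - 1)]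
  have h3 : x * y ≤ Real.exp (x + y - 2) := by
    calc x * y ≤ Real.exp (x - 1) * Real.exp (y - 1) := mul_le_mul h1 h2 hy.le (Real.exp_pos _).le
      _ = _ := by rw [← Real.exp_add]; congr 1; ring
  calc 3 - x - y ≤ Real.exp (-(x + y - 2)) := by linarith [Real.add_one_le_exp (-(x + y - 2))]
    _ = 1 / Real.exp (x + y - 2) := by rw [Real.exp_neg, one_div]
    _ ≤ _ := one_div_le_one_div_of_le (by positivity) h3

variable {C Λ Wd X S O : Type*} [Fintype C] [Fintype Λ] [Fintype Wd] [Fintype X] [Fintype S]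
  [Fintype O]

/-- Performance of likelihood encoding followed by likelihood decoding over a random codebook.
`mean f w` is the conditional expectation of the sum of `f` over the codebook given that one of its
words is `w`; `g` is the weight of the favourable configurations. -/
theorem le_sum_likelihood_coding [Nonempty Λ] {μ : C → ℝ} (hμ : ∀ c, 0 ≤ μ c) {word : C → Λ → Wd}
    {ν : Wd → ℝ} (hν : ∀ w, 0 ≤ ν w) {mean : (Wd → ℝ) → Wd → ℝ}
    (h1 : ∀ l (h : Wd → ℝ), ∑ c, μ c * h (word c l) = ∑ w, ν w * h w)
    (h2 : ∀ l (h f : Wd → ℝ), ∑ c, μ c * (h (word c l) * ∑ l', f (word c l')) =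
      ∑ w, ν w * (h w * mean f w))
    {fe : X → Wd → ℝ} (hfe : ∀ x w, 0 ≤ fe x w) {fd : O → Wd → ℝ} (hfd : ∀ o w, 0 ≤ fd o w)
    {k : Wd → S → ℝ} (hk : ∀ w u, 0 ≤ k w u) {G : X → S → O → ℝ} (hG : ∀ x u o, 0 ≤ G x u o)
    {g : X → S → O → Wd → ℝ} (hg : ∀ x u o w, 0 ≤ g x u o w) {L e₁ e₂ : ℝ} (hL : 0 < L)
    (hgood : ∀ x u o w, g x u o w ≠ 0 → 0 < fd o w ∧
      mean (fe x) w ≤ Fintype.card Λ * (1 + e₁) ∧ mean (fd o) w ≤ L * fd o w * (1 + e₂)) :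
    (1 - e₁ - e₂) * ∑ x, ∑ u, ∑ o, ∑ w, ν w * (fe x w * (k w u * G x u o * g x u o w)) ≤
      ∑ c, μ c * ∑ x, ∑ u, ∑ o, ∑ l, fe x (word c l) / (∑ l', fe x (word c l')) * k (word c l) u *
        G x u o * (L * fd o (word c l) / (∑ l', fd o (word c l')) * g x u o (word c l)) := by
  set N : ℝ := (Fintype.card Λ : ℝ) with hN
  have hN0 : 0 < N := by rw [hN]; exact_mod_cast Fintype.card_pos
  -- The encoder normalizer divided by `N` and the decoder normalizer divided by `L * fd` take the
  -- places of x and y in the tangent bound. In favourable configurations their conditional means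
  -- are at most `1 + e₁` and `1 + e₂`.
  have hpt : ∀ c x u o l, fe x (word c l) / N * (k (word c l) u * G x u o * g x u o (word c l)) *
      (3 - (∑ l', fe x (word c l')) / N - (∑ l', fd o (word c l')) / (L * fd o (word c l))) ≤
      fe x (word c l) / (∑ l', fe x (word c l')) * k (word c l) u *
        G x u o * (L * fd o (word c l) / (∑ l', fd o (word c l')) * g x u o (word c l)) := by
    intro c x u o l
    by_cases hg0 : g x u o (word c l) = 0
    · simp [hg0]
    by_cases hf0 : fe x (word c l) = 0
    · simp [hf0]
    have hf := lt_of_le_of_ne (hfe x (word c l)) (Ne.symm hf0)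
    have hd := (hgood _ _ _ _ hg0).1
    have hSe : 0 < ∑ l', fe x (word c l') := hf.trans_le
      (Finset.single_le_sum (f := fun l' => fe x (word c l')) (fun l' _ => hfe x _) (Finset.mem_univ l))
    have hSd : 0 < ∑ l', fd o (word c l') := hd.trans_le
      (Finset.single_le_sum (f := fun l' => fd o (word c l')) (fun l' _ => hfd o _) (Finset.mem_univ l))
    have h := three_sub_sub_le_one_div_mul (div_pos hSe hN0) (div_pos hSd (mul_pos hL hd))
    have h0 : 0 ≤ fe x (word c l) / N * (k (word c l) u * G x u o * g x u o (word c l)) :=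
      mul_nonneg (div_nonneg hf.le hN0.le) (mul_nonneg (mul_nonneg (hk _ _) (hG _ _ _)) (hg _ _ _ _))
    refine (mul_le_mul_of_nonneg_left h h0).trans (le_of_eq ?_)
    field_simp
  have hsum : ∀ x u o l, (1 - e₁ - e₂) * ∑ w, ν w * (fe x w * (k w u * G x u o * g x u o w)) / N ≤
      ∑ c, μ c * (fe x (word c l) / N * (k (word c l) u * G x u o * g x u o (word c l)) *
      (3 - (∑ l', fe x (word c l')) / N - (∑ l', fd o (word c l')) / (L * fd o (word c l)))) := by
    intro x u o l
    set b : Wd → ℝ := fun w => fe x w / N * (k w u * G x u o * g x u o w) with hb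
    have hb0 : ∀ w, 0 ≤ b w := fun w =>
      mul_nonneg (div_nonneg (hfe _ _) hN0.le) (mul_nonneg (mul_nonneg (hk _ _) (hG _ _ _)) (hg _ _ _ _))
    calc _ = ∑ w, ν w * (b w * (1 - e₁ - e₂)) := by
          rw [Finset.mul_sum]
          exact Finset.sum_congr rfl fun w _ => by simp only [hb]; ring
      _ ≤ ∑ w, (ν w * (3 * b w) - ν w * (b w / N * mean (fe x) w) -
            ν w * (b w / (L * fd o w) * mean (fd o) w)) := by
          refine Finset.sum_le_sum fun w _ => ?_
          by_cases hg0 : g x u o w = 0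
          · simp [hb, hg0]
          obtain ⟨hd, hm1, hm2⟩ := hgood _ _ _ _ hg0
          have h3 : mean (fe x) w / N ≤ 1 + e₁ := by rw [div_le_iff₀ hN0]; linarith
          have h4 : mean (fd o) w / (L * fd o w) ≤ 1 + e₂ := by
            rw [div_le_iff₀ (by positivity)]; linarith
          have h5 : 1 - e₁ - e₂ ≤ 3 - mean (fe x) w / N - mean (fd o) w / (L * fd o w) := by
            linarith
          calc _ ≤ ν w * (b w * (3 - mean (fe x) w / N - mean (fd o) w / (L * fd o w))) :=
                mul_le_mul_of_nonneg_left (mul_le_mul_of_nonneg_left h5 (hb0 w)) (hν w)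
            _ = _ := by ring
      _ = _ := by
          -- The constant 3 needs only the law of one codeword; each of the two normalizers is a sum
          -- over the codebook and needs `h2`.
          rw [Finset.sum_sub_distrib, Finset.sum_sub_distrib, ← h1 l, ← h2 l, ← h2 l,
            ← Finset.sum_sub_distrib, ← Finset.sum_sub_distrib]
          exact Finset.sum_congr rfl fun c _ => by simp only [hb]; ring
  calc _ = ∑ x, ∑ u, ∑ o, ∑ _l : Λ,
        (1 - e₁ - e₂) * ∑ w, ν w * (fe x w * (k w u * G x u o * g x u o w)) / N := by
        simp only [Finset.mul_sum, Finset.sum_const, Finset.card_univ, nsmul_eq_mul, ← hN]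
        refine Finset.sum_congr rfl fun x _ => Finset.sum_congr rfl fun u _ =>
          Finset.sum_congr rfl fun o _ => Finset.sum_congr rfl fun w _ => ?_
        field_simp
    _ ≤ ∑ x, ∑ u, ∑ o, ∑ l, ∑ c, μ c * (fe x (word c l) / (∑ l', fe x (word c l')) *
          k (word c l) u * G x u o *
          (L * fd o (word c l) / (∑ l', fd o (word c l')) * g x u o (word c l))) := by
        refine Finset.sum_le_sum fun x _ => Finset.sum_le_sum fun u _ =>
          Finset.sum_le_sum fun o _ => Finset.sum_le_sum fun l _ => (hsum x u o l).trans ?_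
        exact Finset.sum_le_sum fun c _ => mul_le_mul_of_nonneg_left (hpt c x u o l) (hμ c)
    _ = _ := by
        simp only [Finset.mul_sum]
        simp only [Finset.sum_comm (s := (Finset.univ : Finset C))]

/-- An average is at most the maximum. The total weight may be below one, because a likelihood rule
all of whose metrics vanish assigns 0/0 = 0 to every index; this is why `f` has to be nonnegative.
-/
theorem exists_sum_mul_le {α : Type*} [Fintype α] [Nonempty α] {w f : α → ℝ} (hw : ∀ a, 0 ≤ w a)
    (hw1 : ∑ a, w a ≤ 1) (hf : ∀ a, 0 ≤ f a) : ∃ a, ∑ b, w b * f b ≤ f a := by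
  obtain ⟨a, -, ha⟩ := Finset.exists_max_image Finset.univ f Finset.univ_nonempty
  refine ⟨a, ?_⟩
  calc ∑ b, w b * f b ≤ ∑ b, w b * f a :=
        Finset.sum_le_sum fun b _ => mul_le_mul_of_nonneg_left (ha b (Finset.mem_univ b)) (hw b)
    _ = (∑ b, w b) * f a := by rw [Finset.sum_mul]
    _ ≤ 1 * f a := mul_le_mul_of_nonneg_right hw1 (hf a)
    _ = f a := one_mul _

open Classical in
/-- A randomized decoder can be replaced by a deterministic one. -/
theorem exists_decoder [Nonempty Λ] {Oc : Type*} [Fintype Oc] (π : O → Oc) {H : X → O → ℝ}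
    (hH : ∀ x o, 0 ≤ H x o) {d : Oc → Λ → ℝ} (hd : ∀ o l, 0 ≤ d o l) (hd1 : ∀ o, ∑ l, d o l ≤ 1)
    {ok : X → O → Λ → ℝ} (hok : ∀ x o l, 0 ≤ ok x o l) :
    ∃ dec : Oc → Λ, ∑ x, ∑ o, H x o * ∑ l, d (π o) l * ok x o l ≤
      ∑ x, ∑ o, H x o * ok x o (dec (π o)) := by
  have h : ∀ oc : Oc, ∃ l, ∑ l', d oc l' * (∑ x, ∑ o with π o = oc, H x o * ok x o l') ≤
      ∑ x, ∑ o with π o = oc, H x o * ok x o l := fun oc =>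
    exists_sum_mul_le (hd oc) (hd1 oc) fun l => Finset.sum_nonneg fun x _ =>
      Finset.sum_nonneg fun o _ => mul_nonneg (hH x o) (hok x o l)
  choose dec hdec using h
  refine ⟨dec, ?_⟩
  have hfib : ∀ F : X → O → ℝ, ∑ x, ∑ o, F x o =
      ∑ oc : Oc, ∑ x : X, ∑ o : O with π o = oc, F x o := by
    intro F
    symm
    rw [Finset.sum_comm]
    exact Finset.sum_congr rfl fun x _ => Finset.sum_fiberwise Finset.univ π (F x)
  rw [hfib, hfib]
  refine Finset.sum_le_sum fun oc _ => ?_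
  calc _ = ∑ l', d oc l' * (∑ x, ∑ o with π o = oc, H x o * ok x o l') := by
        simp only [Finset.mul_sum]
        symm
        rw [Finset.sum_comm]
        refine Finset.sum_congr rfl fun x _ => ?_
        rw [Finset.sum_comm]
        refine Finset.sum_congr rfl fun o ho => Finset.sum_congr rfl fun l _ => ?_
        rw [(Finset.mem_filter.mp ho).2]; ring
    _ ≤ _ := hdec oc
    _ = _ := by
        refine Finset.sum_congr rfl fun x _ => Finset.sum_congr rfl fun o ho => ?_
        rw [(Finset.mem_filter.mp ho).2]

/-- A randomized encoder can be replaced by a deterministic one. -/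
theorem exists_encoder [Nonempty S] {e : X → Λ → S → ℝ} (he : ∀ x l u, 0 ≤ e x l u)
    (he1 : ∀ x, ∑ l, ∑ u, e x l u ≤ 1) {F : X → S → ℝ} (hF : ∀ x u, 0 ≤ F x u) :
    ∃ enc : X → S, ∑ x, ∑ u, ∑ l, e x l u * F x u ≤ ∑ x, F x (enc x) := by
  have h : ∀ x, ∃ u, ∑ u', (∑ l, e x l u') * F x u' ≤ F x u := fun x =>
    exists_sum_mul_le (fun u => Finset.sum_nonneg fun l _ => he x l u)
      (by rw [Finset.sum_comm]; exact he1 x) (hF x)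
  choose enc henc using h
  refine ⟨enc, Finset.sum_le_sum fun x _ => ?_⟩
  simpa only [Finset.sum_mul] using henc x

end OneShot

/-! ### Typical words -/

section Typicality

theorem prod_eq_two_rpow_sum_logb {ι : Type*} [Fintype ι] {f : ι → ℝ} (hf : ∀ i, 0 < f i) :
    ∏ i, f i = (2 : ℝ) ^ ∑ i, Real.logb 2 (f i) := by
  rw [← Real.logb_prod _ _ (fun i _ => (hf i).ne'), Real.rpow_logb (by norm_num) (by norm_num)
    (Finset.prod_pos fun i _ => hf i)]

variable {ι Q : Type*} [Fintype ι] [DecidableEq ι] [Fintype Q] {α : ι → Type*}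
  [∀ i, Fintype (α i)]

/-- A word of positive probability along which the sums of all statistics `f · q` are within `h` of
their expectations. -/
def IsTypical (w : ∀ i, α i → ℝ) (f : ∀ i, Q → α i → ℝ) (h : ℝ) (c : ∀ i, α i) : Prop :=
  (∀ i, 0 < w i (c i)) ∧ ∀ q, |∑ i, f i q (c i) - ∑ i, ∑ x, w i x * f i q x| ≤ h

open Classical in
-- Chebyshev's inequality with a union bound over the statistics. The positivity required of a
-- typical word costs nothing, since words with a letter of probability zero have no weight.
theorem one_sub_le_prob_isTypical (w : ∀ i, α i → ℝ) (hw0 : ∀ i x, 0 ≤ w i x)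
    (hw : ∀ i, ∑ x, w i x = 1) (f : ∀ i, Q → α i → ℝ) {C h : ℝ} (hh : 0 < h)
    (hC : ∀ i q, ∑ x, w i x * f i q x ^ 2 ≤ C) :
    1 - Fintype.card Q * (Fintype.card ι * C / h ^ 2) ≤
      ∑ c : ∀ i, α i, (∏ k, w k (c k)) * if IsTypical w f h c then 1 else 0 := by
  have hb := fun q => prob_abs_sum_sub_mean_gt_le w hw0 hw (fun i => f i q) hh fun i => hC i q
  have hsum := Finset.sum_le_sum fun q (_ : q ∈ (Finset.univ : Finset Q)) => hb q
  rw [Finset.sum_const, Finset.card_univ, nsmul_eq_mul] at hsum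
  rw [sub_le_iff_le_add]
  refine le_trans ?_ (add_le_add le_rfl hsum)
  rw [Finset.sum_comm, ← Finset.sum_add_distrib]
  refine (sum_pi_prod_eq_one w hw).symm.le.trans ?_
  refine Finset.sum_le_sum fun c _ => ?_
  have hp : 0 ≤ ∏ k, w k (c k) := Finset.prod_nonneg fun k _ => hw0 k _
  rw [← Finset.mul_sum, ← mul_add]
  by_cases hpos : ∀ i, 0 < w i (c i)
  · refine le_mul_of_one_le_right hp ?_
    by_cases ht : IsTypical w f h c
    · rw [if_pos ht]
      exact le_add_of_nonneg_right (Finset.sum_nonneg fun q _ => by split_ifs <;> norm_num)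
    · have : ∃ q, h < |∑ i, f i q (c i) - ∑ i, ∑ x, w i x * f i q x| := by
        by_contra! hcon
        exact ht ⟨hpos, hcon⟩
      obtain ⟨q, hq⟩ := this
      rw [if_neg ht, zero_add]
      refine le_trans ?_ (Finset.single_le_sum
        (f := fun q => if h < |∑ i, f i q (c i) - ∑ i, ∑ x, w i x * f i q x| then (1 : ℝ) else 0)
        (fun q _ => by split_ifs <;> norm_num) (Finset.mem_univ q))
      simp only [if_pos hq]; exact le_rfl
  · push Not at hpos
    obtain ⟨i, hi⟩ := hpos
    have h0 : ∏ k, w k (c k) = 0 :=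
      Finset.prod_eq_zero (Finset.mem_univ i) (le_antisymm hi (hw0 i _))
    simp [h0]

end Typicality

/-! ### Sums over words of pairs and product bounds -/

section Reindexing

theorem sum_pi_prodMk {ι : Type*} [Fintype ι] [DecidableEq ι] {α β : ι → Type*}
    [∀ i, Fintype (α i)] [∀ i, Fintype (β i)] (F : (∀ i, α i × β i) → ℝ) :
    ∑ c, F c = ∑ a : ∀ i, α i, ∑ b : ∀ i, β i, F fun i => (a i, b i) := by
  rw [← Fintype.sum_prod_type' (f := fun (a : ∀ i, α i) (b : ∀ i, β i) => F fun i => (a i, b i))]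
  exact Fintype.sum_equiv ⟨fun c => (fun i => (c i).1, fun i => (c i).2),
    fun c i => (c.1 i, c.2 i), fun _ => rfl, fun _ => rfl⟩ _ _ fun _ => rfl

theorem sum_pi_prod_mul_le {ι : Type*} [Fintype ι] [DecidableEq ι] {α : ι → Type*}
    [∀ i, Fintype (α i)] {w f : ∀ i, α i → ℝ} {b : ι → ℝ} (hw : ∀ i x, 0 ≤ w i x)
    (hf : ∀ i x, 0 ≤ f i x) (h : ∀ i, ∑ x, w i x * f i x ≤ b i) :
    ∑ c : ∀ i, α i, (∏ i, w i (c i)) * ∏ i, f i (c i) ≤ ∏ i, b i := by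
  simp only [← Finset.prod_mul_distrib]
  rw [sum_pi_prod (fun i x => w i x * f i x)]
  exact Finset.prod_le_prod
    (fun i _ => Finset.sum_nonneg fun x _ => mul_nonneg (hw i x) (hf i x)) fun i _ => h i

end Reindexing

/-! ### Bounds for the conditional mean over the codebook -/

section CodebookMean

variable {I K J A B T : Type*} [Fintype I] [Fintype K] [Fintype J] [Fintype A] [Fintype B]
  [Fintype T] [Nonempty I] [Nonempty K] [Nonempty J]
  {pa : A → ℝ} {β : A → B → ℝ} {q : T → ℝ}

/-- The bounds `ft`, `fb` and `fbt` are for the mean over a fresh `t`, a fresh `b` and both. A word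
from another cluster has mean at most 1, which gives the last term. -/
theorem codebookMean_le (hpa : ∀ a, 0 ≤ pa a) (hβ : ∀ a b, 0 ≤ β a b) (hq : ∀ t, 0 ≤ q t)
    {f : A × B × T → ℝ} {ft : A → B → ℝ} {fb : A → T → ℝ} {fbt : A → ℝ} (hf : ∀ w, 0 ≤ f w)
    (ht : ∀ a b, ∑ t, q t * f (a, b, t) ≤ ft a b) (hb : ∀ a t, ∑ b, β a b * f (a, b, t) ≤ fb a t)
    (hbt : ∀ a, ∑ b, β a b * ft a b ≤ fbt a) (h1 : ∑ a, pa a * fbt a ≤ 1) (a : A) (b : B) (t : T) :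
    codebookMean I K J pa β q f (a, b, t) ≤ f (a, b, t) + Fintype.card J * ft a b
      + Fintype.card K * fb a t + Fintype.card K * Fintype.card J * fbt a
      + Fintype.card I * Fintype.card K * Fintype.card J := by
  have cI : (1 : ℝ) ≤ Fintype.card I := by exact_mod_cast Fintype.card_pos
  have cK : (1 : ℝ) ≤ Fintype.card K := by exact_mod_cast Fintype.card_pos
  have cJ : (1 : ℝ) ≤ Fintype.card J := by exact_mod_cast Fintype.card_pos
  have ht0 : ∀ a b, 0 ≤ ∑ t, q t * f (a, b, t) := fun a b =>
    Finset.sum_nonneg fun t _ => mul_nonneg (hq t) (hf _)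
  have hb0 : 0 ≤ ∑ b, β a b * f (a, b, t) :=
    Finset.sum_nonneg fun b _ => mul_nonneg (hβ a b) (hf _)
  have hbt' : ∀ a, ∑ b, β a b * ∑ t, q t * f (a, b, t) ≤ fbt a := fun a =>
    (Finset.sum_le_sum fun b _ => mul_le_mul_of_nonneg_left (ht a b) (hβ a b)).trans (hbt a)
  have hbt0 : ∀ a, 0 ≤ ∑ b, β a b * ∑ t, q t * f (a, b, t) := fun a =>
    Finset.sum_nonneg fun b _ => mul_nonneg (hβ a b) (ht0 a b)
  have h1' : ∑ a, pa a * ∑ b, β a b * ∑ t, q t * f (a, b, t) ≤ 1 :=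
    (Finset.sum_le_sum fun a _ => mul_le_mul_of_nonneg_left (hbt' a) (hpa a)).trans h1
  simp only [codebookMean]
  have e1 : ((Fintype.card J : ℝ) - 1) * ∑ t, q t * f (a, b, t) ≤ Fintype.card J * ft a b :=
    mul_le_mul (by linarith) (ht a b) (ht0 a b) (by linarith)
  have e2 : ((Fintype.card K : ℝ) - 1) * ∑ b, β a b * f (a, b, t) ≤ Fintype.card K * fb a t :=
    mul_le_mul (by linarith) (hb a t) hb0 (by linarith)
  have e3 : ((Fintype.card K : ℝ) - 1) * ((Fintype.card J : ℝ) - 1) *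
      ∑ b, β a b * ∑ t, q t * f (a, b, t) ≤ Fintype.card K * Fintype.card J * fbt a :=
    mul_le_mul (mul_le_mul (by linarith) (by linarith) (by linarith) (by linarith)) (hbt' a)
      (hbt0 a) (by positivity)
  have e4 : ((Fintype.card I : ℝ) - 1) * (Fintype.card K * Fintype.card J *
      ∑ a, pa a * ∑ b, β a b * ∑ t, q t * f (a, b, t)) ≤
      Fintype.card I * (Fintype.card K * Fintype.card J * 1) :=
    mul_le_mul (by linarith) (mul_le_mul_of_nonneg_left h1' (by positivity))
      (mul_nonneg (by positivity) (Finset.sum_nonneg fun a _ => mul_nonneg (hpa a) (hbt0 a)))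
      (by linarith)
  linarith

/-- A metric that is blind to the satellite cannot distinguish the words of a cluster with the same
`t`, so everything is multiplied by the number of satellites. This factor is absorbed by `L` in
`le_sum_likelihood_coding`. -/
theorem codebookMean_le_of_forall_eq (hpa : ∀ a, 0 ≤ pa a) (hβ : ∀ a, ∑ b, β a b = 1)
    (hq : ∀ t, 0 ≤ q t)
    {f : A → T → ℝ} {ft : A → ℝ} (hf : ∀ a t, 0 ≤ f a t)
    (ht : ∀ a, ∑ t, q t * f a t ≤ ft a) (h1 : ∑ a, pa a * ft a ≤ 1) (a : A) (b : B) (t : T) :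
    codebookMean I K J pa β q (fun w => f w.1 w.2.2) (a, b, t) ≤
      Fintype.card K * (f a t + Fintype.card J * ft a + Fintype.card I * Fintype.card J) := by
  have cI : (1 : ℝ) ≤ Fintype.card I := by exact_mod_cast Fintype.card_pos
  have cK : (1 : ℝ) ≤ Fintype.card K := by exact_mod_cast Fintype.card_pos
  have cJ : (1 : ℝ) ≤ Fintype.card J := by exact_mod_cast Fintype.card_pos
  have ht0 : ∀ a, 0 ≤ ∑ t, q t * f a t := fun a =>
    Finset.sum_nonneg fun t _ => mul_nonneg (hq t) (hf _ _)
  have h1' : ∑ a, pa a * ∑ t, q t * f a t ≤ 1 :=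
    (Finset.sum_le_sum fun a _ => mul_le_mul_of_nonneg_left (ht a) (hpa a)).trans h1
  simp only [codebookMean, ← Finset.sum_mul, hβ, one_mul]
  have e1 : ((Fintype.card J : ℝ) - 1) * ∑ t, q t * f a t ≤ Fintype.card J * ft a :=
    mul_le_mul (by linarith) (ht a) (ht0 a) (by linarith)
  have e4 : ((Fintype.card I : ℝ) - 1) * (Fintype.card J * ∑ a, pa a * ∑ t, q t * f a t) ≤
      Fintype.card I * (Fintype.card J * 1) :=
    mul_le_mul (by linarith) (mul_le_mul_of_nonneg_left h1' (by positivity))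
      (mul_nonneg (by positivity) (Finset.sum_nonneg fun a _ => mul_nonneg (hpa a) (ht0 a)))
      (by linarith)
  calc _ = Fintype.card K * (f a t + ((Fintype.card J : ℝ) - 1) * ∑ t, q t * f a t +
        ((Fintype.card I : ℝ) - 1) * (Fintype.card J * ∑ a, pa a * ∑ t, q t * f a t)) := by ring
    _ ≤ _ := mul_le_mul_of_nonneg_left (by linarith) (by positivity)

end CodebookMean

/-! ### Single-letter data of the source code and of the channel code -/

section Letters

variable {X Yc Yr U Vc Vr Xc Xr : Type*} [Fintype X] [Fintype Yc] [Fintype Yr] [Fintype U]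
  [Fintype Vc] [Fintype Vr]

/-- Single-letter data of a superposition source code for the source `P`: the codebook law
`pa`, `β`, the encoding metric `ρ` with its partial mean `ρ₁`, the decoding metrics `σc`, `σr` with
the partial mean `σ₁` of the latter, and the reconstruction functions. -/
structure SourceLetter (P : X × Yc × Yr → ℝ) (Xc Xr : Type*) where
  Zc : Type
  Zr : Type
  [fintypeZc : Fintype Zc]
  [fintypeZr : Fintype Zr]
  pa : Zc → ℝ
  β : Zc → Zr → ℝ
  ρ : X → Zc → Zr → ℝ
  ρ₁ : X → Zc → ℝ
  σc : Yc → Zc → ℝ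
  σr : Yr → Zc → Zr → ℝ
  σ₁ : Yr → Zc → ℝ
  gc : Zc × Yc → Xc
  gr : Zr × Yr → Xr
  pa_nonneg : ∀ a, 0 ≤ pa a
  β_nonneg : ∀ a b, 0 ≤ β a b
  ρ_nonneg : ∀ x a b, 0 ≤ ρ x a b
  ρ₁_nonneg : ∀ x a, 0 ≤ ρ₁ x a
  σc_nonneg : ∀ y a, 0 ≤ σc y a
  σr_nonneg : ∀ y a b, 0 ≤ σr y a b
  σ₁_nonneg : ∀ y a, 0 ≤ σ₁ y a
  sum_pa : ∑ a, pa a = 1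
  sum_β : ∀ a, ∑ b, β a b = 1
  sum_ρ : ∀ x a, ∑ b, β a b * ρ x a b ≤ ρ₁ x a
  sum_ρ₁ : ∀ x, ∑ a, pa a * ρ₁ x a ≤ 1
  sum_σc : ∀ y, ∑ a, pa a * σc y a ≤ 1
  sum_σr : ∀ y a, ∑ b, β a b * σr y a b ≤ σ₁ y a
  sum_σ₁ : ∀ y, ∑ a, pa a * σ₁ y a ≤ 1
  sum_prob : ∑ s : (X × Yc × Yr) × Zc × Zr,
    P s.1 * (pa s.2.1 * β s.2.1 s.2.2 * ρ s.1.1 s.2.1 s.2.2) = 1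
  pos : ∀ s : (X × Yc × Yr) × Zc × Zr,
    0 < P s.1 * (pa s.2.1 * β s.2.1 s.2.2 * ρ s.1.1 s.2.1 s.2.2) →
    0 < ρ s.1.1 s.2.1 s.2.2 ∧ 0 < ρ₁ s.1.1 s.2.1 ∧ 0 < σc s.1.2.1 s.2.1 ∧
    0 < σr s.1.2.2 s.2.1 s.2.2 ∧ 0 < σ₁ s.1.2.2 s.2.1

attribute [instance] SourceLetter.fintypeZc SourceLetter.fintypeZr

namespace SourceLetter

variable {P : X × Yc × Yr → ℝ} (S : SourceLetter P Xc Xr)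

/-- Joint law of source, side information and codeword letters. -/
def prob (s : (X × Yc × Yr) × S.Zc × S.Zr) : ℝ :=
  P s.1 * (S.pa s.2.1 * S.β s.2.1 s.2.2 * S.ρ s.1.1 s.2.1 s.2.2)

/-- The information densities and distortions which typicality refers to. -/
def stat (dC : X → Xc → ℝ≥0) (dR : X → Xr → ℝ≥0) (q : Fin 7)
    (s : (X × Yc × Yr) × S.Zc × S.Zr) : ℝ :=
  ![Real.logb 2 (S.ρ s.1.1 s.2.1 s.2.2), Real.logb 2 (S.ρ₁ s.1.1 s.2.1),
    Real.logb 2 (S.σc s.1.2.1 s.2.1), Real.logb 2 (S.σr s.1.2.2 s.2.1 s.2.2),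
    Real.logb 2 (S.σ₁ s.1.2.2 s.2.1), (dC s.1.1 (S.gc (s.2.1, s.1.2.1)) : ℝ),
    (dR s.1.1 (S.gr (s.2.2, s.1.2.2)) : ℝ)] q

/-- Expectation of `stat`. -/
def mean (dC : X → Xc → ℝ≥0) (dR : X → Xr → ℝ≥0) (q : Fin 7) : ℝ :=
  ∑ s, S.prob s * S.stat dC dR q s

theorem prob_nonneg (hP : ∀ s, 0 ≤ P s) (s) : 0 ≤ S.prob s :=
  mul_nonneg (hP _) (mul_nonneg (mul_nonneg (S.pa_nonneg _) (S.β_nonneg _ _)) (S.ρ_nonneg _ _ _))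

end SourceLetter

/-- Single-letter data of a Gelfand-Pinsker type code for the channel `W`: the codebook laws
`qt`, `qr`, the encoding metric `τ`, the random map `κ` to channel inputs, the decoding metrics
`θc`, `θr`, and the partial means `θt`, `θR` of the latter. -/
structure ChannelLetter (W : U → Vc × Vr → ℝ) where
  T : Type
  R : Type
  [fintypeT : Fintype T]
  [fintypeR : Fintype R]
  qt : T → ℝ
  qr : R → ℝ
  τ : T → R → ℝ
  κ : T → R → U → ℝ
  θc : Vc → T → ℝ
  θr : Vr → T → R → ℝ
  θt : Vr → T → ℝ
  θR : Vr → R → ℝ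
  qt_nonneg : ∀ t, 0 ≤ qt t
  qr_nonneg : ∀ r, 0 ≤ qr r
  τ_nonneg : ∀ t r, 0 ≤ τ t r
  κ_nonneg : ∀ t r u, 0 ≤ κ t r u
  θc_nonneg : ∀ v t, 0 ≤ θc v t
  θr_nonneg : ∀ v t r, 0 ≤ θr v t r
  θt_nonneg : ∀ v t, 0 ≤ θt v t
  θR_nonneg : ∀ v r, 0 ≤ θR v r
  sum_qt : ∑ t, qt t = 1
  sum_qr : ∑ r, qr r = 1
  sum_κ : ∀ t r, ∑ u, κ t r u ≤ 1
  sum_qt_τ : ∀ r, ∑ t, qt t * τ t r ≤ 1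
  sum_qr_τ : ∀ t, ∑ r, qr r * τ t r ≤ 1
  sum_θc : ∀ v, ∑ t, qt t * θc v t ≤ 1
  sum_qt_θr : ∀ v r, ∑ t, qt t * θr v t r ≤ θR v r
  sum_qr_θr : ∀ v t, ∑ r, qr r * θr v t r ≤ θt v t
  sum_θR : ∀ v, ∑ r, qr r * θR v r ≤ 1
  sum_prob : ∑ s : T × R × U × Vc × Vr,
    qt s.1 * qr s.2.1 * τ s.1 s.2.1 * κ s.1 s.2.1 s.2.2.1 * W s.2.2.1 s.2.2.2 = 1
  pos : ∀ s : T × R × U × Vc × Vr,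
    0 < qt s.1 * qr s.2.1 * τ s.1 s.2.1 * κ s.1 s.2.1 s.2.2.1 * W s.2.2.1 s.2.2.2 →
    0 < τ s.1 s.2.1 ∧ 0 < θc s.2.2.2.1 s.1 ∧ 0 < θr s.2.2.2.2 s.1 s.2.1 ∧
    0 < θt s.2.2.2.2 s.1 ∧ 0 < θR s.2.2.2.2 s.2.1

attribute [instance] ChannelLetter.fintypeT ChannelLetter.fintypeR

namespace ChannelLetter

variable {W : U → Vc × Vr → ℝ} (L : ChannelLetter W)

/-- Joint law of codeword letters, channel input and channel outputs. -/
def prob (s : L.T × L.R × U × Vc × Vr) : ℝ :=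
  L.qt s.1 * L.qr s.2.1 * L.τ s.1 s.2.1 * L.κ s.1 s.2.1 s.2.2.1 * W s.2.2.1 s.2.2.2

/-- The information densities which typicality refers to. -/
def stat (q : Fin 5) (s : L.T × L.R × U × Vc × Vr) : ℝ :=
  ![Real.logb 2 (L.τ s.1 s.2.1), Real.logb 2 (L.θc s.2.2.2.1 s.1),
    Real.logb 2 (L.θr s.2.2.2.2 s.1 s.2.1), Real.logb 2 (L.θt s.2.2.2.2 s.1),
    Real.logb 2 (L.θR s.2.2.2.2 s.2.1)] q

/-- Expectation of `stat`. -/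
def mean (q : Fin 5) : ℝ := ∑ s, L.prob s * L.stat q s

theorem prob_nonneg (hW : IsChannel W) (s) : 0 ≤ L.prob s :=
  mul_nonneg (mul_nonneg (mul_nonneg (mul_nonneg (L.qt_nonneg _) (L.qr_nonneg _))
    (L.τ_nonneg _ _)) (L.κ_nonneg _ _ _)) ((hW _).1 _)

end ChannelLetter

end Letters

/-! ### Metrics and laws of words, with letters that may vary with the position -/

section Words

variable {X Yc Yr U Vc Vr Xc Xr : Type*} [Fintype X] [Fintype Yc] [Fintype Yr] [Fintype U]
  [Fintype Vc] [Fintype Vr] {P : X × Yc × Yr → ℝ} {W : U → Vc × Vr → ℝ} {n m : ℕ}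
  (S : Fin n → SourceLetter P Xc Xr) (L : Fin m → ChannelLetter W)

/-- Words over the codeword alphabets of the source letters `S` and the channel letters `L`. -/
abbrev CodeWord := (∀ j, (S j).Zc) × ((∀ j, (S j).Zr) × ∀ i, (L i).R) × ∀ i, (L i).T

/-- Law of the cluster centres. -/
def wordPa (a : ∀ j, (S j).Zc) : ℝ := ∏ j, (S j).pa (a j)

/-- Law of the satellites. -/
def wordβ (a : ∀ j, (S j).Zc) (b : (∀ j, (S j).Zr) × ∀ i, (L i).R) : ℝ :=
  (∏ j, (S j).β (a j) (b.1 j)) * ∏ i, (L i).qr (b.2 i)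

/-- Law of the channel codewords. -/
def wordQ (t : ∀ i, (L i).T) : ℝ := ∏ i, (L i).qt (t i)

/-- Encoding metric for words. -/
def encMetric (x : Fin n → X) (w : CodeWord S L) : ℝ :=
  (∏ j, (S j).ρ (x j) (w.1 j) (w.2.1.1 j)) * ∏ i, (L i).τ (w.2.2 i) (w.2.1.2 i)

/-- Decoding metric for words at receiver `c`. -/
def decMetricC (o : (Fin n → Yc) × (Fin m → Vc)) (a : ∀ j, (S j).Zc) (t : ∀ i, (L i).T) : ℝ :=
  (∏ j, (S j).σc (o.1 j) (a j)) * ∏ i, (L i).θc (o.2 i) (t i)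

/-- Decoding metric for words at receiver `r`. -/
def decMetricR (o : (Fin n → Yr) × (Fin m → Vr)) (w : CodeWord S L) : ℝ :=
  (∏ j, (S j).σr (o.1 j) (w.1 j) (w.2.1.1 j)) * ∏ i, (L i).θr (o.2 i) (w.2.2 i) (w.2.1.2 i)

/-- Law of the channel input word given the codeword. -/
def wordκ (w : CodeWord S L) (u : Fin m → U) : ℝ := ∏ i, (L i).κ (w.2.2 i) (w.2.1.2 i) (u i)

/-- The part of the joint law which is given by the source and the channel. -/
def naturalProb (P : X × Yc × Yr → ℝ) (W : U → Vc × Vr → ℝ) (x : Fin n → X) (u : Fin m → U)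
    (o : (Fin n → Yc × Yr) × (Fin m → Vc × Vr)) : ℝ :=
  (∏ j, P (x j, o.1 j)) * ∏ i, W (u i) (o.2 i)

theorem wordPa_nonneg (a) : 0 ≤ wordPa S a := Finset.prod_nonneg fun j _ => (S j).pa_nonneg _

theorem wordβ_nonneg (a b) : 0 ≤ wordβ S L a b :=
  mul_nonneg (Finset.prod_nonneg fun j _ => (S j).β_nonneg _ _)
    (Finset.prod_nonneg fun j _ => (L j).qr_nonneg _)

theorem wordQ_nonneg (t) : 0 ≤ wordQ L t := Finset.prod_nonneg fun j _ => (L j).qt_nonneg _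

theorem wordκ_nonneg (w u) : 0 ≤ wordκ S L w u := Finset.prod_nonneg fun j _ => (L j).κ_nonneg _ _ _

theorem encMetric_nonneg (x w) : 0 ≤ encMetric S L x w :=
  mul_nonneg (Finset.prod_nonneg fun j _ => (S j).ρ_nonneg _ _ _)
    (Finset.prod_nonneg fun j _ => (L j).τ_nonneg _ _)

theorem decMetricC_nonneg (o a t) : 0 ≤ decMetricC S L o a t :=
  mul_nonneg (Finset.prod_nonneg fun j _ => (S j).σc_nonneg _ _)
    (Finset.prod_nonneg fun j _ => (L j).θc_nonneg _ _)

theorem decMetricR_nonneg (o w) : 0 ≤ decMetricR S L o w :=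
  mul_nonneg (Finset.prod_nonneg fun j _ => (S j).σr_nonneg _ _ _)
    (Finset.prod_nonneg fun j _ => (L j).θr_nonneg _ _ _)

theorem sum_wordPa : ∑ a, wordPa S a = 1 := sum_pi_prod_eq_one _ fun j => (S j).sum_pa

theorem sum_wordβ (a) : ∑ b, wordβ S L a b = 1 := by
  simp only [wordβ]
  rw [Fintype.sum_prod_type]
  simp only [← Finset.mul_sum, ← Finset.sum_mul]
  rw [sum_pi_prod_eq_one (fun j => (S j).β (a j)) fun j => (S j).sum_β _,
    sum_pi_prod_eq_one (fun i => (L i).qr) fun i => (L i).sum_qr, one_mul]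

theorem sum_wordQ : ∑ t, wordQ L t = 1 := sum_pi_prod_eq_one _ fun j => (L j).sum_qt

theorem sum_wordκ (w) : ∑ u, wordκ S L w u ≤ 1 := by
  simp only [wordκ]
  rw [sum_pi_prod (fun i u => (L i).κ (w.2.2 i) (w.2.1.2 i) u)]
  exact Finset.prod_le_one (fun i _ => Finset.sum_nonneg fun u _ => (L i).κ_nonneg _ _ _)
    fun i _ => (L i).sum_κ _ _

theorem sum_wordβ_mul_le {a : ∀ j, (S j).Zc} {f : ∀ j, (S j).Zr → ℝ} {g : ∀ i, (L i).R → ℝ}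
    {bf : Fin n → ℝ} {bg : Fin m → ℝ} (hf : ∀ j z, 0 ≤ f j z) (hg : ∀ i r, 0 ≤ g i r)
    (hbf : ∀ j, ∑ z, (S j).β (a j) z * f j z ≤ bf j)
    (hbg : ∀ i, ∑ r, (L i).qr r * g i r ≤ bg i) :
    ∑ b, wordβ S L a b * ((∏ j, f j (b.1 j)) * ∏ i, g i (b.2 i)) ≤ (∏ j, bf j) * ∏ i, bg i := by
  have h1 := sum_pi_prod_mul_le (w := fun j => (S j).β (a j)) (fun j z => (S j).β_nonneg _ _) hf hbf
  have h2 := sum_pi_prod_mul_le (w := fun i => (L i).qr) (fun i z => (L i).qr_nonneg _) hg hbg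
  refine le_trans (le_of_eq ?_) (mul_le_mul h1 h2 (Finset.sum_nonneg fun r _ => mul_nonneg
    (Finset.prod_nonneg fun j _ => (L j).qr_nonneg _) (Finset.prod_nonneg fun j _ => hg _ _))
    (le_trans (Finset.sum_nonneg fun r _ => mul_nonneg
    (Finset.prod_nonneg fun j _ => (S j).β_nonneg _ _) (Finset.prod_nonneg fun j _ => hf _ _)) h1))
  rw [Fintype.sum_prod_type, Finset.sum_mul_sum]
  refine Finset.sum_congr rfl fun z _ => Finset.sum_congr rfl fun r _ => ?_
  simp only [wordβ]; ring

variable {I K J : Type*} [Fintype I] [Fintype K] [Fintype J] [Nonempty I] [Nonempty K] [Nonempty J]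

/-- Averaging `τ` over either argument leaves at most 1, so `τ` survives only in the term of the
word itself. Averaging `ρ` over a fresh satellite leaves `ρ₁`, and averaging that over a fresh
centre leaves at most 1. -/
theorem codebookMean_encMetric_le (x : Fin n → X) (w : CodeWord S L) :
    codebookMean I K J (wordPa S) (wordβ S L) (wordQ L) (encMetric S L x) w ≤
      (∏ j, (S j).ρ (x j) (w.1 j) (w.2.1.1 j)) * ∏ i, (L i).τ (w.2.2 i) (w.2.1.2 i)
      + Fintype.card J * ∏ j, (S j).ρ (x j) (w.1 j) (w.2.1.1 j)
      + Fintype.card K * ∏ j, (S j).ρ₁ (x j) (w.1 j)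
      + Fintype.card K * Fintype.card J * ∏ j, (S j).ρ₁ (x j) (w.1 j)
      + Fintype.card I * Fintype.card K * Fintype.card J := by
  have hρ0 : ∀ (a : ∀ j, (S j).Zc) (b : (∀ j, (S j).Zr)), 0 ≤ ∏ j, (S j).ρ (x j) (a j) (b j) := fun a b =>
    Finset.prod_nonneg fun j _ => (S j).ρ_nonneg _ _ _
  refine codebookMean_le (wordPa_nonneg S) (wordβ_nonneg S L) (wordQ_nonneg L)
    (ft := fun a b => ∏ j, (S j).ρ (x j) (a j) (b.1 j)) (fb := fun a _ => ∏ j, (S j).ρ₁ (x j) (a j))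
    (fbt := fun a => ∏ j, (S j).ρ₁ (x j) (a j)) (encMetric_nonneg S L x) ?_ ?_ ?_ ?_ w.1 w.2.1 w.2.2
  · intro a b
    have h := sum_pi_prod_mul_le (w := fun i => (L i).qt) (f := fun i t => (L i).τ t (b.2 i))
      (b := fun _ => 1) (fun i t => (L i).qt_nonneg t) (fun i t => (L i).τ_nonneg _ _)
      fun i => (L i).sum_qt_τ _
    rw [Finset.prod_const_one] at h
    calc _ = (∏ j, (S j).ρ (x j) (a j) (b.1 j)) * ∑ t : ∀ i, (L i).T,
          (∏ i, (L i).qt (t i)) * ∏ i, (L i).τ (t i) (b.2 i) := by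
          rw [Finset.mul_sum]
          exact Finset.sum_congr rfl fun t _ => by simp only [wordQ, encMetric]; ring
      _ ≤ _ := mul_le_of_le_one_right (hρ0 _ _) h
  · intro a t
    refine (sum_wordβ_mul_le S L (f := fun j z => (S j).ρ (x j) (a j) z)
      (g := fun i r => (L i).τ (t i) r) (bg := fun _ => 1) (fun j z => (S j).ρ_nonneg _ _ _)
      (fun i r => (L i).τ_nonneg _ _) (fun j => (S j).sum_ρ _ _) fun i => (L i).sum_qr_τ _).trans ?_
    simp
  · intro a
    have := sum_wordβ_mul_le S L (a := a) (f := fun j z => (S j).ρ (x j) (a j) z)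
      (g := fun i r => 1) (bg := fun _ => 1) (fun j z => (S j).ρ_nonneg _ _ _)
      (fun i r => zero_le_one) (fun j => (S j).sum_ρ _ _) fun i => by simp [(L i).sum_qr]
    simpa using this
  · have := sum_pi_prod_mul_le (w := fun j => (S j).pa) (f := fun j z => (S j).ρ₁ (x j) z)
      (b := fun _ => 1) (fun j z => (S j).pa_nonneg _) (fun j z => (S j).ρ₁_nonneg _ _)
      fun j => (S j).sum_ρ₁ _
    simpa [wordPa] using this

theorem codebookMean_decMetricC_le (o : (Fin n → Yc) × (Fin m → Vc)) (w : CodeWord S L) :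
    codebookMean I K J (wordPa S) (wordβ S L) (wordQ L) (fun w => decMetricC S L o w.1 w.2.2) w ≤
      Fintype.card K * (decMetricC S L o w.1 w.2.2
        + Fintype.card J * ∏ j, (S j).σc (o.1 j) (w.1 j) + Fintype.card I * Fintype.card J) := by
  refine codebookMean_le_of_forall_eq (wordPa_nonneg S) (sum_wordβ S L) (wordQ_nonneg L)
    (ft := fun a => ∏ j, (S j).σc (o.1 j) (a j)) (decMetricC_nonneg S L o) ?_ ?_ w.1 w.2.1 w.2.2
  · intro a
    have h := sum_pi_prod_mul_le (w := fun i => (L i).qt) (f := fun i t => (L i).θc (o.2 i) t)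
      (b := fun _ => 1) (fun i t => (L i).qt_nonneg t) (fun i t => (L i).θc_nonneg _ _)
      fun i => (L i).sum_θc _
    rw [Finset.prod_const_one] at h
    calc _ = (∏ j, (S j).σc (o.1 j) (a j)) * ∑ t : ∀ i, (L i).T,
          (∏ i, (L i).qt (t i)) * ∏ i, (L i).θc (o.2 i) (t i) := by
          rw [Finset.mul_sum]
          exact Finset.sum_congr rfl fun t _ => by simp only [wordQ, decMetricC]; ring
      _ ≤ _ := mul_le_of_le_one_right (Finset.prod_nonneg fun j _ => (S j).σc_nonneg _ _) h
  · have := sum_pi_prod_mul_le (w := fun j => (S j).pa) (f := fun j z => (S j).σc (o.1 j) z)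
      (b := fun _ => 1) (fun j z => (S j).pa_nonneg _) (fun j z => (S j).σc_nonneg _ _)
      fun j => (S j).sum_σc _
    simpa [wordPa] using this

/-- The five terms belong to the correct word, a wrong `t`, a wrong satellite, both wrong, and a
wrong cluster. The last four are the error events of receiver `r`, each with the partial mean of the
metric that a fresh component leaves. -/
theorem codebookMean_decMetricR_le (o : (Fin n → Yr) × (Fin m → Vr)) (w : CodeWord S L) :
    codebookMean I K J (wordPa S) (wordβ S L) (wordQ L) (decMetricR S L o) w ≤
      decMetricR S L o w
      + Fintype.card J * ((∏ j, (S j).σr (o.1 j) (w.1 j) (w.2.1.1 j)) *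
          ∏ i, (L i).θR (o.2 i) (w.2.1.2 i))
      + Fintype.card K * ((∏ j, (S j).σ₁ (o.1 j) (w.1 j)) * ∏ i, (L i).θt (o.2 i) (w.2.2 i))
      + Fintype.card K * Fintype.card J * ∏ j, (S j).σ₁ (o.1 j) (w.1 j)
      + Fintype.card I * Fintype.card K * Fintype.card J := by
  refine codebookMean_le (wordPa_nonneg S) (wordβ_nonneg S L) (wordQ_nonneg L)
    (ft := fun a b => (∏ j, (S j).σr (o.1 j) (a j) (b.1 j)) * ∏ i, (L i).θR (o.2 i) (b.2 i))
    (fb := fun a t => (∏ j, (S j).σ₁ (o.1 j) (a j)) * ∏ i, (L i).θt (o.2 i) (t i))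
    (fbt := fun a => ∏ j, (S j).σ₁ (o.1 j) (a j)) (decMetricR_nonneg S L o) ?_ ?_ ?_ ?_
    w.1 w.2.1 w.2.2
  · intro a b
    have h := sum_pi_prod_mul_le (w := fun i => (L i).qt)
      (f := fun i t => (L i).θr (o.2 i) t (b.2 i)) (b := fun i => (L i).θR (o.2 i) (b.2 i))
      (fun i t => (L i).qt_nonneg t) (fun i t => (L i).θr_nonneg _ _ _)
      fun i => (L i).sum_qt_θr _ _
    calc _ = (∏ j, (S j).σr (o.1 j) (a j) (b.1 j)) * ∑ t : ∀ i, (L i).T,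
          (∏ i, (L i).qt (t i)) * ∏ i, (L i).θr (o.2 i) (t i) (b.2 i) := by
          rw [Finset.mul_sum]
          exact Finset.sum_congr rfl fun t _ => by simp only [wordQ, decMetricR]; ring
      _ ≤ _ := mul_le_mul_of_nonneg_left h (Finset.prod_nonneg fun j _ => (S j).σr_nonneg _ _ _)
  · intro a t
    exact sum_wordβ_mul_le S L (f := fun j z => (S j).σr (o.1 j) (a j) z)
      (g := fun i r => (L i).θr (o.2 i) (t i) r) (fun j z => (S j).σr_nonneg _ _ _)
      (fun i r => (L i).θr_nonneg _ _ _) (fun j => (S j).sum_σr _ _) fun i => (L i).sum_qr_θr _ _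
  · intro a
    have := sum_wordβ_mul_le S L (a := a) (f := fun j z => (S j).σr (o.1 j) (a j) z)
      (g := fun i r => (L i).θR (o.2 i) r) (bg := fun _ => 1) (fun j z => (S j).σr_nonneg _ _ _)
      (fun i r => (L i).θR_nonneg _ _) (fun j => (S j).sum_σr _ _) fun i => (L i).sum_θR _
    simpa using this
  · have := sum_pi_prod_mul_le (w := fun j => (S j).pa) (f := fun j z => (S j).σ₁ (o.1 j) z)
      (b := fun _ => 1) (fun j z => (S j).pa_nonneg _) (fun j z => (S j).σ₁_nonneg _ _)
      fun j => (S j).sum_σ₁ _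
    simpa [wordPa] using this

/-- The joint law of all words is the product of the letter laws. -/
theorem sum_codewordProb_mul (F : (∀ j, (X × Yc × Yr) × (S j).Zc × (S j).Zr) → ℝ)
    (H : (∀ i, (L i).T × (L i).R × U × Vc × Vr) → ℝ) :
    ∑ x : Fin n → X, ∑ u : Fin m → U, ∑ o : (Fin n → Yc × Yr) × (Fin m → Vc × Vr),
      ∑ w : CodeWord S L, codewordProb (wordPa S) (wordβ S L) (wordQ L) w *
        (encMetric S L x w * (wordκ S L w u * naturalProb P W x u o *
          (F (fun j => ((x j, o.1 j), w.1 j, w.2.1.1 j)) *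
            H (fun i => (w.2.2 i, w.2.1.2 i, u i, o.2 i))))) =
      (∑ s, (∏ j, (S j).prob (s j)) * F s) * ∑ s, (∏ i, (L i).prob (s i)) * H s := by
  have hF : ∑ s, (∏ j, (S j).prob (s j)) * F s = ∑ x : Fin n → X, ∑ y : Fin n → Yc × Yr,
      ∑ a : ∀ j, (S j).Zc, ∑ b : ∀ j, (S j).Zr,
        (∏ j, (S j).prob ((x j, y j), a j, b j)) * F (fun j => ((x j, y j), a j, b j)) := by
    rw [sum_pi_prodMk, sum_pi_prodMk]
    refine Finset.sum_congr rfl fun x _ => Finset.sum_congr rfl fun y _ => ?_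
    rw [sum_pi_prodMk]
  have hH : ∑ s, (∏ i, (L i).prob (s i)) * H s = ∑ t : ∀ i, (L i).T, ∑ r : ∀ i, (L i).R,
      ∑ u : Fin m → U, ∑ v : Fin m → Vc × Vr,
        (∏ i, (L i).prob (t i, r i, u i, v i)) * H (fun i => (t i, r i, u i, v i)) := by
    rw [sum_pi_prodMk]
    refine Finset.sum_congr rfl fun t _ => ?_
    rw [sum_pi_prodMk]
    refine Finset.sum_congr rfl fun r _ => ?_
    rw [sum_pi_prodMk]
  rw [hF, hH]
  set F' : (Fin n → X) → (Fin n → Yc × Yr) → (∀ j, (S j).Zc) → (∀ j, (S j).Zr) → ℝ :=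
    fun x y a b => (∏ j, (S j).prob ((x j, y j), a j, b j)) * F (fun j => ((x j, y j), a j, b j))
    with hF'
  set H' : (∀ i, (L i).T) → (∀ i, (L i).R) → (Fin m → U) → (Fin m → Vc × Vr) → ℝ :=
    fun t r u v => (∏ i, (L i).prob (t i, r i, u i, v i)) * H (fun i => (t i, r i, u i, v i))
    with hH'
  have hterm : ∀ (x : Fin n → X) (u : Fin m → U) (o : (Fin n → Yc × Yr) × (Fin m → Vc × Vr))
      (w : CodeWord S L), codewordProb (wordPa S) (wordβ S L) (wordQ L) w *
        (encMetric S L x w * (wordκ S L w u * naturalProb P W x u o *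
          (F (fun j => ((x j, o.1 j), w.1 j, w.2.1.1 j)) *
            H (fun i => (w.2.2 i, w.2.1.2 i, u i, o.2 i))))) =
      F' x o.1 w.1 w.2.1.1 * H' w.2.2 w.2.1.2 u o.2 := by
    intro x u o w
    simp only [hF', hH', codewordProb, wordPa, wordβ, wordQ, encMetric, wordκ, naturalProb,
      SourceLetter.prob, ChannelLetter.prob, Finset.prod_mul_distrib]
    ring
  simp only [hterm, Fintype.sum_prod_type]
  calc _ = ∑ x, ∑ u, ∑ y, ∑ v, ∑ a, ∑ b, ∑ r, ∑ t, F' x y a b * H' t r u v := rfl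
    _ = ∑ x, ∑ y, ∑ a, ∑ b, ∑ t, ∑ r, ∑ u, ∑ v, F' x y a b * H' t r u v := by
        refine Finset.sum_congr rfl fun x _ => ?_
        rw [Finset.sum_comm]
        refine Finset.sum_congr rfl fun y _ => ?_
        simp only [← Finset.mul_sum, ← Finset.sum_mul]
        congr 1
        rw [Finset.sum_comm]
        calc _ = ∑ v, ∑ u, ∑ t, ∑ r, H' t r u v :=
              Finset.sum_congr rfl fun v _ => Finset.sum_congr rfl fun u _ => Finset.sum_comm
          _ = ∑ u, ∑ v, ∑ t, ∑ r, H' t r u v := Finset.sum_comm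
          _ = ∑ u, ∑ t, ∑ v, ∑ r, H' t r u v :=
              Finset.sum_congr rfl fun u _ => Finset.sum_comm
          _ = ∑ t, ∑ u, ∑ v, ∑ r, H' t r u v := Finset.sum_comm
          _ = ∑ t, ∑ u, ∑ r, ∑ v, H' t r u v :=
              Finset.sum_congr rfl fun t _ => Finset.sum_congr rfl fun u _ => Finset.sum_comm
          _ = _ := Finset.sum_congr rfl fun t _ => Finset.sum_comm
    _ = _ := by
        simp only [← Finset.mul_sum, ← Finset.sum_mul]
        rfl

end Words

/-! ### From random to deterministic codes -/

section Derandomization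

variable {C Λ X S O Oc Or : Type*} [Fintype C] [Fintype Λ] [Fintype X] [Fintype S] [Fintype O]
  [Fintype Oc] [Fintype Or] [Nonempty Λ] [Nonempty S]

/-- A random codebook with a randomized encoder and two randomized decoders can be replaced by a
deterministic code which does at least as well on the sum of two rewards `okc` and `okr`; `rc` and
`rr` are lower bounds on the conditional expectations of these rewards. -/
theorem exists_deterministic_code {μ : C → ℝ} (hμ : ∀ c, 0 ≤ μ c) (hμ1 : ∑ c, μ c = 1)
    (πc : O → Oc) (πr : O → Or) {e : C → X → Λ → S → ℝ} (he : ∀ c x l u, 0 ≤ e c x l u)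
    (he1 : ∀ c x, ∑ l, ∑ u, e c x l u ≤ 1) {G : X → S → O → ℝ} (hG : ∀ x u o, 0 ≤ G x u o)
    {dc : C → Oc → Λ → ℝ} (hdc : ∀ c o l, 0 ≤ dc c o l) (hdc1 : ∀ c o, ∑ l, dc c o l ≤ 1)
    {dr : C → Or → Λ → ℝ} (hdr : ∀ c o l, 0 ≤ dr c o l) (hdr1 : ∀ c o, ∑ l, dr c o l ≤ 1)
    {okc okr : C → X → O → Λ → ℝ} (hokc : ∀ c x o l, 0 ≤ okc c x o l)
    (hokr : ∀ c x o l, 0 ≤ okr c x o l) {rc rr : C → X → S → O → Λ → ℝ}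
    (hrc : ∀ c x u o l, rc c x u o l ≤ ∑ l', dc c (πc o) l' * okc c x o l')
    (hrr : ∀ c x u o l, rr c x u o l ≤ ∑ l', dr c (πr o) l' * okr c x o l') :
    ∃ (c : C) (enc : X → S) (decc : Oc → Λ) (decr : Or → Λ),
      (∑ c, μ c * ∑ x, ∑ u, ∑ o, ∑ l, e c x l u * G x u o * rc c x u o l) +
        (∑ c, μ c * ∑ x, ∑ u, ∑ o, ∑ l, e c x l u * G x u o * rr c x u o l) ≤
      (∑ x, ∑ o, G x (enc x) o * okc c x o (decc (πc o))) +
        ∑ x, ∑ o, G x (enc x) o * okr c x o (decr (πr o)) := by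
  set F : C → X → S → ℝ := fun c x u => ∑ o, G x u o *
    (∑ l', dc c (πc o) l' * okc c x o l' + ∑ l', dr c (πr o) l' * okr c x o l') with hF
  have hF0 : ∀ c x u, 0 ≤ F c x u := fun c x u => Finset.sum_nonneg fun o _ =>
    mul_nonneg (hG _ _ _) (add_nonneg
      (Finset.sum_nonneg fun l _ => mul_nonneg (hdc _ _ _) (hokc _ _ _ _))
      (Finset.sum_nonneg fun l _ => mul_nonneg (hdr _ _ _) (hokr _ _ _ _)))
  have : Nonempty C := by
    by_contra hne
    rw [not_nonempty_iff] at hne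
    simp at hμ1
  -- The total reward is linear in each random choice, so the codebook is fixed first, then the
  -- encoder against the still randomized decoders, then the decoders. The decoders can be fixed
  -- separately, since each reward involves only one of them.
  obtain ⟨c, hc⟩ := exists_sum_mul_le hμ hμ1.le
    (f := fun c => ∑ x, ∑ u, ∑ l, e c x l u * F c x u) fun c =>
      Finset.sum_nonneg fun x _ => Finset.sum_nonneg fun u _ => Finset.sum_nonneg fun l _ =>
        mul_nonneg (he _ _ _ _) (hF0 _ _ _)
  obtain ⟨enc, henc⟩ := exists_encoder (he c) (he1 c) (hF0 c)
  obtain ⟨decc, hdecc⟩ := exists_decoder πc (H := fun x o => G x (enc x) o) (fun x o => hG _ _ _)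
    (hdc c) (hdc1 c) (hokc c)
  obtain ⟨decr, hdecr⟩ := exists_decoder πr (H := fun x o => G x (enc x) o) (fun x o => hG _ _ _)
    (hdr c) (hdr1 c) (hokr c)
  refine ⟨c, enc, decc, decr, ?_⟩
  refine le_trans ?_ (add_le_add hdecc hdecr)
  have hsplit : ∑ x, F c x (enc x) =
      (∑ x, ∑ o, G x (enc x) o * ∑ l, dc c (πc o) l * okc c x o l) +
        ∑ x, ∑ o, G x (enc x) o * ∑ l, dr c (πr o) l * okr c x o l := by
    simp only [hF, mul_add, Finset.sum_add_distrib]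
  rw [← hsplit]
  refine le_trans ?_ (hc.trans henc)
  rw [← Finset.sum_add_distrib]
  refine Finset.sum_le_sum fun c _ => ?_
  rw [← mul_add]
  refine mul_le_mul_of_nonneg_left ?_ (hμ c)
  simp only [← Finset.sum_add_distrib]
  refine Finset.sum_le_sum fun x _ => Finset.sum_le_sum fun u _ => ?_
  simp only [hF, Finset.mul_sum (s := (Finset.univ : Finset O))]
  rw [Finset.sum_comm]
  refine Finset.sum_le_sum fun l _ => Finset.sum_le_sum fun o _ => ?_
  rw [← mul_add, mul_assoc]
  exact mul_le_mul_of_nonneg_left (mul_le_mul_of_nonneg_left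
    (add_le_add (hrc c x u o l) (hrr c x u o l)) (hG _ _ _)) (he _ _ _ _)

end Derandomization

/-! ### Comparison of exponents -/

section Exponents

/-- Codebook sizes are integers. Rounding `2 ^ e` up at most doubles it because it is at least 1,
and `e'` is the exact exponent after rounding. -/
theorem exists_nat_eq_two_rpow {e : ℝ} (he : 0 ≤ e) :
    ∃ M : ℕ, 0 < M ∧ ∃ e' : ℝ, (M : ℝ) = 2 ^ e' ∧ e ≤ e' ∧ e' ≤ e + 1 := by
  have h1 : (1 : ℝ) ≤ 2 ^ e := Real.one_le_rpow (by norm_num) he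
  have hM : (0 : ℝ) < ⌈(2 : ℝ) ^ e⌉₊ := by linarith [Nat.le_ceil ((2 : ℝ) ^ e)]
  refine ⟨⌈(2 : ℝ) ^ e⌉₊, by exact_mod_cast hM, Real.logb 2 ⌈(2 : ℝ) ^ e⌉₊, ?_, ?_, ?_⟩
  · rw [Real.rpow_logb (by norm_num) (by norm_num) hM]
  · rw [Real.le_logb_iff_rpow_le (by norm_num) hM]
    exact Nat.le_ceil _
  · rw [Real.logb_le_iff_le_rpow (by norm_num) hM, Real.rpow_add (by norm_num), Real.rpow_one]
    linarith [Nat.ceil_lt_add_one (by linarith : (0 : ℝ) ≤ 2 ^ e)]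

theorem exists_exponent {ι : Type*} [Fintype ι] {f : ι → ℝ} (hf : ∀ i, 0 < f i) {μ h : ℝ}
    (hμ : |∑ i, Real.logb 2 (f i) - μ| ≤ h) :
    ∃ e : ℝ, ∏ i, f i = 2 ^ e ∧ μ - h ≤ e ∧ e ≤ μ + h := by
  rw [abs_le] at hμ
  exact ⟨_, prod_eq_two_rpow_sum_logb hf, by linarith, by linarith⟩

theorem two_rpow_le_mul {x y z : ℝ} (h : x ≤ y + z) : (2 : ℝ) ^ x ≤ 2 ^ y * 2 ^ z := by
  rw [← Real.rpow_add (by norm_num)]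
  exact Real.rpow_le_rpow_of_exponent_le (by norm_num) h

/-- In the tightest case, that of a word with the right centre and a fresh satellite and `t`, the
margin `2 * h` in the sizes pays `h` for the deviation of a typical sum and `h` for the factor `2 ^
(-h)`. -/
theorem enc_exponent_bound {a₁ a₂ g h r r₁ t I K J : ℝ} (hh : 0 ≤ h) (hg : 0 ≤ g) (hr : r ≤ a₂ + h)
    (hr₁ : r₁ ≤ a₁ + h) (ht : t ≤ g + h) (hI : a₁ + 2 * h ≤ I) (hK : a₂ - a₁ + 2 * h ≤ K)
    (hJ : g + 2 * h ≤ J) :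
    (2 : ℝ) ^ r * 2 ^ t + 2 ^ J * 2 ^ r + 2 ^ K * 2 ^ r₁ + 2 ^ K * 2 ^ J * 2 ^ r₁
      + 2 ^ I * 2 ^ K * 2 ^ J ≤ 2 ^ I * 2 ^ K * 2 ^ J * (1 + 4 * 2 ^ (-h)) := by
  simp only [← Real.rpow_add (show (0 : ℝ) < 2 by norm_num)]
  have e1 := two_rpow_le_mul (show r + t ≤ (I + K + J) + (-h) by linarith)
  have e2 := two_rpow_le_mul (show J + r ≤ (I + K + J) + (-h) by linarith)
  have e3 := two_rpow_le_mul (show K + r₁ ≤ (I + K + J) + (-h) by linarith)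
  have e4 := two_rpow_le_mul (show K + J + r₁ ≤ (I + K + J) + (-h) by linarith)
  linarith

/-- `h1` excludes a wrong `t` in the right cluster and `h2` a wrong cluster. -/
theorem decC_exponent_bound {a₁ g h sc hc s θ I J : ℝ} (hh : 1 ≤ h) (hs : sc - h ≤ s)
    (hθ : hc - h ≤ θ) (hI : I ≤ a₁ + 2 * h + 1) (hJ : J ≤ g + 2 * h + 1)
    (h1 : g + 12 * h ≤ hc) (h2 : a₁ + g + 12 * h ≤ sc + hc) :
    (2 : ℝ) ^ s * 2 ^ θ + 2 ^ J * 2 ^ s + 2 ^ I * 2 ^ J ≤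
      2 ^ s * 2 ^ θ * (1 + 2 * 2 ^ (-h)) := by
  simp only [← Real.rpow_add (show (0 : ℝ) < 2 by norm_num)]
  have e1 := two_rpow_le_mul (show J + s ≤ (s + θ) + (-h) by linarith)
  have e2 := two_rpow_le_mul (show I + J ≤ (s + θ) + (-h) by linarith)
  linarith

/-- The hypotheses `h1`, `h2`, `h4`, `h5` exclude a wrong `t`, a wrong satellite, both, and a wrong
cluster. The constant 12 is set by the last event: the three sizes exceed their exponents by up to
`6 * h + 3`, the typical metrics fall short by up to `2 * h`, and the factor `2 ^ (-h)` takes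
another `h`; finally `9 * h + 3 ≤ 12 * h` as `h ≥ 1`. -/
theorem decR_exponent_bound {a₁ a₂ g h sr s₁ h3 ht hR s σ θ θt θR I K J : ℝ} (hh : 1 ≤ h)
    (hs : sr - h ≤ s) (hσ : σ ≤ s₁ + h) (hθ : h3 - h ≤ θ) (hθt : θt ≤ ht + h) (hθR : θR ≤ hR + h)
    (hI : I ≤ a₁ + 2 * h + 1) (hK : K ≤ a₂ - a₁ + 2 * h + 1) (hJ : J ≤ g + 2 * h + 1)
    (h1 : g + hR + 12 * h ≤ h3) (h2 : a₂ - a₁ + s₁ + ht + 12 * h ≤ sr + h3)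
    (h4 : a₂ - a₁ + s₁ + g + 12 * h ≤ sr + h3) (h5 : a₂ + g + 12 * h ≤ sr + h3) :
    (2 : ℝ) ^ s * 2 ^ θ + 2 ^ J * (2 ^ s * 2 ^ θR) + 2 ^ K * (2 ^ σ * 2 ^ θt)
      + 2 ^ K * 2 ^ J * 2 ^ σ + 2 ^ I * 2 ^ K * 2 ^ J ≤
      2 ^ s * 2 ^ θ * (1 + 4 * 2 ^ (-h)) := by
  simp only [← Real.rpow_add (show (0 : ℝ) < 2 by norm_num)]
  have e1 := two_rpow_le_mul (show J + (s + θR) ≤ (s + θ) + (-h) by linarith)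
  have e2 := two_rpow_le_mul (show K + (σ + θt) ≤ (s + θ) + (-h) by linarith)
  have e3 := two_rpow_le_mul (show K + J + σ ≤ (s + θ) + (-h) by linarith)
  have e4 := two_rpow_le_mul (show I + K + J ≤ (s + θ) + (-h) by linarith)
  linarith

end Exponents

/-! ### Exponents and distortions of typical words -/

section Block

variable {X Yc Yr U Vc Vr Xc Xr : Type*} [Fintype X] [Fintype Yc] [Fintype Yr] [Fintype U]
  [Fintype Vc] [Fintype Vr] {P : X × Yc × Yr → ℝ} {W : U → Vc × Vr → ℝ} {n m : ℕ}
  (S : Fin n → SourceLetter P Xc Xr) (L : Fin m → ChannelLetter W)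
  (dC : X → Xc → ℝ≥0) (dR : X → Xr → ℝ≥0)

/-- Expectation of a statistic of the source, summed over the positions. -/
def sourceMean (q : Fin 7) : ℝ := ∑ j, (S j).mean dC dR q

/-- Expectation of a statistic of the channel, summed over the positions. -/
def channelMean (q : Fin 5) : ℝ := ∑ i, (L i).mean q

/-- Typical source words. -/
abbrev SourceTypical (h : ℝ) (s : ∀ j, (X × Yc × Yr) × (S j).Zc × (S j).Zr) : Prop :=
  IsTypical (fun j => (S j).prob) (fun j q => (S j).stat dC dR q) h s

/-- Typical channel words. -/
abbrev ChannelTypical (h : ℝ) (s : ∀ i, (L i).T × (L i).R × U × Vc × Vr) : Prop :=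
  IsTypical (fun i => (L i).prob) (fun i q => (L i).stat q) h s

variable {S L dC dR}

theorem SourceTypical.exponents {h : ℝ} {s : ∀ j, (X × Yc × Yr) × (S j).Zc × (S j).Zr}
    (hs : SourceTypical S dC dR h s) :
    (∃ e : ℝ, ∏ j, (S j).ρ (s j).1.1 (s j).2.1 (s j).2.2 = 2 ^ e ∧
      e ≤ sourceMean S dC dR 0 + h) ∧
    (∃ e : ℝ, ∏ j, (S j).ρ₁ (s j).1.1 (s j).2.1 = 2 ^ e ∧ e ≤ sourceMean S dC dR 1 + h) ∧
    (∃ e : ℝ, ∏ j, (S j).σc (s j).1.2.1 (s j).2.1 = 2 ^ e ∧ sourceMean S dC dR 2 - h ≤ e) ∧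
    (∃ e : ℝ, ∏ j, (S j).σr (s j).1.2.2 (s j).2.1 (s j).2.2 = 2 ^ e ∧
      sourceMean S dC dR 3 - h ≤ e) ∧
    (∃ e : ℝ, ∏ j, (S j).σ₁ (s j).1.2.2 (s j).2.1 = 2 ^ e ∧ e ≤ sourceMean S dC dR 4 + h) := by
  obtain ⟨hpos, hq⟩ := hs
  have hp := fun j => (S j).pos (s j) (hpos j)
  obtain ⟨e0, h0, -, h0'⟩ := exists_exponent (fun j => (hp j).1) (hq 0)
  obtain ⟨e1, h1, -, h1'⟩ := exists_exponent (fun j => (hp j).2.1) (hq 1)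
  obtain ⟨e2, h2, h2', -⟩ := exists_exponent (fun j => (hp j).2.2.1) (hq 2)
  obtain ⟨e3, h3, h3', -⟩ := exists_exponent (fun j => (hp j).2.2.2.1) (hq 3)
  obtain ⟨e4, h4, -, h4'⟩ := exists_exponent (fun j => (hp j).2.2.2.2) (hq 4)
  exact ⟨⟨e0, h0, h0'⟩, ⟨e1, h1, h1'⟩, ⟨e2, h2, h2'⟩, ⟨e3, h3, h3'⟩, ⟨e4, h4, h4'⟩⟩

theorem SourceTypical.distC_le {h : ℝ} {s : ∀ j, (X × Yc × Yr) × (S j).Zc × (S j).Zr}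
    (hs : SourceTypical S dC dR h s) :
    ∑ j, (dC (s j).1.1 ((S j).gc ((s j).2.1, (s j).1.2.1)) : ℝ) ≤ sourceMean S dC dR 5 + h := by
  have := (abs_le.mp (hs.2 5)).2
  change ∑ j, (dC (s j).1.1 ((S j).gc ((s j).2.1, (s j).1.2.1)) : ℝ) - sourceMean S dC dR 5 ≤ h
    at this
  linarith

theorem SourceTypical.distR_le {h : ℝ} {s : ∀ j, (X × Yc × Yr) × (S j).Zc × (S j).Zr}
    (hs : SourceTypical S dC dR h s) :
    ∑ j, (dR (s j).1.1 ((S j).gr ((s j).2.2, (s j).1.2.2)) : ℝ) ≤ sourceMean S dC dR 6 + h := by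
  have := (abs_le.mp (hs.2 6)).2
  change ∑ j, (dR (s j).1.1 ((S j).gr ((s j).2.2, (s j).1.2.2)) : ℝ) - sourceMean S dC dR 6 ≤ h
    at this
  linarith

theorem ChannelTypical.exponents {h : ℝ} {s : ∀ i, (L i).T × (L i).R × U × Vc × Vr}
    (hs : ChannelTypical L h s) :
    (∃ e : ℝ, ∏ i, (L i).τ (s i).1 (s i).2.1 = 2 ^ e ∧ e ≤ channelMean L 0 + h) ∧
    (∃ e : ℝ, ∏ i, (L i).θc (s i).2.2.2.1 (s i).1 = 2 ^ e ∧ channelMean L 1 - h ≤ e) ∧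
    (∃ e : ℝ, ∏ i, (L i).θr (s i).2.2.2.2 (s i).1 (s i).2.1 = 2 ^ e ∧ channelMean L 2 - h ≤ e) ∧
    (∃ e : ℝ, ∏ i, (L i).θt (s i).2.2.2.2 (s i).1 = 2 ^ e ∧ e ≤ channelMean L 3 + h) ∧
    (∃ e : ℝ, ∏ i, (L i).θR (s i).2.2.2.2 (s i).2.1 = 2 ^ e ∧ e ≤ channelMean L 4 + h) := by
  obtain ⟨hpos, hq⟩ := hs
  have hp := fun i => (L i).pos (s i) (hpos i)
  obtain ⟨e0, h0, -, h0'⟩ := exists_exponent (fun j => (hp j).1) (hq 0)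
  obtain ⟨e1, h1, h1', -⟩ := exists_exponent (fun j => (hp j).2.1) (hq 1)
  obtain ⟨e2, h2, h2', -⟩ := exists_exponent (fun j => (hp j).2.2.1) (hq 2)
  obtain ⟨e3, h3, -, h3'⟩ := exists_exponent (fun j => (hp j).2.2.2.1) (hq 3)
  obtain ⟨e4, h4, -, h4'⟩ := exists_exponent (fun j => (hp j).2.2.2.2) (hq 4)
  exact ⟨⟨e0, h0, h0'⟩, ⟨e1, h1, h1'⟩, ⟨e2, h2, h2'⟩, ⟨e3, h3, h3'⟩, ⟨e4, h4, h4'⟩⟩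

end Block

/-! ### Existence of a good block code -/

section ExistsCode

variable {X Yc Yr U Vc Vr Xc Xr : Type*} [Fintype Vc] [Fintype Vr] {P : X × Yc × Yr → ℝ} {W : U → Vc × Vr → ℝ} {n m : ℕ}

/-- What receiver `c` observes. -/
def obsC (o : (Fin n → Yc × Yr) × (Fin m → Vc × Vr)) : (Fin n → Yc) × (Fin m → Vc) :=
  (fun j => (o.1 j).1, fun i => (o.2 i).1)

/-- What receiver `r` observes. -/
def obsR (o : (Fin n → Yc × Yr) × (Fin m → Vc × Vr)) : (Fin n → Yr) × (Fin m → Vr) :=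
  (fun j => (o.1 j).2, fun i => (o.2 i).2)

theorem naturalProb_nonneg (hP : ∀ s, 0 ≤ P s) (hW : IsChannel W) (x : Fin n → X) (u : Fin m → U)
    (o : (Fin n → Yc × Yr) × (Fin m → Vc × Vr)) : 0 ≤ naturalProb P W x u o :=
  mul_nonneg (Finset.prod_nonneg fun _ _ => hP _) (Finset.prod_nonneg fun _ _ => (hW _).1 _)

variable [Fintype X] [Fintype Yc] [Fintype Yr]

theorem sum_naturalProb_mul (enc : (Fin n → X) → (Fin m → U))
    (F : (Fin n → X) → (Fin n → Yc × Yr) × (Fin m → Vc × Vr) → ℝ) :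
    ∑ x, ∑ o, naturalProb P W x (enc x) o * F x o = ∑ s : Fin n → X × Yc × Yr,
      ∑ v : Fin m → Vc × Vr, blockProb P W enc s v *
        F (fun j => (s j).1) (fun j => (s j).2, v) := by
  rw [sum_pi_prodMk]
  refine Finset.sum_congr rfl fun x _ => ?_
  rw [Fintype.sum_prod_type]
  rfl

variable [Fintype U] (S : Fin n → SourceLetter P Xc Xr) (L : Fin m → ChannelLetter W)
  (dC : X → Xc → ℝ≥0) (dR : X → Xr → ℝ≥0)

open Classical in
/-- Indicator of the typical configurations. -/
def typicalWeight (h : ℝ) (x : Fin n → X) (u : Fin m → U)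
    (o : (Fin n → Yc × Yr) × (Fin m → Vc × Vr)) (w : CodeWord S L) : ℝ :=
  (if SourceTypical S dC dR h (fun j => ((x j, o.1 j), w.1 j, w.2.1.1 j)) then 1 else 0) *
    (if ChannelTypical L h (fun i => (w.2.2 i, w.2.1.2 i, u i, o.2 i)) then 1 else 0)

theorem typicalWeight_nonneg (h : ℝ) (x : Fin n → X) (u : Fin m → U)
    (o : (Fin n → Yc × Yr) × (Fin m → Vc × Vr)) (w : CodeWord S L) :
    0 ≤ typicalWeight S L dC dR h x u o w := by
  unfold typicalWeight
  split_ifs <;> norm_num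

theorem typicalWeight_le_one (h : ℝ) (x : Fin n → X) (u : Fin m → U)
    (o : (Fin n → Yc × Yr) × (Fin m → Vc × Vr)) (w : CodeWord S L) :
    typicalWeight S L dC dR h x u o w ≤ 1 := by
  unfold typicalWeight
  split_ifs <;> norm_num

variable {S L dC dR}

theorem typical_of_typicalWeight_ne_zero {h : ℝ} {x : Fin n → X} {u : Fin m → U}
    {o : (Fin n → Yc × Yr) × (Fin m → Vc × Vr)} {w : CodeWord S L}
    (hg : typicalWeight S L dC dR h x u o w ≠ 0) :
    SourceTypical S dC dR h (fun j => ((x j, o.1 j), w.1 j, w.2.1.1 j)) ∧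
      ChannelTypical L h (fun i => (w.2.2 i, w.2.1.2 i, u i, o.2 i)) := by
  unfold typicalWeight at hg
  constructor
  · by_contra hc; simp [hc] at hg
  · by_contra hc; simp [hc] at hg

/-- The codebook law, tilted by the encoding metric and followed by input map, source and channel,
is the product of the ideal letter laws. Under that law source and channel words are independent and
typical with high probability. -/
theorem le_sum_typicalWeight (hP : P ∈ stdSimplex ℝ (X × Yc × Yr)) (hW : IsChannel W)
    {h CS CL : ℝ} (hh : 0 < h) (hCS : ∀ j q, ∑ s, (S j).prob s * (S j).stat dC dR q s ^ 2 ≤ CS)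
    (hCL : ∀ i q, ∑ s, (L i).prob s * (L i).stat q s ^ 2 ≤ CL) {e : ℝ} (he : 0 ≤ e) :
    1 - 7 * (n * CS / h ^ 2) - 5 * (m * CL / h ^ 2) - e ≤ (1 - e) *
      ∑ x : Fin n → X, ∑ u : Fin m → U, ∑ o : (Fin n → Yc × Yr) × (Fin m → Vc × Vr),
        ∑ w : CodeWord S L, codewordProb (wordPa S) (wordβ S L) (wordQ L) w *
        (encMetric S L x w * (wordκ S L w u * naturalProb P W x u o *
          typicalWeight S L dC dR h x u o w)) := by
  classical
  have key := sum_codewordProb_mul (P := P) (W := W) S L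
    (fun s => if SourceTypical S dC dR h s then 1 else 0)
    (fun s => if ChannelTypical L h s then 1 else 0)
  have hs := one_sub_le_prob_isTypical (fun j => (S j).prob) (fun j => (S j).prob_nonneg hP.1)
    (fun j => (S j).sum_prob) (fun j q => (S j).stat dC dR q) hh hCS
  have hc := one_sub_le_prob_isTypical (fun j => (L j).prob) (fun j => (L j).prob_nonneg hW)
    (fun j => (L j).sum_prob) (fun j q => (L j).stat q) hh hCL
  have hs1 : (∑ s, (∏ j, (S j).prob (s j)) * if SourceTypical S dC dR h s then 1 else 0) ≤ 1 := by
    refine le_trans (Finset.sum_le_sum fun s _ => mul_le_of_le_one_right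
      (Finset.prod_nonneg fun j _ => (S j).prob_nonneg hP.1 _) ?_)
      (sum_pi_prod_eq_one (fun j => (S j).prob) fun j => (S j).sum_prob).le
    split_ifs <;> norm_num
  have hc1 : (∑ s, (∏ j, (L j).prob (s j)) * if ChannelTypical L h s then 1 else 0) ≤ 1 := by
    refine le_trans (Finset.sum_le_sum fun s _ => mul_le_of_le_one_right
      (Finset.prod_nonneg fun j _ => (L j).prob_nonneg hW _) ?_)
      (sum_pi_prod_eq_one (fun j => (L j).prob) fun j => (L j).sum_prob).le
    split_ifs <;> norm_num
  have hs0 : 0 ≤ (∑ s, (∏ j, (S j).prob (s j)) * if SourceTypical S dC dR h s then (1 : ℝ) else 0) :=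
    Finset.sum_nonneg fun s _ => mul_nonneg
      (Finset.prod_nonneg fun j _ => (S j).prob_nonneg hP.1 _) (by split_ifs <;> norm_num)
  have hc0 : 0 ≤ (∑ s, (∏ j, (L j).prob (s j)) * if ChannelTypical L h s then (1 : ℝ) else 0) :=
    Finset.sum_nonneg fun s _ => mul_nonneg
      (Finset.prod_nonneg fun j _ => (L j).prob_nonneg hW _) (by split_ifs <;> norm_num)
  simp only [Fintype.card_fin] at hs hc
  have e7 : ((7 : ℕ) : ℝ) = 7 := by norm_num
  have e5 : ((5 : ℕ) : ℝ) = 5 := by norm_num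
  rw [e7] at hs
  rw [e5] at hc
  unfold typicalWeight
  rw [key]
  set p := ∑ s, (∏ j, (S j).prob (s j)) * if SourceTypical S dC dR h s then (1 : ℝ) else 0
  set q := ∑ s, (∏ j, (L j).prob (s j)) * if ChannelTypical L h s then (1 : ℝ) else 0
  -- This is (1 - p)(1 - q) ≥ 0.
  have h1 : p + q - 1 ≤ p * q := by nlinarith
  have h2 : p * q ≤ 1 := mul_le_one₀ hs1 hc0 hc1
  have h3 : e * (p * q) ≤ e := mul_le_of_le_one_right he h2
  have hs' : 1 - 7 * (n * CS / h ^ 2) ≤ p := hs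
  have hc' : 1 - 5 * (m * CL / h ^ 2) ≤ q := hc
  linarith

variable {M₁ M₂ Mt : ℕ}

/-- Here `L` is `M₂`: receiver `c` has to find the centre and `t`, and `M₂` words of the codebook
share them. -/
theorem le_sum_coding_c (hP : P ∈ stdSimplex ℝ (X × Yc × Yr)) (hW : IsChannel W)
    (h₁ : 0 < M₁) (h₂ : 0 < M₂) (ht : 0 < Mt) {e₁ e₂ et h : ℝ} (hh : 1 ≤ h)
    (hM₁ : (M₁ : ℝ) = 2 ^ e₁) (hM₂ : (M₂ : ℝ) = 2 ^ e₂) (hMt : (Mt : ℝ) = 2 ^ et)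
    (he₁ : sourceMean S dC dR 1 + 2 * h ≤ e₁) (he₁' : e₁ ≤ sourceMean S dC dR 1 + 2 * h + 1)
    (he₂ : sourceMean S dC dR 0 - sourceMean S dC dR 1 + 2 * h ≤ e₂)
    (het : channelMean L 0 + 2 * h ≤ et) (het' : et ≤ channelMean L 0 + 2 * h + 1)
    (hg : 0 ≤ channelMean L 0) (hc1 : channelMean L 0 + 12 * h ≤ channelMean L 1)
    (hc2 : sourceMean S dC dR 1 + channelMean L 0 + 12 * h ≤
      sourceMean S dC dR 2 + channelMean L 1) :
    (1 - 4 * 2 ^ (-h) - 4 * 2 ^ (-h)) *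
      ∑ x : Fin n → X, ∑ u : Fin m → U, ∑ o : (Fin n → Yc × Yr) × (Fin m → Vc × Vr),
        ∑ w : CodeWord S L, codewordProb (wordPa S) (wordβ S L) (wordQ L) w *
        (encMetric S L x w * (wordκ S L w u * naturalProb P W x u o *
          typicalWeight S L dC dR h x u o w)) ≤
    ∑ c : Fin M₁ → _ × (Fin M₂ → _) × (Fin Mt → _),
      (∏ i, clusterProb (wordPa S) (wordβ S L) (wordQ L) (c i)) *
      ∑ x, ∑ u, ∑ o, ∑ l, encMetric S L x (codeword c l) /
        (∑ l', encMetric S L x (codeword c l')) * wordκ S L (codeword c l) u *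
        naturalProb P W x u o *
        (M₂ * decMetricC S L (obsC o) (codeword c l).1 (codeword c l).2.2 /
          (∑ l', decMetricC S L (obsC o) (codeword c l').1 (codeword c l').2.2) *
          typicalWeight S L dC dR h x u o (codeword c l)) := by
  have : Nonempty (Fin M₁) := ⟨⟨0, h₁⟩⟩
  have : Nonempty (Fin M₂) := ⟨⟨0, h₂⟩⟩
  have : Nonempty (Fin Mt) := ⟨⟨0, ht⟩⟩
  have hE : (0 : ℝ) < 2 ^ (-h) := Real.rpow_pos_of_pos (by norm_num) _
  refine le_sum_likelihood_coding
    (mean := codebookMean (Fin M₁) (Fin M₂) (Fin Mt) (wordPa S) (wordβ S L) (wordQ L))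
    (ν := codewordProb (wordPa S) (wordβ S L) (wordQ L)) (fe := encMetric S L)
    (fd := fun o w => decMetricC S L (obsC o) w.1 w.2.2)
    (fun c => Finset.prod_nonneg fun i _ => mul_nonneg (wordPa_nonneg S _) (mul_nonneg
      (Finset.prod_nonneg fun k _ => wordβ_nonneg S L _ _)
      (Finset.prod_nonneg fun k _ => wordQ_nonneg L _)))
    (fun w => mul_nonneg (wordPa_nonneg S _) (mul_nonneg (wordβ_nonneg S L _ _)
      (wordQ_nonneg L _)))
    (sum_codebook_mul (sum_wordPa S) (sum_wordβ S L) (sum_wordQ L))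
    (sum_codebook_mul_sum (sum_wordPa S) (sum_wordβ S L) (sum_wordQ L))
    (encMetric_nonneg S L) (fun o w => decMetricC_nonneg S L _ _ _) (wordκ_nonneg S L)
    (naturalProb_nonneg hP.1 hW) (typicalWeight_nonneg S L dC dR h)
    (by exact_mod_cast h₂) ?_
  intro x u o w hgw
  obtain ⟨hs, hc⟩ := typical_of_typicalWeight_ne_zero hgw
  obtain ⟨⟨r, hr, hr'⟩, ⟨r₁, hr₁, hr₁'⟩, ⟨s, hσ, hσ'⟩, -, -⟩ := hs.exponents
  obtain ⟨⟨t, hτ, hτ'⟩, ⟨θ, hθ, hθ'⟩, -, -, -⟩ := hc.exponents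
  have hd : decMetricC S L (obsC o) w.1 w.2.2 = 2 ^ s * 2 ^ θ := by
    rw [← hσ, ← hθ]; rfl
  have hd0 : 0 < decMetricC S L (obsC o) w.1 w.2.2 := by rw [hd]; positivity
  refine ⟨hd0, ?_, ?_⟩
  · refine (codebookMean_encMetric_le S L x w).trans ?_
    have := enc_exponent_bound (by linarith) hg hr' hr₁' hτ' he₁ he₂ het
    simp only [Fintype.card_prod, Fintype.card_fin, Nat.cast_mul, hM₁, hM₂, hMt]
    rw [← hr, ← hr₁, ← hτ] at this
    rw [← mul_assoc]
    exact this
  · refine (codebookMean_decMetricC_le S L (obsC o) w).trans ?_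
    have := decC_exponent_bound hh hσ' hθ' he₁' het' hc1 hc2
    rw [hd, Fintype.card_fin, Fintype.card_fin, Fintype.card_fin, mul_assoc]
    refine mul_le_mul_of_nonneg_left ?_ (Nat.cast_nonneg _)
    have hσ2 : ∏ j, (S j).σc ((obsC o).1 j) (w.1 j) = 2 ^ s := hσ
    rw [hσ2, hM₁, hMt]
    -- Two error events would allow the constant 2; it is weakened to 4 so that both receivers have
    -- the same prefactor.
    refine this.trans (mul_le_mul_of_nonneg_left ?_ (by positivity))
    linarith

theorem le_sum_coding_r (hP : P ∈ stdSimplex ℝ (X × Yc × Yr)) (hW : IsChannel W)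
    (h₁ : 0 < M₁) (h₂ : 0 < M₂) (ht : 0 < Mt) {e₁ e₂ et h : ℝ} (hh : 1 ≤ h)
    (hM₁ : (M₁ : ℝ) = 2 ^ e₁) (hM₂ : (M₂ : ℝ) = 2 ^ e₂) (hMt : (Mt : ℝ) = 2 ^ et)
    (he₁ : sourceMean S dC dR 1 + 2 * h ≤ e₁) (he₁' : e₁ ≤ sourceMean S dC dR 1 + 2 * h + 1)
    (he₂ : sourceMean S dC dR 0 - sourceMean S dC dR 1 + 2 * h ≤ e₂)
    (he₂' : e₂ ≤ sourceMean S dC dR 0 - sourceMean S dC dR 1 + 2 * h + 1)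
    (het : channelMean L 0 + 2 * h ≤ et) (het' : et ≤ channelMean L 0 + 2 * h + 1)
    (hg : 0 ≤ channelMean L 0)
    (hr1 : channelMean L 0 + channelMean L 4 + 12 * h ≤ channelMean L 2)
    (hr2 : sourceMean S dC dR 0 - sourceMean S dC dR 1 + sourceMean S dC dR 4 + channelMean L 3
      + 12 * h ≤ sourceMean S dC dR 3 + channelMean L 2)
    (hr3 : sourceMean S dC dR 0 - sourceMean S dC dR 1 + sourceMean S dC dR 4 + channelMean L 0
      + 12 * h ≤ sourceMean S dC dR 3 + channelMean L 2)
    (hr4 : sourceMean S dC dR 0 + channelMean L 0 + 12 * h ≤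
      sourceMean S dC dR 3 + channelMean L 2) :
    (1 - 4 * 2 ^ (-h) - 4 * 2 ^ (-h)) *
      ∑ x : Fin n → X, ∑ u : Fin m → U, ∑ o : (Fin n → Yc × Yr) × (Fin m → Vc × Vr),
        ∑ w : CodeWord S L, codewordProb (wordPa S) (wordβ S L) (wordQ L) w *
        (encMetric S L x w * (wordκ S L w u * naturalProb P W x u o *
          typicalWeight S L dC dR h x u o w)) ≤
    ∑ c : Fin M₁ → _ × (Fin M₂ → _) × (Fin Mt → _),
      (∏ i, clusterProb (wordPa S) (wordβ S L) (wordQ L) (c i)) *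
      ∑ x, ∑ u, ∑ o, ∑ l, encMetric S L x (codeword c l) /
        (∑ l', encMetric S L x (codeword c l')) * wordκ S L (codeword c l) u *
        naturalProb P W x u o *
        (1 * decMetricR S L (obsR o) (codeword c l) /
          (∑ l', decMetricR S L (obsR o) (codeword c l')) *
          typicalWeight S L dC dR h x u o (codeword c l)) := by
  have : Nonempty (Fin M₁) := ⟨⟨0, h₁⟩⟩
  have : Nonempty (Fin M₂) := ⟨⟨0, h₂⟩⟩
  have : Nonempty (Fin Mt) := ⟨⟨0, ht⟩⟩
  refine le_sum_likelihood_coding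
    (mean := codebookMean (Fin M₁) (Fin M₂) (Fin Mt) (wordPa S) (wordβ S L) (wordQ L))
    (ν := codewordProb (wordPa S) (wordβ S L) (wordQ L)) (fe := encMetric S L)
    (fd := fun o w => decMetricR S L (obsR o) w)
    (fun c => Finset.prod_nonneg fun i _ => mul_nonneg (wordPa_nonneg S _) (mul_nonneg
      (Finset.prod_nonneg fun k _ => wordβ_nonneg S L _ _)
      (Finset.prod_nonneg fun k _ => wordQ_nonneg L _)))
    (fun w => mul_nonneg (wordPa_nonneg S _) (mul_nonneg (wordβ_nonneg S L _ _)
      (wordQ_nonneg L _)))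
    (sum_codebook_mul (sum_wordPa S) (sum_wordβ S L) (sum_wordQ L))
    (sum_codebook_mul_sum (sum_wordPa S) (sum_wordβ S L) (sum_wordQ L))
    (encMetric_nonneg S L) (fun o w => decMetricR_nonneg S L _ _) (wordκ_nonneg S L)
    (naturalProb_nonneg hP.1 hW) (typicalWeight_nonneg S L dC dR h)
    one_pos ?_
  intro x u o w hgw
  obtain ⟨hs, hc⟩ := typical_of_typicalWeight_ne_zero hgw
  obtain ⟨⟨r, hr, hr'⟩, ⟨r₁, hr₁, hr₁'⟩, -, ⟨s, hσ, hσ'⟩, ⟨σ, hσ₁, hσ₁'⟩⟩ := hs.exponents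
  obtain ⟨⟨t, hτ, hτ'⟩, -, ⟨θ, hθ, hθ'⟩, ⟨θt, hθt, hθt'⟩, ⟨θR, hθR, hθR'⟩⟩ := hc.exponents
  have hd : decMetricR S L (obsR o) w = 2 ^ s * 2 ^ θ := by
    rw [← hσ, ← hθ]; rfl
  have hd0 : 0 < decMetricR S L (obsR o) w := by rw [hd]; positivity
  refine ⟨hd0, ?_, ?_⟩
  · refine (codebookMean_encMetric_le S L x w).trans ?_
    have := enc_exponent_bound (by linarith) hg hr' hr₁' hτ' he₁ he₂ het
    simp only [Fintype.card_prod, Fintype.card_fin, Nat.cast_mul, hM₁, hM₂, hMt]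
    rw [← hr, ← hr₁, ← hτ] at this
    rw [← mul_assoc]
    exact this
  · refine (codebookMean_decMetricR_le S L (obsR o) w).trans ?_
    have := decR_exponent_bound hh hσ' hσ₁' hθ' hθt' hθR' he₁' he₂' het' hr1 hr2 hr3 hr4
    rw [hd, Fintype.card_fin, Fintype.card_fin, Fintype.card_fin, one_mul, hM₁, hM₂, hMt]
    have hx1 : ∏ j, (S j).σr ((obsR o).1 j) (w.1 j) (w.2.1.1 j) = 2 ^ s := hσ
    have hx2 : ∏ j, (S j).σ₁ ((obsR o).1 j) (w.1 j) = 2 ^ σ := hσ₁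
    have hx3 : ∏ i, (L i).θt ((obsR o).2 i) (w.2.2 i) = 2 ^ θt := hθt
    have hx4 : ∏ i, (L i).θR ((obsR o).2 i) (w.2.1.2 i) = 2 ^ θR := hθR
    rw [hx1, hx2, hx3, hx4]
    exact this

theorem card_mul_le_sum {I K J : Type*} [Fintype I] [Fintype K] [Fintype J] {f : I × K × J → ℝ}
    (hf : ∀ l, 0 ≤ f l) {i : I} {j : J} {a : ℝ} (ha : ∀ k, f (i, k, j) = a) :
    Fintype.card K * a ≤ ∑ l, f l := by
  classical
  calc Fintype.card K * a = ∑ l ∈ Finset.univ.map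
        ⟨fun k : K => (i, k, j), fun k k' h => by simpa using h⟩, f l := by
        rw [Finset.sum_map]
        exact ((Finset.sum_congr rfl fun k _ => ha k).trans (by simp)).symm
    _ ≤ _ := Finset.sum_le_sum_of_subset_of_nonneg (Finset.subset_univ _) fun l _ _ => hf l

theorem sum_div_sum_le_one {Λ : Type*} [Fintype Λ] (f : Λ → ℝ) :
    ∑ l, f l / (∑ l', f l') ≤ 1 := by
  rw [← Finset.sum_div]
  exact div_self_le_one _

theorem sum_mul_const_mul {C X S O Λ : Type*} [Fintype C] [Fintype X] [Fintype S] [Fintype O]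
    [Fintype Λ] (μ : C → ℝ) (e r : C → X → S → O → Λ → ℝ) (α : ℝ) :
    ∑ c, μ c * ∑ x, ∑ u, ∑ o, ∑ l, e c x u o l * (α * r c x u o l) =
      α * ∑ c, μ c * ∑ x, ∑ u, ∑ o, ∑ l, e c x u o l * r c x u o l := by
  simp only [mul_left_comm _ α, ← Finset.mul_sum]

/-- The `M₂` words with the same centre and the same `t` have equal metrics and lead to the same
reconstruction. Decoding to any of them is a success, so their probabilities add up to the factor
`M₂`. -/
theorem typicalReward_c_le {α h : ℝ} (hα : 0 ≤ α)
    (c : Fin M₁ → (∀ j, (S j).Zc) × (Fin M₂ → (∀ j, (S j).Zr) × ∀ i, (L i).R) ×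
      (Fin Mt → ∀ i, (L i).T))
    (x : Fin n → X) (u : Fin m → U) (o : (Fin n → Yc × Yr) × (Fin m → Vc × Vr))
    (l : Fin M₁ × Fin M₂ × Fin Mt) {ok : Fin M₁ × Fin M₂ × Fin Mt → ℝ} (hok0 : ∀ l, 0 ≤ ok l)
    (hok : ∑ j, (dC (x j) ((S j).gc ((codeword c l).1 j, (o.1 j).1)) : ℝ) ≤
      sourceMean S dC dR 5 + h → ∀ k, ok (l.1, k, l.2.2) = 1) :
    α * (M₂ * decMetricC S L (obsC o) (codeword c l).1 (codeword c l).2.2 /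
      (∑ l', decMetricC S L (obsC o) (codeword c l').1 (codeword c l').2.2) *
      typicalWeight S L dC dR h x u o (codeword c l)) ≤
    ∑ l', decMetricC S L (obsC o) (codeword c l').1 (codeword c l').2.2 /
      (∑ l', decMetricC S L (obsC o) (codeword c l').1 (codeword c l').2.2) * (α * ok l') := by
  have hS : 0 ≤ ∑ l', decMetricC S L (obsC o) (codeword c l').1 (codeword c l').2.2 :=
    Finset.sum_nonneg fun _ _ => decMetricC_nonneg _ _ _ _ _
  set D := ∑ l', decMetricC S L (obsC o) (codeword c l').1 (codeword c l').2.2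
  have hf0 : ∀ l', 0 ≤ decMetricC S L (obsC o) (codeword c l').1 (codeword c l').2.2 / D *
      (α * ok l') := fun l' =>
    mul_nonneg (div_nonneg (decMetricC_nonneg _ _ _ _ _) hS) (mul_nonneg hα (hok0 _))
  by_cases hgw : typicalWeight S L dC dR h x u o (codeword c l) = 0
  · rw [hgw, mul_zero, mul_zero]
    exact Finset.sum_nonneg fun l' _ => hf0 l'
  have hd := hok (typical_of_typicalWeight_ne_zero hgw).1.distC_le
  have h1 := card_mul_le_sum hf0 (i := l.1) (j := l.2.2)
    (a := decMetricC S L (obsC o) (codeword c l).1 (codeword c l).2.2 / D * α)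
    (fun k => by rw [hd k, mul_one]; rfl)
  rw [Fintype.card_fin] at h1
  refine le_trans ?_ h1
  calc _ ≤ α * (M₂ * decMetricC S L (obsC o) (codeword c l).1 (codeword c l).2.2 / D) :=
        mul_le_mul_of_nonneg_left (mul_le_of_le_one_right (div_nonneg (mul_nonneg
          (Nat.cast_nonneg _) (decMetricC_nonneg _ _ _ _ _)) hS)
          (typicalWeight_le_one S L dC dR h x u o _)) hα
    _ = _ := by ring

theorem typicalReward_r_le {α h : ℝ} (hα : 0 ≤ α)
    (c : Fin M₁ → (∀ j, (S j).Zc) × (Fin M₂ → (∀ j, (S j).Zr) × ∀ i, (L i).R) ×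
      (Fin Mt → ∀ i, (L i).T))
    (x : Fin n → X) (u : Fin m → U) (o : (Fin n → Yc × Yr) × (Fin m → Vc × Vr))
    (l : Fin M₁ × Fin M₂ × Fin Mt) {ok : Fin M₁ × Fin M₂ × Fin Mt → ℝ} (hok0 : ∀ l, 0 ≤ ok l)
    (hok : ∑ j, (dR (x j) ((S j).gr ((codeword c l).2.1.1 j, (o.1 j).2)) : ℝ) ≤
      sourceMean S dC dR 6 + h → ok l = 1) :
    α * (1 * decMetricR S L (obsR o) (codeword c l) /
      (∑ l', decMetricR S L (obsR o) (codeword c l')) *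
      typicalWeight S L dC dR h x u o (codeword c l)) ≤
    ∑ l', decMetricR S L (obsR o) (codeword c l') /
      (∑ l', decMetricR S L (obsR o) (codeword c l')) * (α * ok l') := by
  have hS : 0 ≤ ∑ l', decMetricR S L (obsR o) (codeword c l') :=
    Finset.sum_nonneg fun _ _ => decMetricR_nonneg _ _ _ _
  set D := ∑ l', decMetricR S L (obsR o) (codeword c l')
  have hf0 : ∀ l', 0 ≤ decMetricR S L (obsR o) (codeword c l') / D * (α * ok l') := fun l' =>
    mul_nonneg (div_nonneg (decMetricR_nonneg _ _ _ _) hS) (mul_nonneg hα (hok0 _))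
  by_cases hgw : typicalWeight S L dC dR h x u o (codeword c l) = 0
  · rw [hgw, mul_zero, mul_zero]
    exact Finset.sum_nonneg fun l' _ => hf0 l'
  have hd := hok (typical_of_typicalWeight_ne_zero hgw).1.distR_le
  refine le_trans ?_ (Finset.single_le_sum (fun l' _ => hf0 l') (Finset.mem_univ l))
  rw [hd, mul_one, one_mul, mul_comm]
  exact mul_le_mul_of_nonneg_right (mul_le_of_le_one_right (div_nonneg
    (decMetricR_nonneg _ _ _ _) hS) (typicalWeight_le_one S L dC dR h x u o _)) hα

open Classical in
/-- Existence of good block codes. The weights `αc` and `αr` select the receivers which have to be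
served. -/
theorem exists_code [Nonempty U] (hP : P ∈ stdSimplex ℝ (X × Yc × Yr)) (hW : IsChannel W)
    {h CS CL : ℝ} (hh : 1 ≤ h) (hCS : ∀ j q, ∑ s, (S j).prob s * (S j).stat dC dR q s ^ 2 ≤ CS)
    (hCL : ∀ i q, ∑ s, (L i).prob s * (L i).stat q s ^ 2 ≤ CL)
    (ha₁ : 0 ≤ sourceMean S dC dR 1) (ha₂ : sourceMean S dC dR 1 ≤ sourceMean S dC dR 0)
    (hg : 0 ≤ channelMean L 0) {αc αr : ℝ} (hαc : 0 ≤ αc) (hαr : 0 ≤ αr)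
    (hc : αc ≠ 0 → channelMean L 0 + 12 * h ≤ channelMean L 1 ∧
      sourceMean S dC dR 1 + channelMean L 0 + 12 * h ≤ sourceMean S dC dR 2 + channelMean L 1)
    (hr : αr ≠ 0 → channelMean L 0 + channelMean L 4 + 12 * h ≤ channelMean L 2 ∧
      sourceMean S dC dR 0 - sourceMean S dC dR 1 + sourceMean S dC dR 4 + channelMean L 3
        + 12 * h ≤ sourceMean S dC dR 3 + channelMean L 2 ∧
      sourceMean S dC dR 0 - sourceMean S dC dR 1 + sourceMean S dC dR 4 + channelMean L 0
        + 12 * h ≤ sourceMean S dC dR 3 + channelMean L 2 ∧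
      sourceMean S dC dR 0 + channelMean L 0 + 12 * h ≤
        sourceMean S dC dR 3 + channelMean L 2) :
    ∃ code : Code m n X Yc Yr U Vc Vr Xc Xr,
      (∀ v y, ∃ z : ∀ j, (S j).Zc, code.decC v y = fun j => (S j).gc (z j, y j)) ∧
      (∀ v y, ∃ z : ∀ j, (S j).Zr, code.decR v y = fun j => (S j).gr (z j, y j)) ∧
      (αc + αr) * (1 - 7 * (n * CS / h ^ 2) - 5 * (m * CL / h ^ 2) - 8 * 2 ^ (-h)) ≤
        αc * (∑ s : Fin n → X × Yc × Yr, ∑ v : Fin m → Vc × Vr, blockProb P W code.enc s v *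
          if ∑ j, (dC (s j).1 (code.decC (fun i => (v i).1) (fun j => (s j).2.1) j) : ℝ) ≤
            sourceMean S dC dR 5 + h then 1 else 0) +
        αr * (∑ s : Fin n → X × Yc × Yr, ∑ v : Fin m → Vc × Vr, blockProb P W code.enc s v *
          if ∑ j, (dR (s j).1 (code.decR (fun i => (v i).2) (fun j => (s j).2.2) j) : ℝ) ≤
            sourceMean S dC dR 6 + h then 1 else 0) := by
  -- `M₁` counts centres, `M₂` satellites per centre and `Mt` channel codewords per centre. Each
  -- size exceeds by the margin `2 * h` the exponent below which the encoder would find no fitting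
  -- word.
  obtain ⟨M₁, h₁, e₁, hM₁, he₁, he₁'⟩ := exists_nat_eq_two_rpow
    (show 0 ≤ sourceMean S dC dR 1 + 2 * h by linarith)
  obtain ⟨M₂, h₂, e₂, hM₂, he₂, he₂'⟩ := exists_nat_eq_two_rpow
    (show 0 ≤ sourceMean S dC dR 0 - sourceMean S dC dR 1 + 2 * h by linarith)
  obtain ⟨Mt, ht, et, hMt, het, het'⟩ := exists_nat_eq_two_rpow
    (show 0 ≤ channelMean L 0 + 2 * h by linarith)
  have : Nonempty (Fin M₁) := ⟨⟨0, h₁⟩⟩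
  have : Nonempty (Fin M₂) := ⟨⟨0, h₂⟩⟩
  have : Nonempty (Fin Mt) := ⟨⟨0, ht⟩⟩
  have hE : (0 : ℝ) < 2 ^ (-h) := Real.rpow_pos_of_pos (by norm_num) _
  have htyp := le_sum_typicalWeight (h := h) (L := L) (S := S) (dC := dC) (dR := dR) hP hW
    (by linarith) hCS hCL (e := 8 * 2 ^ (-h)) (by positivity)
  have e8 : (1 : ℝ) - 8 * 2 ^ (-h) = 1 - 4 * 2 ^ (-h) - 4 * 2 ^ (-h) := by ring
  rw [e8] at htyp
  let CB := Fin M₁ → (∀ j, (S j).Zc) × (Fin M₂ → (∀ j, (S j).Zr) × ∀ i, (L i).R) ×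
    (Fin Mt → ∀ i, (L i).T)
  obtain ⟨c, enc, decc, decr, hle⟩ := exists_deterministic_code
    (C := CB) (Λ := Fin M₁ × Fin M₂ × Fin Mt)
    (μ := fun c => ∏ i, clusterProb (wordPa S) (wordβ S L) (wordQ L) (c i))
    (fun c => Finset.prod_nonneg fun i _ => mul_nonneg (wordPa_nonneg S _) (mul_nonneg
      (Finset.prod_nonneg fun k _ => wordβ_nonneg S L _ _)
      (Finset.prod_nonneg fun k _ => wordQ_nonneg L _)))
    (sum_pi_prod_eq_one _ fun _ => sum_clusterProb (sum_wordPa S) (sum_wordβ S L) (sum_wordQ L))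
    obsC obsR
    (e := fun c x l u => encMetric S L x (codeword c l) /
        (∑ l', encMetric S L x (codeword c l')) * wordκ S L (codeword c l) u)
    (fun c x l u => mul_nonneg (div_nonneg (encMetric_nonneg _ _ _ _)
      (Finset.sum_nonneg fun _ _ => encMetric_nonneg _ _ _ _)) (wordκ_nonneg _ _ _ _))
    (fun c x => by
      simp only [← Finset.mul_sum]
      refine le_trans (Finset.sum_le_sum fun l _ => mul_le_of_le_one_right (div_nonneg
        (encMetric_nonneg _ _ _ _) (Finset.sum_nonneg fun _ _ => encMetric_nonneg _ _ _ _))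
        (sum_wordκ S L _)) (sum_div_sum_le_one _))
    (G := naturalProb P W) (naturalProb_nonneg hP.1 hW)
    (dc := fun c o l => decMetricC S L o (codeword c l).1 (codeword c l).2.2 /
      ∑ l', decMetricC S L o (codeword c l').1 (codeword c l').2.2)
    (fun c o l => div_nonneg (decMetricC_nonneg _ _ _ _ _)
      (Finset.sum_nonneg fun _ _ => decMetricC_nonneg _ _ _ _ _))
    (fun c o => sum_div_sum_le_one _)
    (dr := fun c o l => decMetricR S L o (codeword c l) / ∑ l', decMetricR S L o (codeword c l'))
    (fun c o l => div_nonneg (decMetricR_nonneg _ _ _ _)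
      (Finset.sum_nonneg fun _ _ => decMetricR_nonneg _ _ _ _))
    (fun c o => sum_div_sum_le_one _)
    (okc := fun c x o l => αc * if ∑ j, (dC (x j) ((S j).gc ((codeword c l).1 j, (o.1 j).1)) : ℝ) ≤
      sourceMean S dC dR 5 + h then 1 else 0)
    (okr := fun c x o l => αr * if ∑ j, (dR (x j) ((S j).gr ((codeword c l).2.1.1 j, (o.1 j).2)) : ℝ)
      ≤ sourceMean S dC dR 6 + h then 1 else 0)
    (fun c x o l => mul_nonneg hαc (by split_ifs <;> norm_num))
    (fun c x o l => mul_nonneg hαr (by split_ifs <;> norm_num))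
    (rc := fun c x u o l => αc * (M₂ * decMetricC S L (obsC o) (codeword c l).1 (codeword c l).2.2 /
          (∑ l', decMetricC S L (obsC o) (codeword c l').1 (codeword c l').2.2) *
          typicalWeight S L dC dR h x u o (codeword c l)))
    (rr := fun c x u o l => αr * (1 * decMetricR S L (obsR o) (codeword c l) /
          (∑ l', decMetricR S L (obsR o) (codeword c l')) *
          typicalWeight S L dC dR h x u o (codeword c l)))
    (fun c x u o l => typicalReward_c_le hαc c x u o l (fun l => by split_ifs <;> norm_num)
      fun hd k => if_pos hd)
    (fun c x u o l => typicalReward_r_le hαr c x u o l (fun l => by split_ifs <;> norm_num)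
      fun hd => if_pos hd)
  refine ⟨⟨enc, fun v y => fun j => (S j).gc ((codeword c (decc (y, v))).1 j, y j),
    fun v y => fun j => (S j).gr ((codeword c (decr (y, v))).2.1.1 j, y j)⟩,
    fun v y => ⟨_, rfl⟩, fun v y => ⟨_, rfl⟩, ?_⟩
  refine le_trans ?_ (hle.trans (le_of_eq ?_))
  · rw [sum_mul_const_mul, sum_mul_const_mul, add_mul]
    refine add_le_add ?_ ?_
    · by_cases h0 : αc = 0
      · simp [h0]
      obtain ⟨hc1, hc2⟩ := hc h0
      exact mul_le_mul_of_nonneg_left (htyp.trans (le_sum_coding_c hP hW h₁ h₂ ht hh hM₁ hM₂ hMt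
        he₁ he₁' he₂ het het' hg hc1 hc2)) hαc
    · by_cases h0 : αr = 0
      · simp [h0]
      obtain ⟨hr1, hr2, hr3, hr4⟩ := hr h0
      exact mul_le_mul_of_nonneg_left (htyp.trans (le_sum_coding_r hP hW h₁ h₂ ht hh hM₁ hM₂ hMt
        he₁ he₁' he₂ he₂' het het' hg hr1 hr2 hr3 hr4)) hαr
  · rw [sum_naturalProb_mul, sum_naturalProb_mul]
    simp only [Finset.mul_sum]
    congr 1 <;>
    refine Finset.sum_congr rfl fun s _ => Finset.sum_congr rfl fun v _ => by
      rw [mul_left_comm]; rfl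

end ExistsCode

/-! ### Gibbs' inequality -/

section Gibbs

variable {α : Type*} [Fintype α] {p q : α → ℝ}

/-- This is log z ≤ z - 1 at z = b/a, which is strict unless z = 1. The case a = 0 agrees with the
convention 0 log 0 = 0. -/
theorem sub_le_mul_log_div {a b : ℝ} (ha : 0 ≤ a) (hb : 0 ≤ b) (hab : 0 < a → 0 < b) :
    a - b ≤ a * Real.log (a / b) ∧ (a * Real.log (a / b) = a - b → a = b) := by
  rcases ha.eq_or_lt with rfl | ha
  · exact ⟨by simpa using hb, fun h => by simp at h; exact h.symm⟩
  have hb := hab ha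
  have hx : 0 < b / a := div_pos hb ha
  have e : Real.log (a / b) = -Real.log (b / a) := by rw [← Real.log_inv, inv_div]
  constructor
  · rw [e]
    have := mul_le_mul_of_nonneg_left (Real.log_le_sub_one_of_pos hx) ha.le
    have h2 : a * (b / a - 1) = b - a := by field_simp
    linarith
  · intro h
    by_contra hne
    have hne' : b / a ≠ 1 := by rw [Ne, div_eq_one_iff_eq ha.ne']; exact fun h => hne h.symm
    have := mul_lt_mul_of_pos_left (Real.log_lt_sub_one_of_pos hx hne') ha
    have h2 : a * (b / a - 1) = b - a := by field_simp
    rw [e] at h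
    linarith

/-- Gibbs' inequality, with the case of equality. -/
theorem gibbs (hp : ∀ a, 0 ≤ p a) (hq : ∀ a, 0 ≤ q a) (hpq : ∀ a, 0 < p a → 0 < q a)
    (hsum : ∑ a, q a ≤ ∑ a, p a) :
    0 ≤ ∑ a, p a * Real.logb 2 (p a / q a) ∧
      (∑ a, p a * Real.logb 2 (p a / q a) = 0 → ∀ a, p a = q a) := by
  have hlog2 : 0 < Real.log 2 := Real.log_pos (by norm_num)
  have e : ∑ a, p a * Real.logb 2 (p a / q a) =
      (∑ a, p a * Real.log (p a / q a)) / Real.log 2 := by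
    rw [Finset.sum_div]
    exact Finset.sum_congr rfl fun a _ => by rw [Real.logb, mul_div_assoc]
  have h1 : ∑ a, (p a - q a) ≤ ∑ a, p a * Real.log (p a / q a) :=
    Finset.sum_le_sum fun a _ => (sub_le_mul_log_div (hp a) (hq a) (hpq a)).1
  rw [Finset.sum_sub_distrib] at h1
  rw [e]
  refine ⟨div_nonneg (by linarith) hlog2.le, fun h0 a => ?_⟩
  have h0' : ∑ a, p a * Real.log (p a / q a) = 0 := by
    rcases div_eq_zero_iff.mp h0 with h | h
    · exact h
    · exact absurd h hlog2.ne'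
  have h2 : ∑ a, (p a * Real.log (p a / q a) - (p a - q a)) = 0 := by
    refine le_antisymm ?_ (Finset.sum_nonneg fun a _ => sub_nonneg.mpr
      (sub_le_mul_log_div (hp a) (hq a) (hpq a)).1)
    rw [Finset.sum_sub_distrib, Finset.sum_sub_distrib]
    linarith
  rw [Finset.sum_eq_zero_iff_of_nonneg fun a _ => sub_nonneg.mpr
      (sub_le_mul_log_div (hp a) (hq a) (hpq a)).1] at h2
  exact (sub_le_mul_log_div (hp a) (hq a) (hpq a)).2 (sub_eq_zero.mp (h2 a (Finset.mem_univ a)))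

end Gibbs

/-! ### Laws of random variables, mutual information and Markov chains -/

section Law

variable {Ω : Type*} [Fintype Ω] {A B C D : Type*} {p : Ω → ℝ}

theorem law_nonneg (hp : ∀ ω, 0 ≤ p ω) (f : Ω → A) (a : A) : 0 ≤ law p f a :=
  Finset.sum_nonneg fun ω _ => hp ω

theorem sum_law_mul [Fintype A] (p : Ω → ℝ) (f : Ω → A) (φ : A → ℝ) :
    ∑ a, law p f a * φ a = ∑ ω, p ω * φ (f ω) := by
  classical
  rw [← Finset.sum_fiberwise Finset.univ f]
  refine Finset.sum_congr rfl fun a _ => ?_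
  rw [law, Finset.sum_mul]
  refine Finset.sum_congr (by ext; simp) fun ω hω => ?_
  simp at hω
  rw [hω]

theorem sum_law [Fintype A] (p : Ω → ℝ) (f : Ω → A) : ∑ a, law p f a = ∑ ω, p ω := by
  simpa using sum_law_mul p f fun _ => 1

theorem law_pos (hp : ∀ ω, 0 ≤ p ω) (f : Ω → A) {ω : Ω} (hω : 0 < p ω) : 0 < law p f (f ω) :=
  hω.trans_le (Finset.single_le_sum (fun ω _ => hp ω) (by simp))

theorem law_le_law_comp (hp : ∀ ω, 0 ≤ p ω) (f : Ω → A) (φ : A → B) (a : A) :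
    law p f a ≤ law p (fun ω => φ (f ω)) (φ a) := by
  classical
  refine Finset.sum_le_sum_of_subset_of_nonneg (fun ω hω => ?_) fun ω _ _ => hp ω
  simp only [Finset.mem_filter, Finset.mem_univ, true_and] at hω ⊢
  rw [hω]

theorem law_comp_pos (hp : ∀ ω, 0 ≤ p ω) (f : Ω → A) (φ : A → B) {a : A} (ha : 0 < law p f a) :
    0 < law p (fun ω => φ (f ω)) (φ a) := ha.trans_le (law_le_law_comp hp f φ a)

theorem law_comp_injective (p : Ω → ℝ) (f : Ω → A) {φ : A → B} (hφ : Function.Injective φ)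
    (a : A) : law p (fun ω => φ (f ω)) (φ a) = law p f a :=
  Finset.sum_congr (by ext; simp [hφ.eq_iff]) fun _ _ => rfl

theorem sum_law_prodMk [Fintype B] (p : Ω → ℝ) (f : Ω → A) (g : Ω → B) (a : A) :
    ∑ b, law p (fun ω => (f ω, g ω)) (a, b) = law p f a := by
  classical
  simp only [law, Prod.mk.injEq]
  rw [← Finset.sum_fiberwise (Finset.univ.filter fun ω => f ω = a) g]
  refine Finset.sum_congr rfl fun b _ => Finset.sum_congr ?_ fun _ _ => rfl
  ext ω; simp

theorem law_swap (p : Ω → ℝ) (f : Ω → A) (g : Ω → B) (a : A) (b : B) :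
    law p (fun ω => (g ω, f ω)) (b, a) = law p (fun ω => (f ω, g ω)) (a, b) :=
  law_comp_injective p (fun ω => (f ω, g ω)) (φ := Prod.swap) Prod.swap_injective (a, b)

theorem sum_law_prodMk_left [Fintype A] (p : Ω → ℝ) (f : Ω → A) (g : Ω → B) (b : B) :
    ∑ a, law p (fun ω => (f ω, g ω)) (a, b) = law p g b := by
  rw [← sum_law_prodMk p g f b]
  exact Finset.sum_congr rfl fun a _ => law_swap p g f b a

theorem mutualInfo_eq_sum [Fintype A] [Fintype B] (p : Ω → ℝ) (f : Ω → A) (g : Ω → B) :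
    mutualInfo p f g = ∑ ω, p ω * Real.logb 2
      (law p (fun ω => (f ω, g ω)) (f ω, g ω) / (law p f (f ω) * law p g (g ω))) := by
  rw [← sum_law_mul p (fun ω => (f ω, g ω)) (fun s => Real.logb 2
      (law p (fun ω => (f ω, g ω)) s / (law p f s.1 * law p g s.2))), Fintype.sum_prod_type]
  rfl

theorem condMutualInfo_eq_sum [Fintype A] [Fintype B] [Fintype C] (p : Ω → ℝ) (f : Ω → A)
    (g : Ω → B) (h : Ω → C) :
    condMutualInfo p f g h = ∑ ω, p ω * Real.logb 2
      ((law p (fun ω => (f ω, g ω, h ω)) (f ω, g ω, h ω) * law p h (h ω)) /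
      (law p (fun ω => (f ω, h ω)) (f ω, h ω) * law p (fun ω => (g ω, h ω)) (g ω, h ω))) := by
  rw [← sum_law_mul p (fun ω => (f ω, g ω, h ω)) (fun s => Real.logb 2
      ((law p (fun ω => (f ω, g ω, h ω)) s * law p h s.2.2) /
      (law p (fun ω => (f ω, h ω)) (s.1, s.2.2) * law p (fun ω => (g ω, h ω)) s.2))),
      Fintype.sum_prod_type]
  simp only [Fintype.sum_prod_type]
  rfl

theorem sum_mul_logb_congr {u v : Ω → ℝ} (hp : ∀ ω, 0 ≤ p ω) (h : ∀ ω, 0 < p ω → u ω = v ω) :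
    ∑ ω, p ω * u ω = ∑ ω, p ω * v ω := by
  refine Finset.sum_congr rfl fun ω _ => ?_
  rcases (hp ω).eq_or_lt with h0 | h0
  · simp [← h0]
  · rw [h ω h0]

/-- Gibbs' inequality for the joint law against the product of the marginals. The equality case is
what detects channels that are useless to a receiver. -/
theorem mutualInfo_nonneg_and [Fintype A] [Fintype B] (hp : ∀ ω, 0 ≤ p ω) (hp1 : ∑ ω, p ω = 1)
    (f : Ω → A) (g : Ω → B) : 0 ≤ mutualInfo p f g ∧ (mutualInfo p f g = 0 → ∀ a b,
      law p (fun ω => (f ω, g ω)) (a, b) = law p f a * law p g b) := by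
  have h := gibbs (p := law p (fun ω => (f ω, g ω))) (q := fun s => law p f s.1 * law p g s.2)
    (law_nonneg hp _) (fun s => mul_nonneg (law_nonneg hp _ _) (law_nonneg hp _ _))
    (fun s hs => mul_pos (law_comp_pos hp _ Prod.fst hs) (law_comp_pos hp _ Prod.snd hs))
    (by rw [sum_law, Fintype.sum_prod_type, ← Finset.sum_mul_sum, sum_law, sum_law, hp1, one_mul])
  have e : mutualInfo p f g = ∑ s : A × B, law p (fun ω => (f ω, g ω)) s *
      Real.logb 2 (law p (fun ω => (f ω, g ω)) s / (law p f s.1 * law p g s.2)) := by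
    rw [Fintype.sum_prod_type]; rfl
  rw [e]
  exact ⟨h.1, fun h0 a b => h.2 h0 (a, b)⟩

/-- Gibbs' inequality for the joint law against p(a,c) p(b,c) / p(c), whose total mass does not
exceed that of the joint law. -/
theorem condMutualInfo_nonneg_and [Fintype A] [Fintype B] [Fintype C] (hp : ∀ ω, 0 ≤ p ω)
    (f : Ω → A) (g : Ω → B) (h : Ω → C) :
    0 ≤ condMutualInfo p f g h ∧ (condMutualInfo p f g h = 0 → ∀ a b c,
      law p (fun ω => (f ω, g ω, h ω)) (a, b, c) * law p h c =
        law p (fun ω => (f ω, h ω)) (a, c) * law p (fun ω => (g ω, h ω)) (b, c)) := by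
  have hpos : ∀ s : A × B × C, 0 < law p (fun ω => (f ω, g ω, h ω)) s → 0 < law p h s.2.2 :=
    fun s hs => law_comp_pos hp _ (fun s : A × B × C => s.2.2) hs
  have hg := gibbs (p := law p (fun ω => (f ω, g ω, h ω)))
    (q := fun s => law p (fun ω => (f ω, h ω)) (s.1, s.2.2) * law p (fun ω => (g ω, h ω)) s.2 /
      law p h s.2.2)
    (law_nonneg hp _) (fun s => div_nonneg (mul_nonneg (law_nonneg hp _ _) (law_nonneg hp _ _))
      (law_nonneg hp _ _))
    (fun s hs => div_pos (mul_pos (law_comp_pos hp _ (fun s : A × B × C => (s.1, s.2.2)) hs)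
      (law_comp_pos hp _ (fun s : A × B × C => s.2) hs)) (hpos s hs))
    (by
      rw [sum_law, ← sum_law p h]
      calc _ = ∑ a, ∑ b, ∑ c, law p (fun ω => (f ω, h ω)) (a, c) *
            law p (fun ω => (g ω, h ω)) (b, c) / law p h c := by
            simp only [Fintype.sum_prod_type]
        _ = ∑ c, ∑ a, ∑ b, law p (fun ω => (f ω, h ω)) (a, c) *
            law p (fun ω => (g ω, h ω)) (b, c) / law p h c := by
            rw [Finset.sum_congr rfl fun a _ => Finset.sum_comm, Finset.sum_comm]
        _ ≤ ∑ c, law p h c := by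
            refine Finset.sum_le_sum fun c _ => ?_
            simp only [← Finset.sum_div, ← Finset.sum_mul_sum]
            rw [sum_law_prodMk_left, sum_law_prodMk_left]
            exact (mul_self_div_self _).le)
  have e : condMutualInfo p f g h = ∑ s : A × B × C, law p (fun ω => (f ω, g ω, h ω)) s *
      Real.logb 2 (law p (fun ω => (f ω, g ω, h ω)) s / (law p (fun ω => (f ω, h ω)) (s.1, s.2.2) *
        law p (fun ω => (g ω, h ω)) s.2 / law p h s.2.2)) := by
    simp only [Fintype.sum_prod_type, div_div_eq_mul_div]; rfl
  rw [e]
  refine ⟨hg.1, fun h0 a b c => ?_⟩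
  have h1 := hg.2 h0 (a, b, c)
  simp only at h1
  rcases (law_nonneg hp h c).eq_or_lt with hc | hc
  · have h3 : law p (fun ω => (f ω, h ω)) (a, c) = 0 := le_antisymm
      ((law_le_law_comp hp (fun ω => (f ω, h ω)) Prod.snd (a, c)).trans hc.symm.le)
      (law_nonneg hp _ _)
    rw [← hc, h3]; simp
  · rw [h1]; field_simp

/-- Chain rule for mutual information. -/
theorem mutualInfo_prodMk [Fintype A] [Fintype B] [Fintype C] (hp : ∀ ω, 0 ≤ p ω) (f : Ω → A)
    (g : Ω → B) (h : Ω → C) :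
    mutualInfo p f (fun ω => (g ω, h ω)) = mutualInfo p f h + condMutualInfo p f g h := by
  rw [mutualInfo_eq_sum, mutualInfo_eq_sum, condMutualInfo_eq_sum, ← Finset.sum_add_distrib]
  simp only [← mul_add]
  refine sum_mul_logb_congr hp fun ω hω => ?_
  have h1 := law_pos hp (fun ω => (f ω, g ω, h ω)) hω
  have h2 := law_pos hp (fun ω => (f ω, h ω)) hω
  have h3 := law_pos hp (fun ω => (g ω, h ω)) hω
  have h4 := law_pos hp f hω
  have h5 := law_pos hp h hω
  rw [← Real.logb_mul (by positivity) (by positivity)]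
  congr 1
  field_simp

/-- Conditional mutual information for a Markov chain `h - f - g`. -/
theorem IsMarkov.condMutualInfo_eq [Fintype A] [Fintype B] [Fintype C] (hp : ∀ ω, 0 ≤ p ω)
    {f : Ω → A} {g : Ω → B} {h : Ω → C} (hm : IsMarkov p h f g) :
    condMutualInfo p f g h = mutualInfo p f g - mutualInfo p h g := by
  rw [mutualInfo_eq_sum, mutualInfo_eq_sum, condMutualInfo_eq_sum, ← Finset.sum_sub_distrib]
  simp only [← mul_sub]
  refine sum_mul_logb_congr hp fun ω hω => ?_
  have e := hm (h ω) (f ω) (g ω)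
  have h1 := law_pos hp (fun ω => (f ω, g ω, h ω)) hω
  have h2 := law_pos hp (fun ω => (f ω, h ω)) hω
  have h3 := law_pos hp (fun ω => (g ω, h ω)) hω
  have h4 := law_pos hp f hω
  have h5 := law_pos hp h hω
  have h6 := law_pos hp g hω
  have h7 := law_pos hp (fun ω => (f ω, g ω)) hω
  have h8 : law p (fun ω => (h ω, f ω, g ω)) (h ω, f ω, g ω) =
      law p (fun ω => (f ω, g ω, h ω)) (f ω, g ω, h ω) :=
    law_comp_injective p (fun ω => (f ω, g ω, h ω)) (φ := fun s : A × B × C => (s.2.2, s.1, s.2.1))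
      (fun a b h => by simp only [Prod.mk.injEq] at h; exact Prod.ext h.2.1 (Prod.ext h.2.2 h.1))
      (f ω, g ω, h ω)
  rw [h8, law_swap p f h] at e
  rw [law_swap p g h, ← Real.logb_div (by positivity) (by positivity)]
  congr 1
  field_simp
  linear_combination e

open Classical in
theorem law_prodMk_comp [Fintype C] (p : Ω → ℝ) (k : Ω → A) (h : Ω → C) (φ : C → D) (a : A)
    (d : D) : law p (fun ω => (k ω, φ (h ω))) (a, d) =
      ∑ c with φ c = d, law p (fun ω => (k ω, h ω)) (a, c) := by
  simp only [law, Prod.mk.injEq]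
  rw [← Finset.sum_fiberwise (Finset.univ.filter fun ω => k ω = a ∧ φ (h ω) = d) h,
    Finset.sum_filter]
  refine Finset.sum_congr rfl fun c _ => ?_
  split_ifs with hc
  · refine Finset.sum_congr ?_ fun _ _ => rfl
    ext ω
    simp only [Finset.mem_filter, Finset.mem_univ, true_and]
    constructor
    · rintro ⟨⟨h1, -⟩, h3⟩; exact ⟨h1, h3⟩
    · rintro ⟨h1, h3⟩; exact ⟨⟨h1, by rw [h3, hc]⟩, h3⟩
  · refine Finset.sum_eq_zero fun ω hω => ?_
    simp only [Finset.mem_filter, Finset.mem_univ, true_and] at hω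
    exact absurd (hω.2 ▸ hω.1.2) hc

theorem law_assoc (p : Ω → ℝ) (f : Ω → A) (g : Ω → B) (h : Ω → C) (a : A) (b : B) (c : C) :
    law p (fun ω => ((f ω, g ω), h ω)) ((a, b), c) =
      law p (fun ω => (f ω, g ω, h ω)) (a, b, c) :=
  law_comp_injective p (fun ω => (f ω, g ω, h ω)) (φ := fun s => ((s.1, s.2.1), s.2.2))
    (fun s t h => by
      simp only [Prod.mk.injEq] at h; exact Prod.ext h.1.1 (Prod.ext h.1.2 h.2)) (a, b, c)

/-- A Markov chain remains one if its last variable is replaced by a function of it. -/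
theorem IsMarkov.comp_right [Fintype C] {f : Ω → A} {g : Ω → B} {h : Ω → C}
    (hm : IsMarkov p f g h) (φ : C → D) : IsMarkov p f g (fun ω => φ (h ω)) := by
  classical
  intro a b d
  have e1 := law_prodMk_comp p (fun ω => (f ω, g ω)) h φ (a, b) d
  rw [law_assoc p f g (fun ω => φ (h ω))] at e1
  rw [e1, law_prodMk_comp p g h φ b d, Finset.sum_mul, Finset.mul_sum]
  refine Finset.sum_congr rfl fun c _ => ?_
  rw [law_assoc]
  exact hm a b c

/-- A Markov chain can be read backwards. -/
theorem IsMarkov.symm {f : Ω → A} {g : Ω → B} {h : Ω → C} (hm : IsMarkov p f g h) :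
    IsMarkov p h g f := by
  intro c b a
  have e := hm a b c
  have h1 : law p (fun ω => (h ω, g ω, f ω)) (c, b, a) = law p (fun ω => (f ω, g ω, h ω)) (a, b, c) :=
    law_comp_injective p (fun ω => (f ω, g ω, h ω)) (φ := fun s => (s.2.2, s.2.1, s.1))
      (fun s t h => by
        simp only [Prod.mk.injEq] at h; exact Prod.ext h.2.2 (Prod.ext h.2.1 h.1)) (a, b, c)
  rw [h1, e, law_swap p g h, law_swap p f g, mul_comm]

end Law

/-! ### Information identities and means of likelihood ratios -/

section InformationIdentities

variable {Ω : Type*} [Fintype Ω] {A B C D E : Type*} {p : Ω → ℝ}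

theorem mutualInfo_comp_injective [Fintype A] [Fintype B] [Fintype C] (p : Ω → ℝ) (f : Ω → A)
    (g : Ω → B) {φ : B → C} (hφ : Function.Injective φ) :
    mutualInfo p f (fun ω => φ (g ω)) = mutualInfo p f g := by
  rw [mutualInfo_eq_sum, mutualInfo_eq_sum]
  refine Finset.sum_congr rfl fun ω _ => ?_
  rw [law_comp_injective p g hφ, ← law_comp_injective p (fun ω => (f ω, g ω))
    (φ := fun s : A × B => (s.1, φ s.2)) (fun s t h => by
      simp only [Prod.mk.injEq] at h; exact Prod.ext h.1 (hφ h.2))]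

/-- Chain rule for conditional mutual information. -/
theorem condMutualInfo_prodMk [Fintype A] [Fintype B] [Fintype C] [Fintype D] (hp : ∀ ω, 0 ≤ p ω)
    (f : Ω → A) (g : Ω → B) (h : Ω → C) (k : Ω → D) :
    condMutualInfo p f (fun ω => (g ω, h ω)) k =
      condMutualInfo p f h k + condMutualInfo p f g (fun ω => (h ω, k ω)) := by
  have h1 := mutualInfo_prodMk hp f (fun ω => (g ω, h ω)) k
  have h2 := mutualInfo_prodMk hp f g (fun ω => (h ω, k ω))
  have h3 := mutualInfo_prodMk hp f h k
  have h4 := mutualInfo_comp_injective p f (fun ω => ((g ω, h ω), k ω))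
    (φ := fun s => (s.1.1, s.1.2, s.2)) (fun s t h => by
      simp only [Prod.mk.injEq] at h; exact Prod.ext (Prod.ext h.1 h.2.1) h.2.2)
  linarith

/-- The identity is checked after multiplication by the probability of `h`, where it is a
combination of three factorizations. If that probability is zero, both sides vanish. -/
theorem IsMarkov₄.isMarkov_prodMk (hp : ∀ ω, 0 ≤ p ω) [Fintype A] [Fintype B] {f : Ω → A}
    {g : Ω → B} {h : Ω → C} {k : Ω → D} (hm : IsMarkov₄ p f g h k) :
    IsMarkov p f g (fun ω => (h ω, k ω)) := by
  obtain ⟨h1, h2⟩ := hm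
  have h3 : IsMarkov p g h k := (h2.symm.comp_right Prod.snd).symm
  rintro a b ⟨c, d⟩
  have e1 := h1 a b c
  have e2 := h2 (a, b) c d
  have e3 := h3 b c d
  rw [law_assoc p f g (fun ω => (h ω, k ω)), law_assoc p f g h] at e2
  rcases (law_nonneg hp h c).eq_or_lt with h0 | h0
  · have z1 : law p (fun ω => (f ω, g ω, h ω, k ω)) (a, b, c, d) = 0 := le_antisymm
      ((law_le_law_comp hp _ (fun s : A × B × C × D => s.2.2.1) (a, b, c, d)).trans h0.symm.le)
      (law_nonneg hp _ _)
    have z2 : law p (fun ω => (g ω, h ω, k ω)) (b, c, d) = 0 := le_antisymm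
      ((law_le_law_comp hp _ (fun s : B × C × D => s.2.1) (b, c, d)).trans h0.symm.le)
      (law_nonneg hp _ _)
    rw [z1, z2]; simp
  · refine mul_right_cancel₀ h0.ne' ?_
    linear_combination law p g b * e2 + law p (fun ω => (h ω, k ω)) (c, d) * e1 -
      law p (fun ω => (f ω, g ω)) (a, b) * e3

/-- A likelihood ratio averaged over an independent copy is 1, or 0 at values `e` of probability
zero. This is why an unrelated codeword adds at most one on average to a normalizer. -/
theorem sum_law_mul_ratio_le_one [Fintype A] (hp : ∀ ω, 0 ≤ p ω) (f : Ω → A) (k : Ω → E) (e : E) :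
    ∑ a, law p f a * (law p (fun ω => (k ω, f ω)) (e, a) / (law p k e * law p f a)) ≤ 1 := by
  calc _ ≤ ∑ a, law p (fun ω => (k ω, f ω)) (e, a) / law p k e := by
        refine Finset.sum_le_sum fun a _ => ?_
        rcases (law_nonneg hp f a).eq_or_lt with h0 | h0
        · rw [← h0, zero_mul]
          exact div_nonneg (law_nonneg hp _ _) (law_nonneg hp _ _)
        · refine le_of_eq ?_
          rw [mul_comm (law p k e), ← mul_div_assoc, mul_div_mul_left _ _ h0.ne']
    _ ≤ 1 := by
        rw [← Finset.sum_div, sum_law_prodMk]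
        exact div_self_le_one _

section SourceLetterOfLaw

variable {Zc Zr : Type*}

/-- The conditional law of `zr` given `zc`, made total by the marginal law. -/
def condLaw (p : Ω → ℝ) (zc : Ω → Zc) (zr : Ω → Zr) (a : Zc) (b : Zr) : ℝ :=
  if law p zc a = 0 then law p zr b else law p (fun ω => (zr ω, zc ω)) (b, a) / law p zc a

theorem condLaw_nonneg (hp : ∀ ω, 0 ≤ p ω) (zc : Ω → Zc) (zr : Ω → Zr) (a : Zc) (b : Zr) :
    0 ≤ condLaw p zc zr a b := by
  unfold condLaw
  split_ifs
  · exact law_nonneg hp _ _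
  · exact div_nonneg (law_nonneg hp _ _) (law_nonneg hp _ _)

theorem sum_condLaw [Fintype Zr] (hp1 : ∑ ω, p ω = 1) (zc : Ω → Zc) (zr : Ω → Zr) (a : Zc) :
    ∑ b, condLaw p zc zr a b = 1 := by
  unfold condLaw
  split_ifs with h
  · rw [sum_law, hp1]
  · rw [← Finset.sum_div, sum_law_prodMk_left, div_self h]

theorem law_mul_condLaw (hp : ∀ ω, 0 ≤ p ω) (zc : Ω → Zc) (zr : Ω → Zr) (a : Zc) (b : Zr) :
    law p zc a * condLaw p zc zr a b = law p (fun ω => (zr ω, zc ω)) (b, a) := by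
  unfold condLaw
  split_ifs with h
  · rw [h, zero_mul]
    exact le_antisymm (law_nonneg hp _ _)
      ((law_le_law_comp hp (fun ω => (zr ω, zc ω)) Prod.snd (b, a)).trans h.le)
  · field_simp

/-- Averaging the ratio for the pair over a fresh satellite with the given centre leaves the ratio
for the centre alone. -/
theorem sum_condLaw_mul_ratio_le [Fintype Zr] (hp : ∀ ω, 0 ≤ p ω) (zc : Ω → Zc) (zr : Ω → Zr) (k : Ω → E) (e : E)
    (a : Zc) :
    ∑ b, condLaw p zc zr a b * (law p (fun ω => (k ω, zr ω, zc ω)) (e, b, a) /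
      (law p k e * law p (fun ω => (zr ω, zc ω)) (b, a))) ≤
      law p (fun ω => (k ω, zc ω)) (e, a) / (law p k e * law p zc a) := by
  have hm : ∑ b, law p (fun ω => (k ω, zr ω, zc ω)) (e, b, a) =
      law p (fun ω => (k ω, zc ω)) (e, a) := by
    rw [← sum_law_prodMk_left p zr (fun ω => (k ω, zc ω)) (e, a)]
    refine Finset.sum_congr rfl fun b _ => ?_
    exact law_comp_injective p (fun ω => (zr ω, k ω, zc ω)) (φ := fun s => (s.2.1, s.1, s.2.2))
      (fun s t h => by
        simp only [Prod.mk.injEq] at h; exact Prod.ext h.2.1 (Prod.ext h.1 h.2.2)) (b, e, a)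
  rw [← hm, Finset.sum_div]
  refine Finset.sum_le_sum fun b _ => ?_
  rcases (law_nonneg hp (fun ω => (zr ω, zc ω)) (b, a)).eq_or_lt with h0 | h0
  · rw [← h0, mul_zero, div_zero, mul_zero]
    exact div_nonneg (law_nonneg hp _ _) (mul_nonneg (law_nonneg hp _ _) (law_nonneg hp _ _))
  · have h1 : 0 < law p zc a := law_comp_pos hp _ Prod.snd h0
    rw [← law_mul_condLaw hp zc zr a b] at h0 ⊢
    have h2 : 0 < condLaw p zc zr a b := pos_of_mul_pos_right h0 h1.le
    rcases (law_nonneg hp k e).eq_or_lt with h3 | h3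
    · simp [← h3]
    · refine le_of_eq ?_
      field_simp

end SourceLetterOfLaw

end InformationIdentities

/-! ### Source letters obtained from auxiliary random variables -/

section SourceLetter

variable {X Yc Yr Xc Xr : Type*} [Fintype X] [Fintype Yc] [Fintype Yr] {Ω Zc Zr : Type} [Fintype Ω]
  {P : X × Yc × Yr → ℝ} {p : Ω → ℝ} {x : Ω → X} {yc : Ω → Yc}
  {yr : Ω → Yr} {zc : Ω → Zc} {zr : Ω → Zr}

/-- The factor after `P` is p(zc, zr) p(x, zr, zc) / (p(x) p(zr, zc)), which is p(zc, zr | x) where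
p(x) > 0. The Markov chain makes its product with p(x, yc, yr) the joint law: the encoding metric
turns independently drawn codewords into correctly correlated ones. -/
theorem law_mul_condLaw_mul_ratio (hp : ∀ ω, 0 ≤ p ω)
    (hP : law p (fun ω => (x ω, yc ω, yr ω)) = P)
    (hm : IsMarkov₄ p (fun ω => (yc ω, yr ω)) x zr zc) (s : (X × Yc × Yr) × Zc × Zr) :
    P s.1 * (law p zc s.2.1 * condLaw p zc zr s.2.1 s.2.2 *
      (law p (fun ω => (x ω, zr ω, zc ω)) (s.1.1, s.2.2, s.2.1) /
        (law p x s.1.1 * law p (fun ω => (zr ω, zc ω)) (s.2.2, s.2.1)))) =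
      law p (fun ω => ((x ω, yc ω, yr ω), zc ω, zr ω)) s := by
  obtain ⟨⟨x₀, yc₀, yr₀⟩, a, b⟩ := s
  have e := hm.isMarkov_prodMk hp (yc₀, yr₀) x₀ (b, a)
  have h1 : law p (fun ω => ((yc ω, yr ω), x ω, zr ω, zc ω)) ((yc₀, yr₀), x₀, b, a) =
      law p (fun ω => ((x ω, yc ω, yr ω), zc ω, zr ω)) ((x₀, yc₀, yr₀), a, b) :=
    law_comp_injective p (fun ω => ((x ω, yc ω, yr ω), zc ω, zr ω))
      (φ := fun s => (s.1.2, s.1.1, s.2.2, s.2.1)) (fun s t h => by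
        simp only [Prod.mk.injEq] at h
        exact Prod.ext (Prod.ext h.2.1 h.1) (Prod.ext h.2.2.2 h.2.2.1)) ((x₀, yc₀, yr₀), a, b)
  have h2 : law p (fun ω => ((yc ω, yr ω), x ω)) ((yc₀, yr₀), x₀) = P (x₀, yc₀, yr₀) := by
    rw [← hP, law_swap p x (fun ω => (yc ω, yr ω))]
  rw [h1, h2] at e
  rw [law_mul_condLaw hp]
  simp only
  rcases (law_nonneg hp x x₀).eq_or_lt with h0 | h0
  · rw [← h0, zero_mul, div_zero, mul_zero, mul_zero]
    exact le_antisymm (law_nonneg hp _ _) ((law_le_law_comp hp _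
      (fun s : (X × Yc × Yr) × Zc × Zr => s.1.1) ((x₀, yc₀, yr₀), a, b)).trans h0.symm.le)
  rcases (law_nonneg hp (fun ω => (zr ω, zc ω)) (b, a)).eq_or_lt with h3 | h3
  · rw [← h3, zero_mul, mul_zero]
    exact le_antisymm (law_nonneg hp _ _) ((law_le_law_comp hp _
      (fun s : (X × Yc × Yr) × Zc × Zr => (s.2.2, s.2.1)) ((x₀, yc₀, yr₀), a, b)).trans h3.symm.le)
  · rw [← mul_left_inj' h0.ne', e]
    field_simp

variable [Fintype Zc] [Fintype Zr]

/-- The source letter of given auxiliary random variables. -/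
def SourceLetter.ofLaw (hp : p ∈ stdSimplex ℝ Ω) (hP : law p (fun ω => (x ω, yc ω, yr ω)) = P)
    (hm : IsMarkov₄ p (fun ω => (yc ω, yr ω)) x zr zc) (gc : Zc × Yc → Xc) (gr : Zr × Yr → Xr) :
    SourceLetter P Xc Xr where
  Zc := Zc
  Zr := Zr
  pa := law p zc
  β := condLaw p zc zr
  ρ x₀ a b := law p (fun ω => (x ω, zr ω, zc ω)) (x₀, b, a) /
    (law p x x₀ * law p (fun ω => (zr ω, zc ω)) (b, a))
  ρ₁ x₀ a := law p (fun ω => (x ω, zc ω)) (x₀, a) / (law p x x₀ * law p zc a)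
  σc y a := law p (fun ω => (yc ω, zc ω)) (y, a) / (law p yc y * law p zc a)
  σr y a b := law p (fun ω => (yr ω, zr ω, zc ω)) (y, b, a) /
    (law p yr y * law p (fun ω => (zr ω, zc ω)) (b, a))
  σ₁ y a := law p (fun ω => (yr ω, zc ω)) (y, a) / (law p yr y * law p zc a)
  gc := gc
  gr := gr
  pa_nonneg _ := law_nonneg hp.1 _ _
  β_nonneg _ _ := condLaw_nonneg hp.1 _ _ _ _
  ρ_nonneg _ _ _ := div_nonneg (law_nonneg hp.1 _ _)
    (mul_nonneg (law_nonneg hp.1 _ _) (law_nonneg hp.1 _ _))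
  ρ₁_nonneg _ _ := div_nonneg (law_nonneg hp.1 _ _)
    (mul_nonneg (law_nonneg hp.1 _ _) (law_nonneg hp.1 _ _))
  σc_nonneg _ _ := div_nonneg (law_nonneg hp.1 _ _)
    (mul_nonneg (law_nonneg hp.1 _ _) (law_nonneg hp.1 _ _))
  σr_nonneg _ _ _ := div_nonneg (law_nonneg hp.1 _ _)
    (mul_nonneg (law_nonneg hp.1 _ _) (law_nonneg hp.1 _ _))
  σ₁_nonneg _ _ := div_nonneg (law_nonneg hp.1 _ _)
    (mul_nonneg (law_nonneg hp.1 _ _) (law_nonneg hp.1 _ _))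
  sum_pa := by rw [sum_law, hp.2]
  sum_β := sum_condLaw hp.2 _ _
  sum_ρ := sum_condLaw_mul_ratio_le hp.1 zc zr x
  sum_ρ₁ := sum_law_mul_ratio_le_one hp.1 zc x
  sum_σc := sum_law_mul_ratio_le_one hp.1 zc yc
  sum_σr := sum_condLaw_mul_ratio_le hp.1 zc zr yr
  sum_σ₁ := sum_law_mul_ratio_le_one hp.1 zc yr
  sum_prob := by
    rw [Finset.sum_congr rfl fun s _ => law_mul_condLaw_mul_ratio hp.1 hP hm s, sum_law, hp.2]
  pos s hs := by
    rw [law_mul_condLaw_mul_ratio hp.1 hP hm s] at hs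
    have h1 := law_comp_pos hp.1 _ (fun s : (X × Yc × Yr) × Zc × Zr => s.1.1) hs
    have h2 := law_comp_pos hp.1 _ (fun s : (X × Yc × Yr) × Zc × Zr => s.2.1) hs
    have h3 := law_comp_pos hp.1 _ (fun s : (X × Yc × Yr) × Zc × Zr => s.1.2.1) hs
    have h4 := law_comp_pos hp.1 _ (fun s : (X × Yc × Yr) × Zc × Zr => s.1.2.2) hs
    have h5 := law_comp_pos hp.1 _ (fun s : (X × Yc × Yr) × Zc × Zr => (s.2.2, s.2.1)) hs
    have h6 := law_comp_pos hp.1 _ (fun s : (X × Yc × Yr) × Zc × Zr => (s.1.1, s.2.2, s.2.1)) hs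
    have h7 := law_comp_pos hp.1 _ (fun s : (X × Yc × Yr) × Zc × Zr => (s.1.1, s.2.1)) hs
    have h8 := law_comp_pos hp.1 _ (fun s : (X × Yc × Yr) × Zc × Zr => (s.1.2.1, s.2.1)) hs
    have h9 := law_comp_pos hp.1 _ (fun s : (X × Yc × Yr) × Zc × Zr => (s.1.2.2, s.2.2, s.2.1)) hs
    have h0 := law_comp_pos hp.1 _ (fun s : (X × Yc × Yr) × Zc × Zr => (s.1.2.2, s.2.1)) hs
    exact ⟨div_pos h6 (mul_pos h1 h5), div_pos h7 (mul_pos h1 h2), div_pos h8 (mul_pos h3 h2),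
      div_pos h9 (mul_pos h4 h5), div_pos h0 (mul_pos h4 h2)⟩

section Means

variable (hp : p ∈ stdSimplex ℝ Ω) (hP : law p (fun ω => (x ω, yc ω, yr ω)) = P)
  (hm : IsMarkov₄ p (fun ω => (yc ω, yr ω)) x zr zc) (gc : Zc × Yc → Xc) (gr : Zr × Yr → Xr)
  (dC : X → Xc → ℝ≥0) (dR : X → Xr → ℝ≥0)

theorem SourceLetter.sum_prob_ofLaw_mul (φ : (X × Yc × Yr) × Zc × Zr → ℝ) :
    ∑ s, (SourceLetter.ofLaw hp hP hm gc gr).prob s * φ s =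
      ∑ ω, p ω * φ ((x ω, yc ω, yr ω), zc ω, zr ω) := by
  rw [← sum_law_mul p (fun ω => ((x ω, yc ω, yr ω), zc ω, zr ω)) φ]
  exact Finset.sum_congr rfl fun s _ =>
    congrArg (· * φ s) (law_mul_condLaw_mul_ratio hp.1 hP hm s)

theorem SourceLetter.mean_ofLaw_zero :
    (SourceLetter.ofLaw hp hP hm gc gr).mean dC dR 0 =
      mutualInfo p x (fun ω => (zr ω, zc ω)) := by
  rw [mutualInfo_eq_sum]
  exact SourceLetter.sum_prob_ofLaw_mul hp hP hm gc gr _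

theorem SourceLetter.mean_ofLaw_one :
    (SourceLetter.ofLaw hp hP hm gc gr).mean dC dR 1 = mutualInfo p x zc := by
  rw [mutualInfo_eq_sum]
  exact SourceLetter.sum_prob_ofLaw_mul hp hP hm gc gr _

theorem SourceLetter.mean_ofLaw_two :
    (SourceLetter.ofLaw hp hP hm gc gr).mean dC dR 2 = mutualInfo p yc zc := by
  rw [mutualInfo_eq_sum]
  exact SourceLetter.sum_prob_ofLaw_mul hp hP hm gc gr _

theorem SourceLetter.mean_ofLaw_three :
    (SourceLetter.ofLaw hp hP hm gc gr).mean dC dR 3 =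
      mutualInfo p yr (fun ω => (zr ω, zc ω)) := by
  rw [mutualInfo_eq_sum]
  exact SourceLetter.sum_prob_ofLaw_mul hp hP hm gc gr _

theorem SourceLetter.mean_ofLaw_four :
    (SourceLetter.ofLaw hp hP hm gc gr).mean dC dR 4 = mutualInfo p yr zc := by
  rw [mutualInfo_eq_sum]
  exact SourceLetter.sum_prob_ofLaw_mul hp hP hm gc gr _

theorem SourceLetter.mean_ofLaw_five :
    (SourceLetter.ofLaw hp hP hm gc gr).mean dC dR 5 =
      ∑ ω, p ω * (dC (x ω) (gc (zc ω, yc ω)) : ℝ) :=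
  SourceLetter.sum_prob_ofLaw_mul hp hP hm gc gr _

theorem SourceLetter.mean_ofLaw_six :
    (SourceLetter.ofLaw hp hP hm gc gr).mean dC dR 6 =
      ∑ ω, p ω * (dR (x ω) (gr (zr ω, yr ω)) : ℝ) :=
  SourceLetter.sum_prob_ofLaw_mul hp hP hm gc gr _

end Means

/-- The source letter without any description. -/
def SourceLetter.trivial (hP : P ∈ stdSimplex ℝ (X × Yc × Yr)) (gc : Yc → Xc) (gr : Yr → Xr) :
    SourceLetter P Xc Xr where
  Zc := Unit
  Zr := Unit
  pa _ := 1
  β _ _ := 1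
  ρ _ _ _ := 1
  ρ₁ _ _ := 1
  σc _ _ := 1
  σr _ _ _ := 1
  σ₁ _ _ := 1
  gc s := gc s.2
  gr s := gr s.2
  pa_nonneg _ := zero_le_one
  β_nonneg _ _ := zero_le_one
  ρ_nonneg _ _ _ := zero_le_one
  ρ₁_nonneg _ _ := zero_le_one
  σc_nonneg _ _ := zero_le_one
  σr_nonneg _ _ _ := zero_le_one
  σ₁_nonneg _ _ := zero_le_one
  sum_pa := by simp
  sum_β := by simp
  sum_ρ := by simp
  sum_ρ₁ := by simp
  sum_σc := by simp
  sum_σr := by simp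
  sum_σ₁ := by simp
  sum_prob := by
    rw [Fintype.sum_prod_type]
    simpa using hP.2
  pos _ _ := ⟨one_pos, one_pos, one_pos, one_pos, one_pos⟩

theorem SourceLetter.mean_trivial (hP : P ∈ stdSimplex ℝ (X × Yc × Yr)) (gc : Yc → Xc)
    (gr : Yr → Xr) (dC : X → Xc → ℝ≥0) (dR : X → Xr → ℝ≥0) (q : Fin 7) (hq : q < 5) :
    (SourceLetter.trivial hP gc gr).mean dC dR q = 0 := by
  refine Finset.sum_eq_zero fun s _ => ?_
  have : (SourceLetter.trivial hP gc gr).stat dC dR q s = 0 := by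
    fin_cases q <;> first | exact Real.logb_one | simp at hq
  rw [this, mul_zero]

end SourceLetter

/-! ### Channel letters obtained from auxiliary random variables -/

section ChannelLetterOfLaw

variable {Ω : Type*} [Fintype Ω] {U Vc Vr : Type*} {T R : Type} {p : Ω → ℝ} {t : Ω → T} {r : Ω → R}
  {vc : Ω → Vc} {vr : Ω → Vr} {W : U → Vc × Vr → ℝ} {κ : T → R → U → ℝ}

theorem law_mul_ratio_mul {A B : Type*} (hp : ∀ ω, 0 ≤ p ω) (f : Ω → A) (g : Ω → B) (a : A)
    (b : B) : law p f a * law p g b * (law p (fun ω => (f ω, g ω)) (a, b) /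
      (law p f a * law p g b)) = law p (fun ω => (f ω, g ω)) (a, b) := by
  rcases (law_nonneg hp f a).eq_or_lt with h0 | h0
  · rw [← h0, zero_mul, zero_mul]
    exact (le_antisymm ((law_le_law_comp hp _ Prod.fst (a, b)).trans h0.symm.le)
      (law_nonneg hp _ _)).symm
  rcases (law_nonneg hp g b).eq_or_lt with h1 | h1
  · rw [← h1, mul_zero, zero_mul]
    exact (le_antisymm ((law_le_law_comp hp _ Prod.snd (a, b)).trans h1.symm.le)
      (law_nonneg hp _ _)).symm
  · field_simp

theorem sum_law_mul_ratio_right_le_one {A E : Type*} [Fintype A] (hp : ∀ ω, 0 ≤ p ω) (f : Ω → A)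
    (k : Ω → E) (e : E) :
    ∑ a, law p f a * (law p (fun ω => (f ω, k ω)) (a, e) / (law p f a * law p k e)) ≤ 1 := by
  refine le_trans (le_of_eq (Finset.sum_congr rfl fun a _ => ?_))
    (sum_law_mul_ratio_le_one hp f k e)
  rw [law_swap p f k, mul_comm (law p k e)]

theorem sum_law_mul_div_le {A E : Type*} [Fintype A] (hp : ∀ ω, 0 ≤ p ω) (f : Ω → A) (k : Ω → E)
    (e : E) (c : ℝ) (hc : 0 ≤ c) :
    ∑ a, law p f a * (law p (fun ω => (f ω, k ω)) (a, e) / (law p f a * c)) ≤ law p k e / c := by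
  rw [← sum_law_prodMk_left p f k e, Finset.sum_div]
  refine Finset.sum_le_sum fun a _ => ?_
  rcases (law_nonneg hp f a).eq_or_lt with h0 | h0
  · rw [← h0, zero_mul]
    exact div_nonneg (law_nonneg hp _ _) hc
  · rw [← mul_div_assoc, mul_div_mul_left _ _ h0.ne']

variable [Fintype U] [Fintype Vc] [Fintype Vr] [Fintype T] [Fintype R]

/-- The channel letter of given auxiliary random variables. -/
def ChannelLetter.ofLaw (hp : p ∈ stdSimplex ℝ Ω) (hW : IsChannel W)
    (hκ : ∀ a b u, 0 ≤ κ a b u) (hκ1 : ∀ a b, ∑ u, κ a b u ≤ 1)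
    (hlaw : ∀ a b v, law p (fun ω => (t ω, r ω, vc ω, vr ω)) (a, b, v) =
      ∑ u, law p (fun ω => (t ω, r ω)) (a, b) * κ a b u * W u v) : ChannelLetter W where
  T := T
  R := R
  qt := law p t
  qr := law p r
  τ a b := law p (fun ω => (t ω, r ω)) (a, b) / (law p t a * law p r b)
  κ := κ
  θc v a := law p (fun ω => (t ω, vc ω)) (a, v) / (law p t a * law p vc v)
  -- The ratio is taken against three independent letters, because `t` and `ur` are drawn
  -- independently in the codebook. Its expected logarithm is I(T;Vr) + I(Ur;T,Vr).
  θr v a b := law p (fun ω => (r ω, t ω, vr ω)) (b, a, v) / (law p r b * (law p t a * law p vr v))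
  θt v a := law p (fun ω => (t ω, vr ω)) (a, v) / (law p t a * law p vr v)
  θR v b := law p (fun ω => (r ω, vr ω)) (b, v) / (law p r b * law p vr v)
  qt_nonneg := law_nonneg hp.1 _
  qr_nonneg := law_nonneg hp.1 _
  τ_nonneg _ _ := div_nonneg (law_nonneg hp.1 _ _)
    (mul_nonneg (law_nonneg hp.1 _ _) (law_nonneg hp.1 _ _))
  κ_nonneg := hκ
  θc_nonneg _ _ := div_nonneg (law_nonneg hp.1 _ _)
    (mul_nonneg (law_nonneg hp.1 _ _) (law_nonneg hp.1 _ _))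
  θr_nonneg _ _ _ := div_nonneg (law_nonneg hp.1 _ _) (mul_nonneg (law_nonneg hp.1 _ _)
    (mul_nonneg (law_nonneg hp.1 _ _) (law_nonneg hp.1 _ _)))
  θt_nonneg _ _ := div_nonneg (law_nonneg hp.1 _ _)
    (mul_nonneg (law_nonneg hp.1 _ _) (law_nonneg hp.1 _ _))
  θR_nonneg _ _ := div_nonneg (law_nonneg hp.1 _ _)
    (mul_nonneg (law_nonneg hp.1 _ _) (law_nonneg hp.1 _ _))
  sum_qt := by rw [sum_law, hp.2]
  sum_qr := by rw [sum_law, hp.2]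
  sum_κ := hκ1
  sum_qt_τ := sum_law_mul_ratio_right_le_one hp.1 t r
  sum_qr_τ a := by
    simpa only [law_swap p t r] using sum_law_mul_ratio_le_one hp.1 r t a
  sum_θc := sum_law_mul_ratio_right_le_one hp.1 t vc
  sum_qt_θr v b := by
    refine le_trans (le_of_eq (Finset.sum_congr rfl fun a _ => ?_))
      (sum_law_mul_div_le hp.1 t (fun ω => (r ω, vr ω)) (b, v) (law p r b * law p vr v)
        (mul_nonneg (law_nonneg hp.1 _ _) (law_nonneg hp.1 _ _)))
    rw [law_comp_injective p (fun ω => (t ω, r ω, vr ω)) (φ := fun s => (s.2.1, s.1, s.2.2))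
      (fun s t h => by
        simp only [Prod.mk.injEq] at h; exact Prod.ext h.2.1 (Prod.ext h.1 h.2.2)) (a, b, v)]
    congr 2
    ring
  sum_qr_θr v a := sum_law_mul_div_le hp.1 r (fun ω => (t ω, vr ω)) (a, v)
    (law p t a * law p vr v) (mul_nonneg (law_nonneg hp.1 _ _) (law_nonneg hp.1 _ _))
  sum_θR := sum_law_mul_ratio_right_le_one hp.1 r vr
  sum_prob := by
    have h1 := sum_law p (fun ω => (t ω, r ω, vc ω, vr ω))
    rw [hp.2, Fintype.sum_prod_type, Finset.sum_congr rfl fun a _ => Fintype.sum_prod_type _] at h1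
    rw [← h1, Fintype.sum_prod_type]
    refine Finset.sum_congr rfl fun a _ => ?_
    rw [Fintype.sum_prod_type]
    refine Finset.sum_congr rfl fun b _ => ?_
    rw [Fintype.sum_prod_type, Finset.sum_comm]
    refine Finset.sum_congr rfl fun v _ => ?_
    rw [hlaw]
    refine Finset.sum_congr rfl fun u _ => ?_
    rw [law_mul_ratio_mul hp.1]
  pos s hs := by
    obtain ⟨a, b, u, v⟩ := s
    simp only at hs ⊢
    rw [law_mul_ratio_mul hp.1] at hs
    have hs' : 0 < law p (fun ω => (t ω, r ω, vc ω, vr ω)) (a, b, v) := by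
      rw [hlaw]
      exact hs.trans_le (Finset.single_le_sum (f := fun u => law p (fun ω => (t ω, r ω)) (a, b) *
        κ a b u * W u v) (fun u _ => mul_nonneg (mul_nonneg (law_nonneg hp.1 _ _) (hκ _ _ _))
          ((hW u).1 v)) (Finset.mem_univ u))
    have h1 := law_comp_pos hp.1 _ (fun s : T × R × Vc × Vr => s.1) hs'
    have h2 := law_comp_pos hp.1 _ (fun s : T × R × Vc × Vr => s.2.1) hs'
    have h3 := law_comp_pos hp.1 _ (fun s : T × R × Vc × Vr => s.2.2.1) hs'
    have h4 := law_comp_pos hp.1 _ (fun s : T × R × Vc × Vr => s.2.2.2) hs'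
    have h5 := law_comp_pos hp.1 _ (fun s : T × R × Vc × Vr => (s.1, s.2.1)) hs'
    have h6 := law_comp_pos hp.1 _ (fun s : T × R × Vc × Vr => (s.1, s.2.2.1)) hs'
    have h7 := law_comp_pos hp.1 _ (fun s : T × R × Vc × Vr => (s.2.1, s.1, s.2.2.2)) hs'
    have h8 := law_comp_pos hp.1 _ (fun s : T × R × Vc × Vr => (s.1, s.2.2.2)) hs'
    have h9 := law_comp_pos hp.1 _ (fun s : T × R × Vc × Vr => (s.2.1, s.2.2.2)) hs'
    exact ⟨div_pos h5 (mul_pos h1 h2), div_pos h6 (mul_pos h1 h3),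
      div_pos h7 (mul_pos h2 (mul_pos h1 h4)), div_pos h8 (mul_pos h1 h4),
      div_pos h9 (mul_pos h2 h4)⟩

section Means

variable (hp : p ∈ stdSimplex ℝ Ω) (hW : IsChannel W) (hκ : ∀ a b u, 0 ≤ κ a b u)
    (hκ1 : ∀ a b, ∑ u, κ a b u ≤ 1)
    (hlaw : ∀ a b v, law p (fun ω => (t ω, r ω, vc ω, vr ω)) (a, b, v) =
      ∑ u, law p (fun ω => (t ω, r ω)) (a, b) * κ a b u * W u v)

theorem ChannelLetter.sum_prob_ofLaw_mul (φ : T → R → Vc → Vr → ℝ) :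
    ∑ s, (ChannelLetter.ofLaw hp hW hκ hκ1 hlaw).prob s * φ s.1 s.2.1 s.2.2.2.1 s.2.2.2.2 =
      ∑ ω, p ω * φ (t ω) (r ω) (vc ω) (vr ω) := by
  rw [← sum_law_mul p (fun ω => (t ω, r ω, vc ω, vr ω)) (fun s => φ s.1 s.2.1 s.2.2.1 s.2.2.2)]
  calc _ = ∑ s : T × R × U × Vc × Vr, law p (fun ω => (t ω, r ω)) (s.1, s.2.1) *
        κ s.1 s.2.1 s.2.2.1 * W s.2.2.1 s.2.2.2 * φ s.1 s.2.1 s.2.2.2.1 s.2.2.2.2 := by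
        refine Finset.sum_congr rfl fun s _ => ?_
        rw [← law_mul_ratio_mul hp.1 t r s.1 s.2.1]
        rfl
    _ = _ := by
        rw [Fintype.sum_prod_type, Fintype.sum_prod_type]
        refine Finset.sum_congr rfl fun a _ => ?_
        rw [Fintype.sum_prod_type, Fintype.sum_prod_type]
        refine Finset.sum_congr rfl fun b _ => ?_
        rw [Fintype.sum_prod_type, Finset.sum_comm]
        refine Finset.sum_congr rfl fun v _ => ?_
        rw [hlaw, Finset.sum_mul]

theorem ChannelLetter.mean_ofLaw_zero :
    (ChannelLetter.ofLaw hp hW hκ hκ1 hlaw).mean 0 = mutualInfo p t r := by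
  rw [mutualInfo_eq_sum]
  exact ChannelLetter.sum_prob_ofLaw_mul hp hW hκ hκ1 hlaw (fun a b _ _ => Real.logb 2
    (law p (fun ω => (t ω, r ω)) (a, b) / (law p t a * law p r b)))

theorem ChannelLetter.mean_ofLaw_one :
    (ChannelLetter.ofLaw hp hW hκ hκ1 hlaw).mean 1 = mutualInfo p t vc := by
  rw [mutualInfo_eq_sum]
  exact ChannelLetter.sum_prob_ofLaw_mul hp hW hκ hκ1 hlaw (fun a _ v _ => Real.logb 2
    (law p (fun ω => (t ω, vc ω)) (a, v) / (law p t a * law p vc v)))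

theorem ChannelLetter.mean_ofLaw_two :
    (ChannelLetter.ofLaw hp hW hκ hκ1 hlaw).mean 2 =
      mutualInfo p t vr + mutualInfo p r (fun ω => (t ω, vr ω)) := by
  rw [mutualInfo_eq_sum, mutualInfo_eq_sum, ← Finset.sum_add_distrib]
  refine (ChannelLetter.sum_prob_ofLaw_mul hp hW hκ hκ1 hlaw (fun a b _ v => Real.logb 2
    (law p (fun ω => (r ω, t ω, vr ω)) (b, a, v) /
      (law p r b * (law p t a * law p vr v))))).trans ?_
  simp only [← mul_add]
  refine sum_mul_logb_congr hp.1 fun ω hω => ?_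
  have h1 := law_pos hp.1 (fun ω => (r ω, t ω, vr ω)) hω
  have h2 := law_pos hp.1 (fun ω => (t ω, vr ω)) hω
  have h3 := law_pos hp.1 t hω
  have h4 := law_pos hp.1 r hω
  have h5 := law_pos hp.1 vr hω
  rw [← Real.logb_mul (by positivity) (by positivity)]
  congr 1
  field_simp

theorem ChannelLetter.mean_ofLaw_three :
    (ChannelLetter.ofLaw hp hW hκ hκ1 hlaw).mean 3 = mutualInfo p t vr := by
  rw [mutualInfo_eq_sum]
  exact ChannelLetter.sum_prob_ofLaw_mul hp hW hκ hκ1 hlaw (fun a _ _ v => Real.logb 2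
    (law p (fun ω => (t ω, vr ω)) (a, v) / (law p t a * law p vr v)))

theorem ChannelLetter.mean_ofLaw_four :
    (ChannelLetter.ofLaw hp hW hκ hκ1 hlaw).mean 4 = mutualInfo p r vr := by
  rw [mutualInfo_eq_sum]
  exact ChannelLetter.sum_prob_ofLaw_mul hp hW hκ hκ1 hlaw (fun _ b _ v => Real.logb 2
    (law p (fun ω => (r ω, vr ω)) (b, v) / (law p r b * law p vr v)))

end Means

end ChannelLetterOfLaw

/-! ### The channel input as a random function of `(t, ur)` -/

section FactoredInput

variable {Ω : Type*} [Fintype Ω] {U Vc Vr Uc Ur T : Type*} [Fintype Uc] {p : Ω → ℝ}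
  {uc : Ω → Uc} {ur : Ω → Ur} {t : Ω → T} {u : Ω → U} {vc : Ω → Vc} {vr : Ω → Vr}

/-- The conditional law of the channel input given `(t, ur)`, if the input depends on `t` through
`(ur, uc)` only. -/
def inputKernel (p : Ω → ℝ) (t : Ω → T) (ur : Ω → Ur) (uc : Ω → Uc) (u : Ω → U) (a : T) (b : Ur)
    (w : U) : ℝ :=
  ∑ c, law p (fun ω => (t ω, ur ω, uc ω)) (a, b, c) / law p (fun ω => (t ω, ur ω)) (a, b) *
    (law p (fun ω => ((ur ω, uc ω), u ω)) ((b, c), w) / law p (fun ω => (ur ω, uc ω)) (b, c))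

theorem inputKernel_nonneg (hp : ∀ ω, 0 ≤ p ω) (a : T) (b : Ur) (w : U) :
    0 ≤ inputKernel p t ur uc u a b w :=
  Finset.sum_nonneg fun _ _ => mul_nonneg (div_nonneg (law_nonneg hp _ _) (law_nonneg hp _ _))
    (div_nonneg (law_nonneg hp _ _) (law_nonneg hp _ _))

theorem sum_law_prodMk_prodMk (p : Ω → ℝ) (t : Ω → T) (ur : Ω → Ur) (uc : Ω → Uc) (a : T) (b : Ur) :
    ∑ c, law p (fun ω => (t ω, ur ω, uc ω)) (a, b, c) = law p (fun ω => (t ω, ur ω)) (a, b) := by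
  rw [← sum_law_prodMk p (fun ω => (t ω, ur ω)) uc (a, b)]
  exact Finset.sum_congr rfl fun c _ => (law_assoc p t ur uc a b c).symm

variable [Fintype U]

theorem sum_inputKernel (hp : ∀ ω, 0 ≤ p ω) (a : T) (b : Ur) :
    ∑ w, inputKernel p t ur uc u a b w ≤ 1 := by
  unfold inputKernel
  rw [Finset.sum_comm]
  calc _ ≤ ∑ c, law p (fun ω => (t ω, ur ω, uc ω)) (a, b, c) /
        law p (fun ω => (t ω, ur ω)) (a, b) := by
        refine Finset.sum_le_sum fun c _ => ?_
        rw [← Finset.mul_sum, ← Finset.sum_div, sum_law_prodMk]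
        exact mul_le_of_le_one_right (div_nonneg (law_nonneg hp _ _) (law_nonneg hp _ _))
          (div_self_le_one _)
    _ ≤ 1 := by
        rw [← Finset.sum_div, sum_law_prodMk_prodMk]
        exact div_self_le_one _

variable {W : U → Vc × Vr → ℝ}

/-- Summing over `uc`, the first Markov chain removes `t` from the law of the output given `(ur,
uc)`, and the second one expresses that law through `W`. So `uc` is mere local randomness of the
encoder and needs no codebook. -/
theorem law_eq_sum_inputKernel (hp : ∀ ω, 0 ≤ p ω)
    (hu : ∀ a b, law p (fun ω => (u ω, vc ω, vr ω)) (a, b) = law p u a * W a b)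
    (hm1 : IsMarkov p t (fun ω => (ur ω, uc ω)) (fun ω => (vr ω, vc ω)))
    (hm2 : IsMarkov p (fun ω => (ur ω, uc ω)) u (fun ω => (vr ω, vc ω))) (a : T) (b : Ur)
    (v : Vc × Vr) :
    law p (fun ω => (t ω, ur ω, vc ω, vr ω)) (a, b, v) =
      ∑ w, law p (fun ω => (t ω, ur ω)) (a, b) * inputKernel p t ur uc u a b w * W w v := by
  obtain ⟨v₁, v₂⟩ := v
  have hk : ∀ c w, law p (fun ω => ((ur ω, uc ω), u ω, vr ω, vc ω)) ((b, c), w, v₂, v₁) =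
      law p (fun ω => ((ur ω, uc ω), u ω)) ((b, c), w) * W w (v₁, v₂) := by
    intro c w
    have e := hm2 (b, c) w (v₂, v₁)
    have e2 : law p (fun ω => (u ω, vr ω, vc ω)) (w, v₂, v₁) = law p u w * W w (v₁, v₂) := by
      rw [← hu]
      exact law_comp_injective p (fun ω => (u ω, vc ω, vr ω)) (φ := fun s => (s.1, s.2.2, s.2.1))
        (fun s t h => by
          simp only [Prod.mk.injEq] at h; exact Prod.ext h.1 (Prod.ext h.2.2 h.2.1)) (w, v₁, v₂)
    rcases (law_nonneg hp u w).eq_or_lt with h0 | h0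
    · have z1 : law p (fun ω => ((ur ω, uc ω), u ω, vr ω, vc ω)) ((b, c), w, v₂, v₁) = 0 :=
        le_antisymm ((law_le_law_comp hp _ (fun s : (Ur × Uc) × U × Vr × Vc => s.2.1)
          ((b, c), w, v₂, v₁)).trans h0.symm.le) (law_nonneg hp _ _)
      have z2 : law p (fun ω => ((ur ω, uc ω), u ω)) ((b, c), w) = 0 :=
        le_antisymm ((law_le_law_comp hp _ Prod.snd ((b, c), w)).trans h0.symm.le)
          (law_nonneg hp _ _)
      rw [z1, z2, zero_mul]
    · refine mul_right_cancel₀ h0.ne' ?_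
      rw [e, e2]; ring
  have hkv : ∀ c, law p (fun ω => ((ur ω, uc ω), vr ω, vc ω)) ((b, c), v₂, v₁) =
      ∑ w, law p (fun ω => ((ur ω, uc ω), u ω)) ((b, c), w) * W w (v₁, v₂) := by
    intro c
    rw [← Finset.sum_congr rfl fun w _ => hk c w,
      ← sum_law_prodMk_left p u (fun ω => ((ur ω, uc ω), vr ω, vc ω)) ((b, c), v₂, v₁)]
    refine Finset.sum_congr rfl fun w _ => ?_
    exact (law_comp_injective p (fun ω => (u ω, (ur ω, uc ω), vr ω, vc ω))
      (φ := fun s => (s.2.1, s.1, s.2.2)) (fun s t h => by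
          simp only [Prod.mk.injEq] at h; exact Prod.ext h.2.1 (Prod.ext h.1 h.2.2))
          (w, (b, c), v₂, v₁)).symm
  have hsum : law p (fun ω => (t ω, ur ω, vc ω, vr ω)) (a, b, v₁, v₂) =
      ∑ c, law p (fun ω => (t ω, (ur ω, uc ω), vr ω, vc ω)) (a, (b, c), v₂, v₁) := by
    rw [← sum_law_prodMk_left p uc (fun ω => (t ω, ur ω, vc ω, vr ω)) (a, b, v₁, v₂)]
    refine Finset.sum_congr rfl fun c _ => ?_
    exact (law_comp_injective p (fun ω => (uc ω, t ω, ur ω, vc ω, vr ω))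
      (φ := fun s => (s.2.1, (s.2.2.1, s.1), s.2.2.2.2, s.2.2.2.1)) (fun s t h => by
          simp only [Prod.mk.injEq] at h
          exact Prod.ext h.2.1.2 (Prod.ext h.1 (Prod.ext h.2.1.1 (Prod.ext h.2.2.2 h.2.2.1))))
          (c, a, b, v₁, v₂)).symm
  rcases (law_nonneg hp (fun ω => (t ω, ur ω)) (a, b)).eq_or_lt with h0 | h0
  · rw [← h0]
    simp only [zero_mul, Finset.sum_const_zero]
    exact le_antisymm ((law_le_law_comp hp _ (fun s : T × Ur × Vc × Vr => (s.1, s.2.1))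
      (a, b, v₁, v₂)).trans h0.symm.le) (law_nonneg hp _ _)
  rw [hsum]
  calc _ = ∑ c, law p (fun ω => (t ω, ur ω, uc ω)) (a, b, c) /
        law p (fun ω => (ur ω, uc ω)) (b, c) *
          ∑ w, law p (fun ω => ((ur ω, uc ω), u ω)) ((b, c), w) * W w (v₁, v₂) := by
        refine Finset.sum_congr rfl fun c _ => ?_
        rw [← hkv c]
        have e := hm1 a (b, c) (v₂, v₁)
        rcases (law_nonneg hp (fun ω => (ur ω, uc ω)) (b, c)).eq_or_lt with h1 | h1
        · rw [← h1, div_zero, zero_mul]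
          exact le_antisymm ((law_le_law_comp hp _ (fun s : T × (Ur × Uc) × Vr × Vc => s.2.1)
            (a, (b, c), v₂, v₁)).trans h1.symm.le) (law_nonneg hp _ _)
        · rw [div_mul_eq_mul_div, eq_div_iff h1.ne', e]
    _ = _ := by
        simp only [Finset.mul_sum, inputKernel, Finset.sum_mul]
        rw [Finset.sum_comm]
        refine Finset.sum_congr rfl fun w _ => Finset.sum_congr rfl fun c _ => ?_
        field_simp

end FactoredInput

/-! ### Consequences of vanishing information -/

section Independence

variable {Ω : Type*} [Fintype Ω] {A B C : Type*} {p : Ω → ℝ}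

theorem mutualInfo_eq_zero [Fintype A] [Fintype B] {f : Ω → A} {g : Ω → B}
    (h : ∀ a b, law p (fun ω => (f ω, g ω)) (a, b) = law p f a * law p g b) :
    mutualInfo p f g = 0 := by
  refine Finset.sum_eq_zero fun a _ => Finset.sum_eq_zero fun b _ => ?_
  rw [h]
  by_cases h0 : law p f a * law p g b = 0
  · rw [h0, zero_mul]
  · rw [div_self h0, Real.logb_one, mul_zero]

theorem law_prodMk_eq_mul_of_prodMk [Fintype B] {f : Ω → A} {g : Ω → B} {h : Ω → C}
    (hi : ∀ a b c, law p (fun ω => ((f ω, g ω), h ω)) ((a, b), c) =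
      law p (fun ω => (f ω, g ω)) (a, b) * law p h c) (a : A) (c : C) :
    law p (fun ω => (f ω, h ω)) (a, c) = law p f a * law p h c := by
  rw [← sum_law_prodMk p f g a, Finset.sum_mul,
    ← sum_law_prodMk_left p g (fun ω => (f ω, h ω)) (a, c)]
  refine Finset.sum_congr rfl fun b _ => ?_
  rw [← hi]
  exact (law_comp_injective p (fun ω => (g ω, f ω, h ω)) (φ := fun s => ((s.2.1, s.1), s.2.2))
    (fun s t h => by
      simp only [Prod.mk.injEq] at h; exact Prod.ext h.1.2 (Prod.ext h.1.1 h.2)) (b, a, c)).symm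

/-- In the applications `F a u` is the joint weight of `a` and the channel input `u`, and `w` is an
output law common to all inputs. The output is then independent of everything that precedes the
channel. -/
theorem law_prodMk_eq_mul_of_const [Fintype B] {U : Type*} [Fintype U]
    (hp1 : ∑ ω, p ω = 1) {f : Ω → A} {g : Ω → B} {F : A → U → ℝ} {w : B → ℝ} [Fintype A]
    (hw : ∑ b, w b = 1)
    (h : ∀ a b, law p (fun ω => (f ω, g ω)) (a, b) = ∑ u, F a u * w b) (a : A) (b : B) :
    law p (fun ω => (f ω, g ω)) (a, b) = law p f a * law p g b := by
  have h1 : ∀ a, law p f a = ∑ u, F a u := by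
    intro a
    rw [← sum_law_prodMk p f g a, Finset.sum_congr rfl fun b _ => h a b]
    simp only [← Finset.sum_mul, ← Finset.mul_sum, hw, mul_one]
  have h2 : ∀ b, law p g b = w b := by
    intro b
    rw [← sum_law_prodMk_left p f g b, Finset.sum_congr rfl fun a _ => h a b]
    simp only [← Finset.sum_mul, ← h1]
    rw [sum_law, hp1, one_mul]
  rw [h, h1, h2, Finset.sum_mul]

/-- If `x - y - z` is a Markov chain, then an estimate of `x` from `(z, y)` can be replaced by an
estimate from `y`. -/
theorem exists_estimate_of_condMutualInfo_eq_zero {X Y Z Xh : Type*} [Fintype X] [Fintype Y]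
    [Fintype Z] [Nonempty Z] (hp : ∀ ω, 0 ≤ p ω) {x : Ω → X} {y : Ω → Y} {z : Ω → Z}
    (h0 : condMutualInfo p x z y = 0) (d : X → Xh → ℝ≥0) (g : Z × Y → Xh) :
    ∃ g' : Y → Xh, ∑ ω, p ω * (d (x ω) (g' (y ω)) : ℝ) ≤
      ∑ ω, p ω * (d (x ω) (g (z ω, y ω)) : ℝ) := by
  have hf := (condMutualInfo_nonneg_and hp x z y).2 h0
  -- `D c b` is the unnormalized distortion at `y = b` when `g` is told that `z = c`. As x and z are
  -- independent given y, the actual distortion averages `D` over z, so for each `b` a best constant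
  -- `c` does no worse.
  set D : Z → Y → ℝ := fun c b => ∑ a, law p (fun ω => (x ω, y ω)) (a, b) * d a (g (c, b))
  have hD : ∀ b, ∃ c, ∀ c', D c b ≤ D c' b := fun b => by
    obtain ⟨c, -, hc⟩ := Finset.exists_min_image Finset.univ (fun c => D c b) Finset.univ_nonempty
    exact ⟨c, fun c' => hc c' (Finset.mem_univ c')⟩
  choose zs hzs using hD
  refine ⟨fun b => g (zs b, b), ?_⟩
  have e1 := sum_law_mul p (fun ω => (x ω, y ω)) (fun s => (d s.1 (g (zs s.2, s.2)) : ℝ))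
  have e2 := sum_law_mul p (fun ω => (x ω, z ω, y ω)) (fun s => (d s.1 (g s.2) : ℝ))
  rw [← e1, ← e2]
  simp only [Fintype.sum_prod_type]
  rw [Finset.sum_comm]
  calc ∑ b, D (zs b) b ≤ ∑ b, ∑ c, law p (fun ω => (z ω, y ω)) (c, b) / law p y b * D c b := by
        refine Finset.sum_le_sum fun b _ => ?_
        rcases (law_nonneg hp y b).eq_or_lt with hb | hb
        · have : ∀ c, D c b = 0 := fun c => Finset.sum_eq_zero fun a _ => by
            rw [le_antisymm ((law_le_law_comp hp (fun ω => (x ω, y ω)) Prod.snd (a, b)).trans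
              hb.symm.le) (law_nonneg hp _ _), zero_mul]
          simp [this]
        · calc D (zs b) b = ∑ c, law p (fun ω => (z ω, y ω)) (c, b) / law p y b * D (zs b) b := by
                rw [← Finset.sum_mul, ← Finset.sum_div, sum_law_prodMk_left, div_self hb.ne',
                  one_mul]
            _ ≤ _ := Finset.sum_le_sum fun c _ => mul_le_mul_of_nonneg_left (hzs b c)
                (div_nonneg (law_nonneg hp _ _) hb.le)
    _ = _ := by
        simp only [D, Finset.mul_sum]
        rw [Finset.sum_comm, Finset.sum_comm (s := (Finset.univ : Finset X))]
        refine Finset.sum_congr rfl fun c _ => ?_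
        rw [Finset.sum_comm]
        refine Finset.sum_congr rfl fun a _ => Finset.sum_congr rfl fun b _ => ?_
        rw [← mul_assoc]
        congr 1
        rcases (law_nonneg hp y b).eq_or_lt with hb | hb
        · rw [← hb, div_zero, zero_mul]
          exact (le_antisymm ((law_le_law_comp hp _ (fun s : X × Z × Y => s.2.2) (a, c, b)).trans
              hb.symm.le) (law_nonneg hp _ _)).symm
        · rw [div_mul_eq_mul_div, div_eq_iff hb.ne', hf]; ring

end Independence

/-! ### The coin-toss input and its laws -/

section MixingLetter

variable {U Vc Vr : Type*} [Fintype Vc] [Fintype Vr]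

/-- Transition probabilities to receiver `c`. -/
def outC (W : U → Vc × Vr → ℝ) (u : U) (v : Vc) : ℝ := ∑ v', W u (v, v')

/-- Transition probabilities to receiver `r`. -/
def outR (W : U → Vc × Vr → ℝ) (u : U) (v : Vr) : ℝ := ∑ v', W u (v', v)

/-- Two independent uniform inputs, one of which is fed into the channel by the toss of a coin. -/
def mixProb {k : ℕ} (e : Fin k → U) (W : U → Vc × Vr → ℝ) (s : Fin k × Fin k × Vc × Vr) : ℝ :=
  ((k : ℝ) * k)⁻¹ * ((W (e s.1) s.2.2 + W (e s.2.1) s.2.2) / 2)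

open Classical in
/-- The coin toss. -/
def mixKernel {k : ℕ} (e : Fin k → U) (a b : Fin k) (u : U) : ℝ :=
  ((if u = e a then 1 else 0) + (if u = e b then 1 else 0)) / 2

theorem mixKernel_nonneg {k : ℕ} (e : Fin k → U) (a b : Fin k) (u : U) : 0 ≤ mixKernel e a b u := by
  classical
  unfold mixKernel
  split_ifs <;> norm_num

open Classical in
theorem law_eq_sum_ite {Ω A : Type*} [Fintype Ω] (p : Ω → ℝ) (f : Ω → A) (a : A) :
    law p f a = ∑ ω, p ω * if f ω = a then 1 else 0 := by
  simp [law, Finset.sum_filter]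

variable {W : U → Vc × Vr → ℝ} {k : ℕ} (e : Fin k → U)

theorem sum_outC (hW : IsChannel W) (u : U) : ∑ v, outC W u v = 1 := by
  rw [← (hW u).2, Fintype.sum_prod_type]; rfl

theorem sum_outR (hW : IsChannel W) (u : U) : ∑ v, outR W u v = 1 := by
  rw [← (hW u).2, Fintype.sum_prod_type, Finset.sum_comm]; rfl

theorem mixProb_mem_stdSimplex (hW : IsChannel W) (hk : 0 < k) :
    mixProb e W ∈ stdSimplex ℝ (Fin k × Fin k × Vc × Vr) := by
  refine ⟨fun s => mul_nonneg (by positivity) (div_nonneg (add_nonneg ((hW _).1 _) ((hW _).1 _))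
    (by norm_num)), ?_⟩
  have hk' : (k : ℝ) ≠ 0 := by exact_mod_cast hk.ne'
  rw [Fintype.sum_prod_type]
  simp only [Fintype.sum_prod_type (α₁ := Fin k), mixProb, ← Finset.mul_sum, ← Finset.sum_div,
    Finset.sum_add_distrib, (hW _).2]
  simp
  field_simp

theorem law_mixProb (W : U → Vc × Vr → ℝ) (s : Fin k × Fin k × Vc × Vr) :
    law (mixProb e W) (fun s => (s.1, s.2.1, s.2.2.1, s.2.2.2)) s = mixProb e W s := by
  classical
  rw [law_eq_sum_ite]
  simp

theorem law_mixProb_fst_snd (hW : IsChannel W) (a b : Fin k) :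
    law (mixProb e W) (fun s => (s.1, s.2.1)) (a, b) = ((k : ℝ) * k)⁻¹ := by
  rw [← sum_law_prodMk (mixProb e W) (fun s => (s.1, s.2.1)) (fun s => s.2.2) (a, b)]
  simp only [law_assoc (mixProb e W) (fun s => s.1) (fun s => s.2.1) (fun s => s.2.2)]
  have h : ∀ v : Vc × Vr, law (mixProb e W) (fun s => (s.1, s.2.1, s.2.2)) (a, b, v) =
    mixProb e W (a, b, v) := fun v => law_mixProb e W (a, b, v)
  simp only [h, mixProb, ← Finset.mul_sum, ← Finset.sum_div, Finset.sum_add_distrib, (hW _).2]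
  norm_num

theorem law_mixProb_fst (hW : IsChannel W) (hk : 0 < k) (a : Fin k) :
    law (mixProb e W) (fun s => s.1) a = (k : ℝ)⁻¹ := by
  have hk' : (k : ℝ) ≠ 0 := by exact_mod_cast hk.ne'
  rw [← sum_law_prodMk (mixProb e W) (fun s => s.1) (fun s => s.2.1) a]
  simp only [law_mixProb_fst_snd e hW]
  simp
  field_simp

theorem law_mixProb_snd (hW : IsChannel W) (hk : 0 < k) (b : Fin k) :
    law (mixProb e W) (fun s => s.2.1) b = (k : ℝ)⁻¹ := by
  have hk' : (k : ℝ) ≠ 0 := by exact_mod_cast hk.ne'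
  rw [← sum_law_prodMk_left (mixProb e W) (fun s => s.1) (fun s => s.2.1) b]
  simp only [law_mixProb_fst_snd e hW]
  simp
  field_simp

theorem law_mixProb_fst_c (a : Fin k) (v : Vc) :
    law (mixProb e W) (fun s => (s.1, s.2.2.1)) (a, v) =
      ((k : ℝ) * k)⁻¹ * ((k * outC W (e a) v + ∑ b, outC W (e b) v) / 2) := by
  classical
  rw [law_eq_sum_ite]
  simp only [Fintype.sum_prod_type, Prod.mk.injEq, ite_and, mul_ite, mul_one, mul_zero]
  have h : ∀ b, (∑ v₁, ∑ v₂, if v₁ = v then mixProb e W (a, b, v₁, v₂) else 0) =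
      ((k : ℝ) * k)⁻¹ * ((outC W (e a) v + outC W (e b) v) / 2) := fun b => by
    rw [Finset.sum_comm]
    simp [mixProb, outC, ← Finset.mul_sum, ← Finset.sum_div, Finset.sum_add_distrib]
  simp [Finset.sum_ite_irrel, h, ← Finset.mul_sum, ← Finset.sum_div, Finset.sum_add_distrib]

theorem law_mixProb_fst_r (a : Fin k) (v : Vr) :
    law (mixProb e W) (fun s => (s.1, s.2.2.2)) (a, v) =
      ((k : ℝ) * k)⁻¹ * ((k * outR W (e a) v + ∑ b, outR W (e b) v) / 2) := by
  classical
  rw [law_eq_sum_ite]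
  simp only [Fintype.sum_prod_type, Prod.mk.injEq, ite_and, mul_ite, mul_one, mul_zero]
  simp [Finset.sum_ite_irrel, mixProb, outR, ← Finset.mul_sum, ← Finset.sum_div,
    Finset.sum_add_distrib]

theorem law_mixProb_snd_fst_r (a b : Fin k) (v : Vr) :
    law (mixProb e W) (fun s => (s.2.1, s.1, s.2.2.2)) (b, a, v) =
      ((k : ℝ) * k)⁻¹ * ((outR W (e a) v + outR W (e b) v) / 2) := by
  classical
  rw [law_eq_sum_ite]
  simp only [Fintype.sum_prod_type, Prod.mk.injEq, ite_and, mul_ite, mul_one, mul_zero]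
  simp [Finset.sum_ite_irrel, mixProb, outR, ← Finset.mul_sum, ← Finset.sum_div,
    Finset.sum_add_distrib]

end MixingLetter

/-! ### Channel letters that provide slack, and letters from the channel region -/

section RegionLetters

variable {U Vc Vr : Type*} [Fintype U] [Fintype Vc] [Fintype Vr] {W : U → Vc × Vr → ℝ}

theorem sum_mixKernel_mul {k : ℕ} (e : Fin k → U) (a b : Fin k) (f : U → ℝ) :
    ∑ u, mixKernel e a b u * f u = (f (e a) + f (e b)) / 2 := by
  classical
  simp only [mixKernel, div_mul_eq_mul_div, ← Finset.sum_div, add_mul, Finset.sum_add_distrib]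
  simp

/-- A channel letter without binning whose rates are positive at each receiver to whose output the
channel input matters. -/
theorem exists_mixing_letter [Nonempty U] (hW : IsChannel W) : ∃ L : ChannelLetter W,
    L.mean 0 = 0 ∧ 0 ≤ L.mean 1 ∧ 0 ≤ L.mean 3 ∧ 0 ≤ L.mean 2 - L.mean 3 ∧
    L.mean 4 ≤ L.mean 2 - L.mean 3 ∧ (L.mean 1 = 0 → ∀ a b v, outC W a v = outC W b v) ∧
    (L.mean 3 = 0 ∨ L.mean 2 - L.mean 3 = 0 → ∀ a b v, outR W a v = outR W b v) := by
  set k := Fintype.card U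
  have hk : 0 < k := Fintype.card_pos
  have hk' : (0 : ℝ) < k := by exact_mod_cast hk
  let e : Fin k ≃ U := (Fintype.equivFin U).symm
  have hp := mixProb_mem_stdSimplex e hW hk
  have hlaw : ∀ a b v, law (mixProb e W) (fun s => (s.1, s.2.1, s.2.2.1, s.2.2.2)) (a, b, v) =
      ∑ u, law (mixProb e W) (fun s => (s.1, s.2.1)) (a, b) * mixKernel e a b u * W u v := by
    intro a b v
    rw [law_mixProb, law_mixProb_fst_snd e hW]
    simp only [mul_assoc]
    rw [← Finset.mul_sum, sum_mixKernel_mul e a b (fun u => W u v)]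
    rfl
  have hsum : ∀ a b, ∑ u, mixKernel e a b u ≤ 1 := fun a b => by
    simpa using (sum_mixKernel_mul e a b fun _ => 1).le
  have i0 := mutualInfo_nonneg_and hp.1 hp.2 (fun s => s.1) (fun s => s.2.2.1)
  have i1 := mutualInfo_nonneg_and hp.1 hp.2 (fun s => s.1) (fun s => s.2.2.2)
  have i2 := mutualInfo_nonneg_and hp.1 hp.2 (fun s => s.2.1) (fun s => (s.1, s.2.2.2))
  refine ⟨ChannelLetter.ofLaw hp hW (mixKernel_nonneg e) hsum hlaw, ?_⟩
  rw [ChannelLetter.mean_ofLaw_zero, ChannelLetter.mean_ofLaw_one, ChannelLetter.mean_ofLaw_two,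
    ChannelLetter.mean_ofLaw_three, ChannelLetter.mean_ofLaw_four, add_sub_cancel_left]
  refine ⟨mutualInfo_eq_zero fun a b => ?_, i0.1, i1.1, i2.1, ?_, fun h a b v => ?_, fun h a b v => ?_⟩
  · rw [law_mixProb_fst_snd e hW, law_mixProb_fst e hW hk, law_mixProb_snd e hW hk, mul_inv]
  · rw [mutualInfo_prodMk hp.1]
    exact le_add_of_nonneg_right (condMutualInfo_nonneg_and hp.1 _ _ _).1
  -- Under independence, and with the first input uniform, its joint law with the output is the same
  -- for both values. The contribution of the other input is common to the two and cancels.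
  · have h1 := i0.2 h (e.symm a) v
    have h2 := i0.2 h (e.symm b) v
    rw [law_mixProb_fst e hW hk] at h1 h2
    have h3 := h1.trans h2.symm
    rw [law_mixProb_fst_c, law_mixProb_fst_c, mul_right_inj' (by positivity),
      div_left_inj' two_ne_zero, add_left_inj, mul_right_inj' hk'.ne'] at h3
    simpa using h3
  · rcases h with h | h
    · have h1 := i1.2 h (e.symm a) v
      have h2 := i1.2 h (e.symm b) v
      rw [law_mixProb_fst e hW hk] at h1 h2
      have h3 := h1.trans h2.symm
      rw [law_mixProb_fst_r, law_mixProb_fst_r, mul_right_inj' (by positivity),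
        div_left_inj' two_ne_zero, add_left_inj, mul_right_inj' hk'.ne'] at h3
      simpa using h3
    -- The same comparison for the second input, with the first input held at the common value
    -- `e.symm a`.
    · have h1 := i2.2 h (e.symm a) (e.symm a, v)
      have h2 := i2.2 h (e.symm b) (e.symm a, v)
      rw [law_mixProb_snd e hW hk] at h1 h2
      have h3 := h1.trans h2.symm
      rw [law_mixProb_snd_fst_r, law_mixProb_snd_fst_r, mul_right_inj' (by positivity),
        div_left_inj' two_ne_zero, add_right_inj] at h3
      simpa using h3

/-- The last two clauses concern a receiver whose output does not depend on the input. There I(T;Vr)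
vanishes, but I(Ur;T,Vr) reduces to I(Ur;T), which explains the extra premise `L.mean 0 = 0`. -/
theorem exists_letter_of_mem_channelRegionLDS (hW : IsChannel W) {κ : ℚ} {R : ℝ × ℝ × ℝ}
    (hR : R ∈ channelRegionLDS W κ) : Nonempty U ∧ ∃ L : ChannelLetter W,
    0 ≤ L.mean 0 ∧ L.mean 4 ≤ L.mean 2 - L.mean 3 ∧ R.1 ≤ κ * (L.mean 1 - L.mean 0) ∧
    R.2.1 ≤ κ * (L.mean 3 - L.mean 0) ∧ R.2.2 ≤ κ * (L.mean 2 - L.mean 3) ∧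
    ((∀ a b v, outC W a v = outC W b v) → L.mean 1 = 0) ∧
    ((∀ a b v, outR W a v = outR W b v) →
      L.mean 3 = 0 ∧ (L.mean 0 = 0 → L.mean 2 - L.mean 3 = 0)) := by
  obtain ⟨Ω, Uc, Ur, T, _, _, _, _, p, uc, ur, t, u, vc, vr, hp, hu, hm1, hm2, h1, h2, h3⟩ := hR
  have hΩ : Nonempty Ω := by
    by_contra h
    rw [not_nonempty_iff] at h
    simpa using hp.2
  have hlaw := law_eq_sum_inputKernel hp.1 hu hm1 hm2
  obtain ⟨ω₀⟩ := hΩ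
  have hpair : ∀ a b v, law p (fun ω => ((t ω, ur ω), vc ω, vr ω)) ((a, b), v) =
      ∑ w, law p (fun ω => (t ω, ur ω)) (a, b) * inputKernel p t ur uc u a b w * W w v :=
    fun a b v => (law_assoc p t ur (fun ω => (vc ω, vr ω)) a b v).trans (hlaw a b v)
  have hC : (∀ a b v, outC W a v = outC W b v) → ∀ a v,
      law p (fun ω => ((t ω, ur ω), vc ω)) (a, v) = law p (fun ω => (t ω, ur ω)) a * law p vc v := by
    intro hc
    refine law_prodMk_eq_mul_of_const hp.2 (w := outC W (u ω₀)) (F := fun s w =>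
      law p (fun ω => (t ω, ur ω)) s * inputKernel p t ur uc u s.1 s.2 w) (sum_outC hW _) ?_
    rintro ⟨a, b⟩ v
    rw [← sum_law_prodMk p (fun ω => ((t ω, ur ω), vc ω)) vr]
    simp only [law_assoc p (fun ω => (t ω, ur ω)) vc vr, hpair]
    rw [Finset.sum_comm]
    refine Finset.sum_congr rfl fun w _ => ?_
    rw [← Finset.mul_sum, ← hc w (u ω₀)]
    rfl
  have hRr : (∀ a b v, outR W a v = outR W b v) → ∀ a v,
      law p (fun ω => ((t ω, ur ω), vr ω)) (a, v) = law p (fun ω => (t ω, ur ω)) a * law p vr v := by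
    intro hc
    refine law_prodMk_eq_mul_of_const hp.2 (w := outR W (u ω₀)) (F := fun s w =>
      law p (fun ω => (t ω, ur ω)) s * inputKernel p t ur uc u s.1 s.2 w) (sum_outR hW _) ?_
    rintro ⟨a, b⟩ v
    rw [← sum_law_prodMk_left p vc (fun ω => ((t ω, ur ω), vr ω))]
    have hs : ∀ v', law p (fun ω => (vc ω, (t ω, ur ω), vr ω)) (v', (a, b), v) =
        law p (fun ω => ((t ω, ur ω), vc ω, vr ω)) ((a, b), v', v) := fun v' =>
      law_comp_injective p (fun ω => ((t ω, ur ω), vc ω, vr ω)) (φ := fun s => (s.2.1, s.1, s.2.2))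
        (fun s t h => by
          simp only [Prod.mk.injEq] at h; exact Prod.ext h.2.1 (Prod.ext h.1 h.2.2)) ((a, b), v', v)
    simp only [hs, hpair]
    rw [Finset.sum_comm]
    refine Finset.sum_congr rfl fun w _ => ?_
    rw [← Finset.mul_sum, ← hc w (u ω₀)]
    rfl
  refine ⟨⟨u ω₀⟩, ChannelLetter.ofLaw hp hW (inputKernel_nonneg hp.1) (sum_inputKernel hp.1) hlaw, ?_⟩
  rw [ChannelLetter.mean_ofLaw_zero, ChannelLetter.mean_ofLaw_one, ChannelLetter.mean_ofLaw_two,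
    ChannelLetter.mean_ofLaw_three, ChannelLetter.mean_ofLaw_four, add_sub_cancel_left]
  refine ⟨(mutualInfo_nonneg_and hp.1 hp.2 _ _).1, ?_, h1, h2, h3, fun hc => ?_, fun hr =>
    ⟨?_, fun h0 => ?_⟩⟩
  · rw [mutualInfo_prodMk hp.1]
    exact le_add_of_nonneg_right (condMutualInfo_nonneg_and hp.1 _ _ _).1
  · exact mutualInfo_eq_zero (law_prodMk_eq_mul_of_prodMk (g := ur) fun a b v => hC hc (a, b) v)
  · exact mutualInfo_eq_zero (law_prodMk_eq_mul_of_prodMk (g := ur) fun a b v => hRr hr (a, b) v)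
  · have h4 := (mutualInfo_nonneg_and hp.1 hp.2 t ur).2 h0
    refine mutualInfo_eq_zero ?_
    rintro b ⟨a, v⟩
    have h5 := law_prodMk_eq_mul_of_prodMk (g := ur) (fun a b v => hRr hr (a, b) v) a v
    have h6 := hRr hr (a, b) v
    have h7 : law p (fun ω => ((t ω, ur ω), vr ω)) ((a, b), v) =
        law p (fun ω => (ur ω, t ω, vr ω)) (b, a, v) :=
      law_comp_injective p (fun ω => (ur ω, t ω, vr ω)) (φ := fun s => ((s.2.1, s.1), s.2.2))
        (fun s t h => by
          simp only [Prod.mk.injEq] at h; exact Prod.ext h.1.2 (Prod.ext h.1.1 h.2)) (b, a, v)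
    rw [← h7, h6, h5, h4]
    ring

end RegionLetters

/-! ### Source letters from the source region -/

section SourceRegion

variable {X Yc Yr Xc Xr : Type*} [Fintype X] [Fintype Yc] [Fintype Yr] {P : X × Yc × Yr → ℝ}
  {dC : X → Xc → ℝ≥0} {dR : X → Xr → ℝ≥0} {Dc Dr : ℝ}

/-- By the Markov chain, the three differences of means are I(X;Zc|Yc), I(X;Zc|Yr) and
I(X;Zr|Zc,Yr). In the last clause the chain rule turns the two vanishing rates into I(X;Zr,Zc|Yr) =
0. -/
theorem exists_letter_of_mem_sourceRegionLDS {R : ℝ × ℝ × ℝ}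
    (hR : R ∈ sourceRegionLDS P dC dR Dc Dr) : ∃ S : SourceLetter P Xc Xr,
    0 ≤ S.mean dC dR 1 ∧ S.mean dC dR 1 ≤ S.mean dC dR 0 ∧
    0 ≤ S.mean dC dR 1 - S.mean dC dR 2 ∧ S.mean dC dR 1 - S.mean dC dR 2 ≤ R.1 ∧
    0 ≤ S.mean dC dR 1 - S.mean dC dR 4 ∧ S.mean dC dR 1 - S.mean dC dR 4 ≤ R.2.1 ∧
    0 ≤ S.mean dC dR 0 - S.mean dC dR 1 - (S.mean dC dR 3 - S.mean dC dR 4) ∧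
    S.mean dC dR 0 - S.mean dC dR 1 - (S.mean dC dR 3 - S.mean dC dR 4) ≤ R.2.2 ∧
    S.mean dC dR 5 ≤ Dc ∧ S.mean dC dR 6 ≤ Dr ∧
    (R.1 ≤ 0 → ∃ g : Yc → Xc, ∑ s, P s * (dC s.1 (g s.2.1) : ℝ) ≤ Dc) ∧
    (R.2.1 ≤ 0 → R.2.2 ≤ 0 → ∃ g : Yr → Xr, ∑ s, P s * (dR s.1 (g s.2.2) : ℝ) ≤ Dr) := by
  obtain ⟨Ω, Zc, Zr, _, _, _, p, x, yc, yr, zc, zr, gc, gr, hp, hP, hm, h1, h2, h3, h4, h5⟩ := hR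
  have hΩ : Nonempty Ω := by
    by_contra h
    rw [not_nonempty_iff] at h
    simpa using hp.2
  obtain ⟨ω₀⟩ := hΩ
  have : Nonempty Zc := ⟨zc ω₀⟩
  have : Nonempty Zr := ⟨zr ω₀⟩
  have hmk := hm.isMarkov_prodMk hp.1
  have mc : IsMarkov p yc x zc :=
    ((hmk.symm.comp_right Prod.fst).symm).comp_right Prod.snd
  have mr : IsMarkov p yr x (fun ω => (zr ω, zc ω)) := (hmk.symm.comp_right Prod.snd).symm
  have mr1 : IsMarkov p yr x zc := mr.comp_right Prod.snd
  have ec := mc.condMutualInfo_eq hp.1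
  have er := mr.condMutualInfo_eq hp.1
  have er1 := mr1.condMutualInfo_eq hp.1
  have echain := condMutualInfo_prodMk hp.1 x zr zc yr
  have nc := (condMutualInfo_nonneg_and hp.1 x zc yc).1
  have nr1 := (condMutualInfo_nonneg_and hp.1 x zc yr).1
  have nr2 := (condMutualInfo_nonneg_and hp.1 x zr (fun ω => (zc ω, yr ω))).1
  refine ⟨SourceLetter.ofLaw hp hP hm gc gr, ?_⟩
  rw [SourceLetter.mean_ofLaw_zero, SourceLetter.mean_ofLaw_one, SourceLetter.mean_ofLaw_two,
    SourceLetter.mean_ofLaw_three, SourceLetter.mean_ofLaw_four, SourceLetter.mean_ofLaw_five,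
    SourceLetter.mean_ofLaw_six]
  refine ⟨(mutualInfo_nonneg_and hp.1 hp.2 _ _).1, ?_, by linarith, by linarith, by linarith,
    by linarith, by linarith, by linarith, h4, h5, fun h0 => ?_, fun h0 h0' => ?_⟩
  · rw [mutualInfo_prodMk hp.1]
    exact le_add_of_nonneg_right (condMutualInfo_nonneg_and hp.1 _ _ _).1
  · obtain ⟨g, hg⟩ := exists_estimate_of_condMutualInfo_eq_zero hp.1 (x := x) (y := yc) (z := zc)
      (by linarith) dC gc
    refine ⟨g, le_trans (le_of_eq ?_) (hg.trans h4)⟩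
    rw [← hP, sum_law_mul p (fun ω => (x ω, yc ω, yr ω)) (fun s => (dC s.1 (g s.2.1) : ℝ))]
  · obtain ⟨g, hg⟩ := exists_estimate_of_condMutualInfo_eq_zero hp.1 (x := x) (y := yr)
      (z := fun ω => (zr ω, zc ω)) (by linarith) dR (fun s => gr (s.1.1, s.2))
    refine ⟨g, le_trans (le_of_eq ?_) (hg.trans h5)⟩
    rw [← hP, sum_law_mul p (fun ω => (x ω, yc ω, yr ω)) (fun s => (dR s.1 (g s.2.2) : ℝ))]

end SourceRegion

/-! ### Expected distortion of block codes -/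

section BlockExpectation

variable {X Yc Yr U Vc Vr Xh : Type*} [Fintype Vc] [Fintype Vr]
  {P : X × Yc × Yr → ℝ} {W : U → Vc × Vr → ℝ} {m n : ℕ} {enc : (Fin n → X) → (Fin m → U)}

theorem blockProb_nonneg (hP : ∀ s, 0 ≤ P s) (hW : IsChannel W) (s : Fin n → X × Yc × Yr)
    (v : Fin m → Vc × Vr) : 0 ≤ blockProb P W enc s v :=
  mul_nonneg (Finset.prod_nonneg fun _ _ => hP _) (Finset.prod_nonneg fun _ _ => (hW _).1 _)

variable [Fintype X] [Fintype Yc] [Fintype Yr]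

theorem sum_blockProb_mul (hW : IsChannel W) (f : (Fin n → X × Yc × Yr) → ℝ) :
    ∑ s, ∑ v, blockProb P W enc s v * f s = ∑ s : Fin n → X × Yc × Yr, (∏ j, P (s j)) * f s := by
  refine Finset.sum_congr rfl fun s _ => ?_
  simp only [blockProb]
  rw [← Finset.sum_mul, ← Finset.mul_sum,
    sum_pi_prod_eq_one (fun i => W (enc (fun j => (s j).1) i)) (fun i => (hW _).2), mul_one]

theorem sum_blockProb (hP : P ∈ stdSimplex ℝ (X × Yc × Yr)) (hW : IsChannel W) :
    ∑ s, ∑ v, blockProb P W enc s v = 1 := by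
  simpa [sum_pi_prod_eq_one (ι := Fin n) (fun _ => P) fun _ => hP.2] using
    sum_blockProb_mul (P := P) (enc := enc) hW fun _ => 1

/-- Expected distortion of an estimate which ignores the channel output. -/
theorem sum_blockProb_mul_blockDist_estimate (hP : P ∈ stdSimplex ℝ (X × Yc × Yr))
    (hW : IsChannel W) (hn : 0 < n) (d : X → Xh → ℝ≥0) (g : X × Yc × Yr → Xh) :
    ∑ s, ∑ v, blockProb P W enc s v * blockDist d (fun j => (s j).1) (fun j => g (s j)) =
      ∑ s, P s * (d s.1 (g s) : ℝ) := by
  have hn' : (n : ℝ) ≠ 0 := by exact_mod_cast hn.ne'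
  rw [sum_blockProb_mul hW (fun s => blockDist d (fun j => (s j).1) (fun j => g (s j)))]
  simp only [blockDist, Finset.mul_sum]
  rw [Finset.sum_comm]
  have h : ∀ j : Fin n, ∑ s : Fin n → X × Yc × Yr, (∏ k, P (s k)) * (1 / (n : ℝ) *
      (d (s j).1 (g (s j)) : ℝ)) = 1 / (n : ℝ) * ∑ s, P s * (d s.1 (g s) : ℝ) := fun j => by
    rw [sum_pi_prod_mul_apply (fun _ => P) (fun _ => hP.2) j
      (fun s => 1 / (n : ℝ) * (d s.1 (g s) : ℝ)), Finset.mul_sum]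
    exact Finset.sum_congr rfl fun s _ => by ring
  rw [Finset.sum_congr rfl fun j _ => h j]
  simp
  field_simp

open Classical in
theorem sum_blockProb_mul_ite_le_one (hP : P ∈ stdSimplex ℝ (X × Yc × Yr)) (hW : IsChannel W)
    (q : (Fin n → X × Yc × Yr) → (Fin m → Vc × Vr) → Prop) :
    ∑ s, ∑ v, blockProb P W enc s v * (if q s v then 1 else 0) ≤ 1 := by
  refine le_trans ?_ (sum_blockProb (enc := enc) hP hW).le
  refine Finset.sum_le_sum fun s _ => Finset.sum_le_sum fun v _ => ?_
  refine mul_le_of_le_one_right (blockProb_nonneg hP.1 hW s v) ?_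
  split_ifs <;> norm_num

open Classical in
/-- Expected distortion of a reconstruction whose distortion is probably at most `M / n`. -/
theorem sum_blockProb_mul_blockDist_le (hP : P ∈ stdSimplex ℝ (X × Yc × Yr)) (hW : IsChannel W)
    (hn : 0 < n) (d : X → Xh → ℝ≥0) (r : (Fin n → X × Yc × Yr) → (Fin m → Vc × Vr) → Fin n → Xh)
    {B M : ℝ} (hM : 0 ≤ M) (hr : ∀ s v j, (d (s j).1 (r s v j) : ℝ) ≤ B) :
    ∑ s, ∑ v, blockProb P W enc s v * blockDist d (fun j => (s j).1) (r s v) ≤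
      M / n + B * (1 - ∑ s, ∑ v, blockProb P W enc s v *
        (if ∑ j, (d (s j).1 (r s v j) : ℝ) ≤ M then 1 else 0)) := by
  have hn' : (0 : ℝ) < n := by exact_mod_cast hn
  have e : M / n + B * (1 - ∑ s, ∑ v, blockProb P W enc s v *
        (if ∑ j, (d (s j).1 (r s v j) : ℝ) ≤ M then 1 else 0)) =
      ∑ s, ∑ v, blockProb P W enc s v * (M / n + B * (1 -
        (if ∑ j, (d (s j).1 (r s v j) : ℝ) ≤ M then 1 else 0))) := by
    simp only [mul_add, mul_sub, mul_one, Finset.sum_add_distrib, Finset.sum_sub_distrib,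
      ← Finset.sum_mul, sum_blockProb hP hW, mul_left_comm _ B, ← Finset.mul_sum, one_mul]
  rw [e]
  refine Finset.sum_le_sum fun s _ => Finset.sum_le_sum fun v _ =>
    mul_le_mul_of_nonneg_left ?_ (blockProb_nonneg hP.1 hW s v)
  unfold blockDist
  rw [one_div_mul_eq_div]
  split_ifs with h
  · rw [sub_self, mul_zero, add_zero]
    gcongr
  · have h1 : ∑ j, (d (s j).1 (r s v j) : ℝ) ≤ n * B := by
      simpa using Finset.sum_le_sum fun j (_ : j ∈ Finset.univ) => hr s v j
    have h2 : (∑ j, (d (s j).1 (r s v j) : ℝ)) / n ≤ B := by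
      rw [div_le_iff₀ hn']; linarith
    have h3 : 0 ≤ M / n := by positivity
    linarith

end BlockExpectation

/-! ### Time sharing between two letters, with uniform bounds -/

section TimeSharing

theorem sum_ite_val_lt {n k : ℕ} (hk : k ≤ n) (a b : ℝ) :
    ∑ j : Fin n, (if (j : ℕ) < k then a else b) = k * a + (n - k : ℝ) * b := by
  have h : ∀ j : Fin n, (if (j : ℕ) < k then a else b) = (if (j : ℕ) < k then 1 else 0) * (a - b) + b :=
    fun j => by split_ifs <;> ring
  simp only [h, Finset.sum_add_distrib, ← Finset.sum_mul, Finset.sum_boole, Fin.card_filter_val_lt,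
    min_eq_right hk]
  simp
  ring

variable {X Yc Yr U Vc Vr Xc Xr : Type*} [Fintype X] [Fintype Yc] [Fintype Yr] [Fintype U]
  [Fintype Vc] [Fintype Vr] {P : X × Yc × Yr → ℝ} {W : U → Vc × Vr → ℝ}
  {dC : X → Xc → ℝ≥0} {dR : X → Xr → ℝ≥0}

theorem exists_sourceMean_eq {n k : ℕ} (hk : k ≤ n) (S S' : SourceLetter P Xc Xr) (dC : X → Xc → ℝ≥0)
    (dR : X → Xr → ℝ≥0) : ∃ Sn : Fin n → SourceLetter P Xc Xr, (∀ j, Sn j = S ∨ Sn j = S') ∧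
      ∀ q, sourceMean Sn dC dR q = k * S.mean dC dR q + (n - k : ℝ) * S'.mean dC dR q := by
  refine ⟨fun j => if (j : ℕ) < k then S else S', fun j => ite_eq_or_eq _ _ _, fun q => ?_⟩
  rw [← sum_ite_val_lt hk]
  exact Finset.sum_congr rfl fun j _ => by dsimp only; split_ifs <;> rfl

theorem exists_channelMean_eq {m k : ℕ} (hk : k ≤ m) (L L' : ChannelLetter W) :
    ∃ Lm : Fin m → ChannelLetter W, (∀ i, Lm i = L ∨ Lm i = L') ∧
      ∀ q, channelMean Lm q = k * L.mean q + (m - k : ℝ) * L'.mean q := by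
  refine ⟨fun i => if (i : ℕ) < k then L else L', fun i => ite_eq_or_eq _ _ _, fun q => ?_⟩
  rw [← sum_ite_val_lt hk]
  exact Finset.sum_congr rfl fun j _ => by dsimp only; split_ifs <;> rfl

theorem SourceLetter.exists_sq_bound (S S' : SourceLetter P Xc Xr) (dC : X → Xc → ℝ≥0)
    (dR : X → Xr → ℝ≥0) : ∃ C, 0 ≤ C ∧ ∀ q, ∑ s, S.prob s * S.stat dC dR q s ^ 2 ≤ C ∧
      ∑ s, S'.prob s * S'.stat dC dR q s ^ 2 ≤ C := by
  refine ⟨∑ q, (|∑ s, S.prob s * S.stat dC dR q s ^ 2| +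
    |∑ s, S'.prob s * S'.stat dC dR q s ^ 2|), Finset.sum_nonneg fun q _ => by positivity,
    fun q => ?_⟩
  have h := Finset.single_le_sum (f := fun q => |∑ s, S.prob s * S.stat dC dR q s ^ 2| +
    |∑ s, S'.prob s * S'.stat dC dR q s ^ 2|) (fun q _ => by positivity) (Finset.mem_univ q)
  exact ⟨(le_abs_self _).trans ((le_add_of_nonneg_right (abs_nonneg _)).trans h),
    (le_abs_self _).trans ((le_add_of_nonneg_left (abs_nonneg _)).trans h)⟩

theorem ChannelLetter.exists_sq_bound (L L' : ChannelLetter W) : ∃ C, 0 ≤ C ∧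
    ∀ q, ∑ s, L.prob s * L.stat q s ^ 2 ≤ C ∧ ∑ s, L'.prob s * L'.stat q s ^ 2 ≤ C := by
  refine ⟨∑ q, (|∑ s, L.prob s * L.stat q s ^ 2| + |∑ s, L'.prob s * L'.stat q s ^ 2|),
    Finset.sum_nonneg fun q _ => by positivity, fun q => ?_⟩
  have h := Finset.single_le_sum (f := fun q => |∑ s, L.prob s * L.stat q s ^ 2| +
    |∑ s, L'.prob s * L'.stat q s ^ 2|) (fun q _ => by positivity) (Finset.mem_univ q)
  exact ⟨(le_abs_self _).trans ((le_add_of_nonneg_right (abs_nonneg _)).trans h),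
    (le_abs_self _).trans ((le_add_of_nonneg_left (abs_nonneg _)).trans h)⟩

/-- The reconstruction alphabet may be infinite, but reconstructions given by a function on a finite
set take finitely many values. -/
theorem exists_dist_bound {A X' Xh : Type*} [Fintype A] [Fintype X'] (d : X' → Xh → ℝ≥0) (g : A → Xh) :
    ∃ B : ℝ, 0 ≤ B ∧ ∀ x a, (d x (g a) : ℝ) ≤ B :=
  ⟨∑ s : X' × A, (d s.1 (g s.2) : ℝ), Finset.sum_nonneg fun _ _ => NNReal.coe_nonneg _, fun x a =>
    Finset.single_le_sum (f := fun s : X' × A => (d s.1 (g s.2) : ℝ))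
      (fun _ _ => NNReal.coe_nonneg _) (Finset.mem_univ (x, a))⟩

theorem SourceLetter.mean_five_nonneg (hP : ∀ s, 0 ≤ P s) (S : SourceLetter P Xc Xr) :
    0 ≤ S.mean dC dR 5 :=
  Finset.sum_nonneg fun _ _ => mul_nonneg (S.prob_nonneg hP _) (NNReal.coe_nonneg _)

theorem SourceLetter.mean_six_nonneg (hP : ∀ s, 0 ≤ P s) (S : SourceLetter P Xc Xr) :
    0 ≤ S.mean dC dR 6 :=
  Finset.sum_nonneg fun _ _ => mul_nonneg (S.prob_nonneg hP _) (NNReal.coe_nonneg _)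

end TimeSharing

/-! ### Slack from time sharing, and the choice of block lengths -/

section Slack

/-- On the first parts of source and channel the balance `I ≤ κ * A` is kept, as the channel part is
proportionally no shorter. The remaining channel uses bring at least `b` each and serve no source
letter, which leaves a surplus linear in the block length. -/
theorem mul_add_le_of_le {n n₁ m m₁ κ δ I A b B h : ℝ} (hI : 0 ≤ I) (hIA : I ≤ κ * A)
    (hm : m = κ * n) (hκ : 0 < κ) (hn₁ : n₁ ≤ (1 - δ) * n) (hδ : δ ≤ 1) (hn : 0 ≤ n)
    (hm₁ : (1 - δ) * m ≤ m₁) (hbB : b ≤ B) (hb : 0 ≤ b) (hm₁' : δ * m / 2 ≤ m - m₁)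
    (hm0 : 0 ≤ m - m₁) (hh : 12 * h ≤ δ * m / 2 * b) : n₁ * I + 12 * h ≤ m₁ * A + (m - m₁) * B := by
  have hA : 0 ≤ A := by
    by_contra hA
    nlinarith
  have h1 : n₁ * I ≤ m₁ * A := by
    calc n₁ * I ≤ (1 - δ) * n * I := mul_le_mul_of_nonneg_right hn₁ hI
      _ ≤ (1 - δ) * n * (κ * A) :=
        mul_le_mul_of_nonneg_left hIA (mul_nonneg (by linarith) hn)
      _ = (1 - δ) * m * A := by rw [hm]; ring
      _ ≤ m₁ * A := mul_le_mul_of_nonneg_right hm₁ hA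
  have h2 : δ * m / 2 * b ≤ (m - m₁) * B := mul_le_mul hm₁' hbB hb hm0
  linarith

/-- The source part is rounded down and the channel part up, both in favour of decoding. The
rounding takes less than one use from the slack `δ * m`, and half of it remains because `δ * m ≥ 2`.
-/
theorem exists_block_lengths {δ : ℝ} (hδ : 0 < δ) (hδ1 : δ ≤ 1) {m n : ℕ} (hm : 2 ≤ δ * m) :
    ∃ n₁ m₁ : ℕ, n₁ ≤ n ∧ m₁ ≤ m ∧ (n₁ : ℝ) ≤ (1 - δ) * n ∧ (n - n₁ : ℝ) ≤ δ * n + 1 ∧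
      (1 - δ) * m ≤ m₁ ∧ δ * m / 2 ≤ m - m₁ := by
  have e1 : (0 : ℝ) ≤ (1 - δ) * n := mul_nonneg (by linarith) (Nat.cast_nonneg n)
  have e2 : (0 : ℝ) ≤ (1 - δ) * m := mul_nonneg (by linarith) (Nat.cast_nonneg m)
  have f1 := Nat.floor_le e1
  have f2 := Nat.lt_floor_add_one ((1 - δ) * (n : ℝ))
  have f3 := Nat.le_ceil ((1 - δ) * (m : ℝ))
  have f4 := Nat.ceil_lt_add_one e2
  have hn0 : (0 : ℝ) ≤ δ * n := by positivity
  refine ⟨⌊(1 - δ) * (n : ℝ)⌋₊, ⌈(1 - δ) * (m : ℝ)⌉₊, ?_, ?_, f1, by linarith, f3, by linarith⟩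
  · have : ((⌊(1 - δ) * (n : ℝ)⌋₊ : ℕ) : ℝ) ≤ n := by linarith
    exact_mod_cast this
  · have : ((⌈(1 - δ) * (m : ℝ)⌉₊ : ℕ) : ℝ) ≤ m := by linarith
    exact_mod_cast this

theorem two_rpow_neg_le_inv {h : ℝ} (hh : 1 ≤ h) : (2 : ℝ) ^ (-h) ≤ h⁻¹ := by
  rw [Real.rpow_neg (by norm_num)]
  have h1 := one_add_mul_self_le_rpow_one_add (s := 1) (by norm_num) hh
  norm_num at h1
  exact inv_anti₀ (by linarith) (by linarith)

/-- The probability of failure of the code is of order `1 / n`. -/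
theorem failure_le {n m κ η CS CL θ : ℝ} (hn : 0 < n) (hη : 0 < η) (hm : m = κ * n)
    (h1 : 1 ≤ η * n) (hθ : (7 * CS / η ^ 2 + 5 * κ * CL / η ^ 2 + 8 / η) / n ≤ θ) :
    7 * (n * CS / (η * n) ^ 2) + 5 * (m * CL / (η * n) ^ 2) + 8 * (2 : ℝ) ^ (-(η * n)) ≤ θ := by
  have h2 := two_rpow_neg_le_inv h1
  refine le_trans ?_ hθ
  have e : (7 * CS / η ^ 2 + 5 * κ * CL / η ^ 2 + 8 / η) / n = 7 * (n * CS / (η * n) ^ 2) +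
      5 * (m * CL / (η * n) ^ 2) + 8 * (η * n)⁻¹ := by
    rw [hm]; field_simp
  rw [e]
  linarith

end Slack

/-! ### Achievability -/

section Achievability

variable {X Yc Yr U Vc Vr Xc Xr : Type*} [Fintype X] [Fintype Yc] [Fintype Yr] [Fintype U]
  [Fintype Vc] [Fintype Vr] {P : X × Yc × Yr → ℝ} {W : U → Vc × Vr → ℝ}
  {dC : X → Xc → ℝ≥0} {dR : X → Xr → ℝ≥0}

theorem SourceLetter.exists_trivial_letter (hP : P ∈ stdSimplex ℝ (X × Yc × Yr))
    (S : SourceLetter P Xc Xr) (dC : X → Xc → ℝ≥0) (dR : X → Xr → ℝ≥0) :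
    ∃ S' : SourceLetter P Xc Xr, ∀ q : Fin 7, q < 5 → S'.mean dC dR q = 0 := by
  obtain ⟨s⟩ : Nonempty ((X × Yc × Yr) × S.Zc × S.Zr) := by
    by_contra h
    rw [not_nonempty_iff] at h
    simpa using S.sum_prob
  exact ⟨SourceLetter.trivial hP (fun y => S.gc (s.2.1, y)) (fun y => S.gr (s.2.2, y)),
    fun q hq => SourceLetter.mean_trivial hP _ _ dC dR q hq⟩

/-- The expected distortion at a receiver whose reconstruction fails with probability at most
`2 * θ`. -/
theorem distortion_bound {n n₁ δ η ε θ D E F B p : ℝ} (hn : 0 < n) (hD : 0 ≤ E) (hED : E ≤ D)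
    (hF : 0 ≤ F) (hB : 0 ≤ B) (hn₁' : n₁ ≤ n) (hn₁ : n - n₁ ≤ δ * n + 1) (hη : η ≤ ε / 4)
    (hδ : δ * F ≤ ε / 4) (hnF : F / n ≤ ε / 4) (hθ : 2 * θ * B ≤ ε / 4) (hp : 1 - 2 * θ ≤ p) :
    (n₁ * E + (n - n₁) * F + η * n) / n + B * (1 - p) ≤ D + ε := by
  have h1 : n₁ * E + (n - n₁) * F + η * n ≤ (D + δ * F + F / n + η) * n := by
    have e1 : n₁ * E ≤ n * D := (mul_le_mul_of_nonneg_right hn₁' hD).trans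
      (mul_le_mul_of_nonneg_left hED hn.le)
    have e2 : (n - n₁) * F ≤ (δ * n + 1) * F := mul_le_mul_of_nonneg_right hn₁ hF
    have e3 : F / n * n = F := by field_simp
    linarith
  have h2 : (n₁ * E + (n - n₁) * F + η * n) / n ≤ D + δ * F + F / n + η := by
    rwa [div_le_iff₀ hn]
  have h3 : B * (1 - p) ≤ B * (2 * θ) := mul_le_mul_of_nonneg_left (by linarith) hB
  linarith

set_option maxHeartbeats 1000000 in
/-- Achievability from single-letter data: the letters `S'` and `L'` provide the slack. Each
receiver is either served by the code, or able to do without the channel. -/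
theorem achievable_of_letters [Nonempty U] (hP : P ∈ stdSimplex ℝ (X × Yc × Yr))
    (hW : IsChannel W) {κ : ℚ} (hκ : 0 < κ) {Dc Dr : ℝ} (S S' : SourceLetter P Xc Xr)
    (L L' : ChannelLetter W) (hS1 : 0 ≤ S.mean dC dR 1) (hS2 : S.mean dC dR 1 ≤ S.mean dC dR 0)
    (hSc : 0 ≤ S.mean dC dR 1 - S.mean dC dR 2) (hSr : 0 ≤ S.mean dC dR 1 - S.mean dC dR 4)
    (hSr' : 0 ≤ S.mean dC dR 0 - S.mean dC dR 1 - (S.mean dC dR 3 - S.mean dC dR 4))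
    (hDc : S.mean dC dR 5 ≤ Dc) (hDr : S.mean dC dR 6 ≤ Dr)
    (hS' : ∀ q : Fin 7, q < 5 → S'.mean dC dR q = 0)
    (hL0 : 0 ≤ L.mean 0) (hL4 : L.mean 4 ≤ L.mean 2 - L.mean 3) (hL'0 : L'.mean 0 = 0)
    (hL'4 : L'.mean 4 ≤ L'.mean 2 - L'.mean 3)
    (hc : (S.mean dC dR 1 - S.mean dC dR 2 ≤ κ * (L.mean 1 - L.mean 0) ∧ 0 < L'.mean 1) ∨
      ∃ g : Yc → Xc, ∑ s, P s * (dC s.1 (g s.2.1) : ℝ) ≤ Dc)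
    (hr : (S.mean dC dR 1 - S.mean dC dR 4 ≤ κ * (L.mean 3 - L.mean 0) ∧
        S.mean dC dR 0 - S.mean dC dR 1 - (S.mean dC dR 3 - S.mean dC dR 4) ≤
          κ * (L.mean 2 - L.mean 3) ∧ 0 < L'.mean 3 ∧ 0 < L'.mean 2 - L'.mean 3) ∨
      ∃ g : Yr → Xr, ∑ s, P s * (dR s.1 (g s.2.2) : ℝ) ≤ Dr) :
    Achievable P W dC dR κ Dc Dr := by
  classical
  intro ε hε
  have hκ' : (0 : ℝ) < κ := by exact_mod_cast hκ
  obtain ⟨αc, hαc⟩ : ∃ αc : ℝ, (αc = 1 ∧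
      (S.mean dC dR 1 - S.mean dC dR 2 ≤ κ * (L.mean 1 - L.mean 0) ∧ 0 < L'.mean 1)) ∨
      (αc = 0 ∧ ∃ g : Yc → Xc, ∑ s, P s * (dC s.1 (g s.2.1) : ℝ) ≤ Dc) := by
    rcases hc with h | h
    exacts [⟨1, Or.inl ⟨rfl, h⟩⟩, ⟨0, Or.inr ⟨rfl, h⟩⟩]
  obtain ⟨αr, hαr⟩ : ∃ αr : ℝ, (αr = 1 ∧ (S.mean dC dR 1 - S.mean dC dR 4 ≤
        κ * (L.mean 3 - L.mean 0) ∧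
        S.mean dC dR 0 - S.mean dC dR 1 - (S.mean dC dR 3 - S.mean dC dR 4) ≤
          κ * (L.mean 2 - L.mean 3) ∧ 0 < L'.mean 3 ∧ 0 < L'.mean 2 - L'.mean 3)) ∨
      (αr = 0 ∧ ∃ g : Yr → Xr, ∑ s, P s * (dR s.1 (g s.2.2) : ℝ) ≤ Dr) := by
    rcases hr with h | h
    exacts [⟨1, Or.inl ⟨rfl, h⟩⟩, ⟨0, Or.inr ⟨rfl, h⟩⟩]
  have hαc01 : 0 ≤ αc ∧ αc ≤ 1 := by rcases hαc with h | h <;> rw [h.1] <;> norm_num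
  have hαr01 : 0 ≤ αr ∧ αr ≤ 1 := by rcases hαr with h | h <;> rw [h.1] <;> norm_num
  obtain ⟨b, hb, hbc, hbr⟩ : ∃ b : ℝ, 0 < b ∧ (αc ≠ 0 → b ≤ L'.mean 1) ∧
      (αr ≠ 0 → b ≤ L'.mean 3 ∧ b ≤ L'.mean 2 - L'.mean 3) := by
    rcases hαc with h | h <;> rcases hαr with h' | h'
    · exact ⟨min (L'.mean 1) (min (L'.mean 3) (L'.mean 2 - L'.mean 3)),
        lt_min h.2.2 (lt_min h'.2.2.2.1 h'.2.2.2.2), fun _ => min_le_left _ _, fun _ =>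
        ⟨(min_le_right _ _).trans (min_le_left _ _), (min_le_right _ _).trans (min_le_right _ _)⟩⟩
    · exact ⟨L'.mean 1, h.2.2, fun _ => le_rfl, fun h0 => (h0 h'.1).elim⟩
    · exact ⟨min (L'.mean 3) (L'.mean 2 - L'.mean 3), lt_min h'.2.2.2.1 h'.2.2.2.2,
        fun h0 => (h0 h.1).elim, fun _ => ⟨min_le_left _ _, min_le_right _ _⟩⟩
    · exact ⟨1, one_pos, fun h0 => (h0 h.1).elim, fun h0 => (h0 h'.1).elim⟩
  obtain ⟨CS, hCS0, hCS⟩ := S.exists_sq_bound S' dC dR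
  obtain ⟨CL, hCL0, hCL⟩ := L.exists_sq_bound L'
  obtain ⟨Bc, hBc0, hBc⟩ := exists_dist_bound dC S.gc
  obtain ⟨Bc', hBc0', hBc'⟩ := exists_dist_bound dC S'.gc
  obtain ⟨Br, hBr0, hBr⟩ := exists_dist_bound dR S.gr
  obtain ⟨Br', hBr0', hBr'⟩ := exists_dist_bound dR S'.gr
  have hE5 := S.mean_five_nonneg (dC := dC) (dR := dR) hP.1
  have hE6 := S.mean_six_nonneg (dC := dC) (dR := dR) hP.1
  have hF5 := S'.mean_five_nonneg (dC := dC) (dR := dR) hP.1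
  have hF6 := S'.mean_six_nonneg (dC := dC) (dR := dR) hP.1
  set F := S'.mean dC dR 5 + S'.mean dC dR 6 with hF
  set B := Bc + Bc' + Br + Br' with hB
  have hF0 : 0 ≤ F := by linarith
  have hB0 : 0 ≤ B := by linarith
  have hBcn : ∀ T, T = S ∨ T = S' → ∀ (x : X) (z : T.Zc) (y : Yc), (dC x (T.gc (z, y)) : ℝ) ≤ B := by
    rintro T (rfl | rfl) x z y
    exacts [(hBc x (z, y)).trans (by linarith), (hBc' x (z, y)).trans (by linarith)]
  have hBrn : ∀ T, T = S ∨ T = S' → ∀ (x : X) (z : T.Zr) (y : Yr), (dR x (T.gr (z, y)) : ℝ) ≤ B := by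
    rintro T (rfl | rfl) x z y
    exacts [(hBr x (z, y)).trans (by linarith), (hBr' x (z, y)).trans (by linarith)]
  -- The allowance `ε` is divided into quarters: `δ` for the undescribed part of the source, `η` for
  -- the deviation of typical distortions, `θ` for failures of the code, and `F / n` for rounding.
  -- The second bound on `η` lets the slack of the mixing letter pay for `12 * h` with `h = η * n`.
  obtain ⟨δ, hδ, hδ1, hδF⟩ : ∃ δ : ℝ, 0 < δ ∧ δ ≤ 1 ∧ δ * F ≤ ε / 4 := by
    refine ⟨min 1 (ε / (4 * (F + 1))), by positivity, min_le_left _ _, ?_⟩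
    calc _ ≤ ε / (4 * (F + 1)) * (F + 1) := mul_le_mul (min_le_right _ _) (by linarith) hF0
          (by positivity)
      _ = ε / 4 := by field_simp
  obtain ⟨η, hη, hηε, hηb⟩ : ∃ η : ℝ, 0 < η ∧ η ≤ ε / 4 ∧ η ≤ δ * κ * b / 24 :=
    ⟨min (ε / 4) (δ * κ * b / 24), by positivity, min_le_left _ _, min_le_right _ _⟩
  obtain ⟨θ, hθ, hθB⟩ : ∃ θ : ℝ, 0 < θ ∧ 2 * θ * B ≤ ε / 4 := by
    refine ⟨ε / (8 * (B + 1)), by positivity, ?_⟩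
    rw [mul_div_assoc', div_mul_eq_mul_div, div_le_iff₀ (by positivity)]
    nlinarith
  set C := 7 * CS / η ^ 2 + 5 * κ * CL / η ^ 2 + 8 / η with hC
  have hC0 : 0 ≤ C := by positivity
  -- The four summands ensure in turn `1 ≤ η * n`, `2 ≤ δ * m`, failure probability at most `θ`, and
  -- `F / n ≤ ε / 4`.
  refine ⟨⌈1 / η + 2 / (δ * κ) + C / θ + 4 * F / ε⌉₊, fun m n hm hn₀ hmn => ?_⟩
  have hn1 : 1 / η + 2 / (δ * κ) + C / θ + 4 * F / ε ≤ n :=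
    (Nat.le_ceil _).trans (by exact_mod_cast hn₀.le)
  have hnN : 0 < n := lt_of_le_of_lt (Nat.zero_le _) hn₀
  have hn : (0 : ℝ) < n := by exact_mod_cast hnN
  have hmκ : (m : ℝ) = κ * n := by
    have : (m : ℚ) = κ * n := by
      rw [← hmn]; field_simp
    exact_mod_cast this
  have t1 : 0 < 1 / η := by positivity
  have t2 : 0 < 2 / (δ * κ) := by positivity
  have t3 : 0 ≤ C / θ := by positivity
  have t4 : 0 ≤ 4 * F / ε := by positivity
  have hh : 1 ≤ η * n := by
    rw [← div_le_iff₀' hη]; linarith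
  have hδm : 2 ≤ δ * m := by
    rw [hmκ, ← mul_assoc, ← div_le_iff₀' (by positivity)]; linarith
  have hCθ : C / n ≤ θ := by
    rw [div_le_iff₀ hn, ← div_le_iff₀' hθ]; linarith
  have hFn : F / n ≤ ε / 4 := by
    rw [div_le_iff₀ hn]
    have : 4 * F ≤ n * ε := by rw [← div_le_iff₀ hε]; linarith
    linarith
  obtain ⟨n₁, m₁, hn₁n, hm₁m, hn₁, hn₁', hm₁, hm₁'⟩ := exists_block_lengths (n := n) hδ hδ1 hδm
  have hn₁0 : (0 : ℝ) ≤ n₁ := Nat.cast_nonneg _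
  have hm₁0 : (0 : ℝ) ≤ m₁ := Nat.cast_nonneg _
  have hn₁R : (n₁ : ℝ) ≤ n := by exact_mod_cast hn₁n
  have hm₁R : (m₁ : ℝ) ≤ m := by exact_mod_cast hm₁m
  have hη12 : 12 * (η * n) ≤ δ * m / 2 * b := by
    rw [hmκ]
    have := mul_le_mul_of_nonneg_right hηb hn.le
    linarith
  have key : ∀ {I A B' : ℝ}, 0 ≤ I → I ≤ κ * A → b ≤ B' →
      n₁ * I + 12 * (η * n) ≤ m₁ * A + (m - m₁) * B' := fun hI hA hB' =>
    mul_add_le_of_le hI hA hmκ hκ' hn₁ hδ1 hn.le hm₁ hB' hb.le hm₁' (by linarith) hη12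
  obtain ⟨Sn, hSn, sm⟩ := exists_sourceMean_eq hn₁n S S' dC dR
  obtain ⟨Lm, hLm, cm⟩ := exists_channelMean_eq hm₁m L L'
  have sm0 : ∀ q : Fin 7, q < 5 → sourceMean Sn dC dR q = n₁ * S.mean dC dR q := fun q hq => by
    rw [sm, hS' q hq, mul_zero, add_zero]
  have hcm0 : channelMean Lm 0 = m₁ * L.mean 0 := by rw [cm, hL'0, mul_zero, add_zero]
  have hs0 := sm0 0 (by decide)
  have hs1 := sm0 1 (by decide)
  have hs2 := sm0 2 (by decide)
  have hs3 := sm0 3 (by decide)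
  have hs4 := sm0 4 (by decide)
  have hc1 := cm 1
  have hc2 := cm 2
  have hc3 := cm 3
  have hc4 := cm 4
  obtain ⟨code, hdC, hdR, hcode⟩ := exists_code (S := Sn) (L := Lm) (dC := dC) (dR := dR)
    (h := η * n) (CS := CS) (CL := CL) (αc := αc) (αr := αr) hP hW hh
    (fun j q => by
      rcases hSn j with h | h <;> rw [h]
      exacts [(hCS q).1, (hCS q).2])
    (fun i q => by
      rcases hLm i with h | h <;> rw [h]
      exacts [(hCL q).1, (hCL q).2])
    (by rw [hs1]; positivity)
    (by rw [hs1, hs0]; exact mul_le_mul_of_nonneg_left hS2 hn₁0)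
    (by rw [hcm0]; positivity) hαc01.1 hαr01.1
    (fun h0 => by
      have hu : S.mean dC dR 1 - S.mean dC dR 2 ≤ κ * (L.mean 1 - L.mean 0) := by
        rcases hαc with h | h
        exacts [h.2.1, (h0 h.1).elim]
      have k1 := key hSc hu (hbc h0)
      have k2 : 0 ≤ (n₁ : ℝ) * (S.mean dC dR 1 - S.mean dC dR 2) := mul_nonneg hn₁0 hSc
      rw [hs1, hs2, hcm0, hc1]
      -- The inequality for a wrong cluster is `k1`; the one for a wrong `t` is weaker by the
      -- nonnegative source term `k2`.
      constructor <;> linarith)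
    (fun h0 => by
      obtain ⟨hu1, hu2⟩ : S.mean dC dR 1 - S.mean dC dR 4 ≤ κ * (L.mean 3 - L.mean 0) ∧
          S.mean dC dR 0 - S.mean dC dR 1 - (S.mean dC dR 3 - S.mean dC dR 4) ≤
            κ * (L.mean 2 - L.mean 3) := by
        rcases hαr with h | h
        exacts [⟨h.2.1, h.2.2.1⟩, (h0 h.1).elim]
      have k1 := key hSr hu1 (hbr h0).1
      have k2 := key hSr' hu2 (hbr h0).2
      have k3 : 0 ≤ (n₁ : ℝ) * (S.mean dC dR 1 - S.mean dC dR 4) := mul_nonneg hn₁0 hSr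
      have k4 := mul_nonneg hn₁0 hSr'
      have k5 := mul_le_mul_of_nonneg_left hL4 hm₁0
      have k6 := mul_le_mul_of_nonneg_left hL'4 (sub_nonneg.2 hm₁R)
      have k7 : 0 < η * n := by linarith
      rw [hs0, hs1, hs3, hs4, hcm0, hc2, hc3, hc4]
      -- A wrong satellite needs `k2` alone and a wrong cluster the sum of `k1` and `k2`. For the
      -- other two events the nonnegative terms `k3`, `k4` are dropped, and `k5`, `k6` compare
      -- I(Ur;Vr) with I(Ur;T,Vr).
      refine ⟨?_, ?_, ?_, ?_⟩ <;> linarith)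
  have hfail := failure_le (CS := CS) (CL := CL) hn hη hmκ hh hCθ
  have hle1 := sum_blockProb_mul_ite_le_one (enc := code.enc) hP hW fun s v =>
    ∑ j, (dC (s j).1 (code.decC (fun i => (v i).1) (fun j => (s j).2.1) j) : ℝ) ≤
      sourceMean Sn dC dR 5 + η * n
  have hle2 := sum_blockProb_mul_ite_le_one (enc := code.enc) hP hW fun s v =>
    ∑ j, (dR (s j).1 (code.decR (fun i => (v i).2) (fun j => (s j).2.2) j) : ℝ) ≤
      sourceMean Sn dC dR 6 + η * n
  set pc := ∑ s : Fin n → X × Yc × Yr, ∑ v : Fin m → Vc × Vr, blockProb P W code.enc s v *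
    if ∑ j, (dC (s j).1 (code.decC (fun i => (v i).1) (fun j => (s j).2.1) j) : ℝ) ≤
      sourceMean Sn dC dR 5 + η * n then (1 : ℝ) else 0 with hpc
  set pr := ∑ s : Fin n → X × Yc × Yr, ∑ v : Fin m → Vc × Vr, blockProb P W code.enc s v *
    if ∑ j, (dR (s j).1 (code.decR (fun i => (v i).2) (fun j => (s j).2.2) j) : ℝ) ≤
      sourceMean Sn dC dR 6 + η * n then (1 : ℝ) else 0 with hpr
  -- Since `pc` and `pr` are at most 1, a bound on their weighted sum bounds each served receiver:
  -- its success probability is at least `1 - 2 * θ`.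
  have hcode' : (αc + αr) * (1 - θ) ≤ αc * pc + αr * pr :=
    le_trans (mul_le_mul_of_nonneg_left (by linarith) (by linarith)) hcode
  have decC : ∃ dec : (Fin m → Vc) → (Fin n → Yc) → (Fin n → Xc),
      ∑ s : Fin n → X × Yc × Yr, ∑ v : Fin m → Vc × Vr, blockProb P W code.enc s v *
        blockDist dC (fun j => (s j).1) (dec (fun i => (v i).1) (fun j => (s j).2.1)) ≤ Dc + ε := by
    rcases hαc with h | ⟨-, g, hg⟩
    · refine ⟨code.decC, (sum_blockProb_mul_blockDist_le (M := sourceMean Sn dC dR 5 + η * n)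
        (B := B) hP hW hnN dC (fun s v => code.decC (fun i => (v i).1) (fun j => (s j).2.1))
        ?_ fun s v j => ?_).trans ?_⟩
      · rw [sm]
        have := mul_nonneg (sub_nonneg.2 hn₁R) hF5
        positivity
      -- Even a wrongly decoded word is passed through the functions `gc`, so the distortion never
      -- exceeds `B`.
      · obtain ⟨z, hz⟩ := hdC (fun i => (v i).1) (fun j => (s j).2.1)
        rw [hz]
        exact hBcn _ (hSn j) _ _ _
      · rw [← hpc, sm]
        rw [h.1] at hcode'
        have : αr * pr ≤ αr := mul_le_of_le_one_right hαr01.1 hle2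
        have : αr * θ ≤ θ := mul_le_of_le_one_left hθ.le hαr01.2
        exact distortion_bound hn hE5 hDc hF5 hB0 hn₁R hn₁' hηε
          (le_trans (mul_le_mul_of_nonneg_left (by linarith) hδ.le) hδF)
          (le_trans (div_le_div_of_nonneg_right (by linarith) hn.le) hFn) hθB (by linarith)
    · refine ⟨fun _ y j => g (y j), ?_⟩
      rw [sum_blockProb_mul_blockDist_estimate hP hW hnN dC (fun s => g s.2.1)]
      linarith
  have decR : ∃ dec : (Fin m → Vr) → (Fin n → Yr) → (Fin n → Xr),
      ∑ s : Fin n → X × Yc × Yr, ∑ v : Fin m → Vc × Vr, blockProb P W code.enc s v *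
        blockDist dR (fun j => (s j).1) (dec (fun i => (v i).2) (fun j => (s j).2.2)) ≤ Dr + ε := by
    rcases hαr with h | ⟨-, g, hg⟩
    · refine ⟨code.decR, (sum_blockProb_mul_blockDist_le (M := sourceMean Sn dC dR 6 + η * n)
        (B := B) hP hW hnN dR (fun s v => code.decR (fun i => (v i).2) (fun j => (s j).2.2))
        ?_ fun s v j => ?_).trans ?_⟩
      · rw [sm]
        have := mul_nonneg (sub_nonneg.2 hn₁R) hF6
        positivity
      · obtain ⟨z, hz⟩ := hdR (fun i => (v i).2) (fun j => (s j).2.2)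
        rw [hz]
        exact hBrn _ (hSn j) _ _ _
      · rw [← hpr, sm]
        rw [h.1] at hcode'
        have : αc * pc ≤ αc := mul_le_of_le_one_right hαc01.1 hle1
        have : αc * θ ≤ θ := mul_le_of_le_one_left hθ.le hαc01.2
        exact distortion_bound hn hE6 hDr hF6 hB0 hn₁R hn₁' hηε
          (le_trans (mul_le_mul_of_nonneg_left (by linarith) hδ.le) hδF)
          (le_trans (div_le_div_of_nonneg_right (by linarith) hn.le) hFn) hθB (by linarith)
    · refine ⟨fun _ y j => g (y j), ?_⟩
      rw [sum_blockProb_mul_blockDist_estimate hP hW hnN dR (fun s => g s.2.2)]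
      linarith
  obtain ⟨decc, hdecc⟩ := decC
  obtain ⟨decr, hdecr⟩ := decR
  exact ⟨⟨code.enc, decc, decr⟩, hdecc, hdecr⟩

theorem achievable_of_mem {κ : ℚ} (hκ : 0 < κ) (hW : IsChannel W) {Dc Dr : ℝ} {R : ℝ × ℝ × ℝ}
    (hP : P ∈ stdSimplex ℝ (X × Yc × Yr)) (hs : R ∈ sourceRegionLDS P dC dR Dc Dr)
    (hc : R ∈ channelRegionLDS W κ) : Achievable P W dC dR κ Dc Dr := by
  have hκ' : (0 : ℝ) < κ := by exact_mod_cast hκ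
  obtain ⟨hU, L, hL0, hL4, hR1, hR2, hR3, hcC, hcR⟩ := exists_letter_of_mem_channelRegionLDS hW hc
  obtain ⟨S, hS1, hS2, hSc, hScR, hSr, hSrR, hSr', hSrR', hDc, hDr, hec, her⟩ :=
    exists_letter_of_mem_sourceRegionLDS hs
  obtain ⟨L', hL'0, hL'1, hL'3, hL'23, hL'4, hL'c, hL'r⟩ := exists_mixing_letter hW
  obtain ⟨S', hS'⟩ := S.exists_trivial_letter hP dC dR
  refine achievable_of_letters hP hW hκ S S' L L' hS1 hS2 hSc hSr hSr' hDc hDr hS' hL0 hL4 hL'0 hL'4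
    ?_ ?_
  -- If the mixing letter gives no rate to receiver `c`, then `I(T;Vc) = 0` for the given letter as
  -- well, which forces `R.1 ≤ 0`.
  · rcases hL'1.eq_or_lt with h | h
    · refine Or.inr (hec ?_)
      rw [hcC (hL'c h.symm)] at hR1
      nlinarith
    · exact Or.inl ⟨by linarith, h⟩
  · by_cases h : L'.mean 3 = 0 ∨ L'.mean 2 - L'.mean 3 = 0
    · obtain ⟨h3, h4⟩ := hcR (hL'r h)
      -- With I(T;Vr) = 0 the bounds 0 ≤ R_cr ≤ -κ I(T;Ur) leave only I(T;Ur) = 0.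
      have h0 : L.mean 0 = 0 := by
        rw [h3] at hR2
        nlinarith
      rw [h4 h0] at hR3
      rw [h3, h0] at hR2
      exact Or.inr (her (by linarith) (by linarith))
    · push Not at h
      exact Or.inl ⟨by linarith, by linarith, lt_of_le_of_ne hL'3 h.1.symm,
        lt_of_le_of_ne hL'23 h.2.symm⟩

end Achievability

end

end WZBC

theorem theorem2 {U : Type w₁} {Vc : Type w₂} {Vr : Type w₃}
    [Fintype U] [Fintype Vc] [Fintype Vr]
    (W : U → Vc × Vr → ℝ) (hW : WZBC.IsChannel W) (κ : ℚ) (hκ : 0 < κ) :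
    WZBC.channelRegionLDS W κ ⊆ WZBC.capacityWZBC.{u, v, w₁, w₂, w₃} W κ ∧
    ∀ (X Yc Yr : Type u) (Xc Xr : Type v) [Fintype X] [Fintype Yc] [Fintype Yr]
      (P : X × Yc × Yr → ℝ) (_ : P ∈ stdSimplex ℝ (X × Yc × Yr))
      (dC : X → Xc → NNReal) (dR : X → Xr → NNReal) (Dc Dr : ℝ),
      (WZBC.sourceRegionLDS P dC dR Dc Dr ∩ WZBC.channelRegionLDS W κ).Nonempty →
      WZBC.Achievable P W dC dR κ Dc Dr := by
  have key : ∀ (X Yc Yr : Type u) (Xc Xr : Type v) [Fintype X] [Fintype Yc] [Fintype Yr]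
      (P : X × Yc × Yr → ℝ) (dC : X → Xc → NNReal) (dR : X → Xr → NNReal) (Dc Dr : ℝ)
      (R : ℝ × ℝ × ℝ), P ∈ stdSimplex ℝ (X × Yc × Yr) → R ∈ WZBC.sourceRegionLDS P dC dR Dc Dr →
      R ∈ WZBC.channelRegionLDS W κ → WZBC.Achievable P W dC dR κ Dc Dr :=
    fun _ _ _ _ _ _ _ _ _ _ _ _ _ _ hP hs hc => WZBC.achievable_of_mem hκ hW hP hs hc
  exact ⟨fun R hR X Yc Yr Xc Xr _ _ _ P dC dR Dc Dr hP hs =>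
      key X Yc Yr Xc Xr P dC dR Dc Dr R hP hs hR,
    fun X Yc Yr Xc Xr _ _ _ P hP dC dR Dc Dr ⟨R, hs, hc⟩ =>
      key X Yc Yr Xc Xr P dC dR Dc Dr R hP hs hc⟩
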